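/- Let $N\ge 0$, $\gamma>0$, and let $L=\sum_{i,j=1}^N a_{ij}\partial_i\partial_j+\sum_{i=1}^N b_i\partial_i+c$ be a differential operator on $\mathbb R^N$ with real coefficients in $C_b^\infty(\mathbb R^N)$ (smooth, bounded together with all derivatives), with $A(x)=[a_{ij}(x)]$ symmetric and $\sum_{i,j} a_{ij}(x)\xi_i\xi_j\ge\gamma|\xi|^2$ for all $x,\xi\in\mathbb R^N$. For $z\in\mathbb R^N$ and $s\in\mathbb R$ put $f^{s,z}(x)=f(z+s(x-z))$, $$L^{s,z}=\sum_{i,j} a_{ij}^{s,z}\partial_i\partial_j+s\sum_i b_i^{s,z}\partial_i+s^2c^{s,z},\qquad L_m^z=\frac1{m!}\frac{d^m}{ds^m}L^{s,z}\Big|_{s=0},\qquad L_0^z=\sum_{i,j}a_{ij}(z)\partial_i\partial_j .$$ For $1<p<\infty$ and $a\in\mathbb R$ let $L^p_a=\{f: e^{a\langle x\rangle}f\in L^p(\mathbb R^N)\}$ with $\langle x\rangle=(1+|x|^2)^{1/2}$ (complex-valued functions), and let $e^{tL_0^z}f=u(t)$, where $u$ is the classical solution in $L^p_a$ of $\partial_tu=L_0^zu$,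 $u(0)=f$. For a multi-index $\alpha=(\alpha_1,\dots,\alpha_k)$ of positive integers with $|\alpha|=\sum_j\alpha_j=\ell$ put $$\Lambda_{\alpha,z}=\int_{\Sigma_k}e^{\tau_0L_0^z}L^z_{\alpha_1}e^{\tau_1L_0^z}L^z_{\alpha_2}\cdots L^z_{\alpha_k}e^{\tau_kL_0^z}\,d\tau,$$ where $\Sigma_k=\{\tau\in[0,\infty)^{k+1}:\sum_j\tau_j=1\}$ and $d\tau$ is Lebesgue measure in the coordinates $\sigma_j=\tau_j+\dots+\tau_k$, $1\le j\le k$; for $\ell=0$, $\alpha$ is the empty multi-index and $\Lambda_{\emptyset,z}=e^{L_0^z}$. Put $\Lambda_z^\ell=\sum_{|\alpha|=\ell}\Lambda_{\alpha,z}$. Let $$G(z;x)=(4\pi)^{-N/2}\det(A(z))^{-1/2}e^{-x^TA(z)^{-1}x/4}.$$ Then for every integer $\ell\ge 0$ and every such $\alpha$ with $|\alpha|=\ell$ there are real functions $a_{\beta,\beta'}\in C_b^\infty(\mathbb R^N)$, indexed by $\beta,\beta'\in\mathbb Z_+^N$ with $|\beta|\le\ell$, $|\beta'|\le3\ell$ and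 depending only on $L$ and $\alpha$, such that, with $$\mathfrak P_\alpha(z,x,y)=\sum_{|\beta|\le\ell,\ |\beta'|\le3\ell}a_{\beta,\beta'}(z)(x-z)^\beta(x-y)^{\beta'},$$ for every $z\in\mathbb R^N$ the operator $\Lambda_{\alpha,z}$ has the smooth kernel $\mathfrak P_\alpha(z,x,y)\,G(z;x-y)$. That is, for all $1<p<\infty$, $b<a$ and $f\in L^p_a$, the integral defining $\Lambda_{\alpha,z}f$ converges absolutely in $L^p_b$, and for almost every $x$ $$\Lambda_{\alpha,z}f(x)=\int_{\mathbb R^N}\mathfrak P_\alpha(z,x,y)\,G(z;x-y)\,f(y)\,dy,$$ the integral on the right being absolutely convergent for every $x$. Consequently $\Lambda_z^\ell$ has the kernel $\mathfrak P^\ell(z,x,y)\,G(z;x-y)$ with $\mathfrak P^\ell=\sum_{|\alpha|=\ell}\mathfrak P_\alpha$, which is of the same form. -/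

import Mathlib

open MeasureTheory Filter Topology
open scoped ENNReal ContDiff Matrix

noncomputable section

namespace DysonTaylor

/-- The space `ℝ^N` with the Euclidean norm and Lebesgue measure. -/
abbrev E (N : ℕ) : Type := EuclideanSpace ℝ (Fin N)

/-- `f ∈ C_b^∞(ℝ^N)`: `f` is smooth and `f` and all its derivatives are bounded. -/
def IsCbInfty {N : ℕ} (f : E N → ℝ) : Prop :=
  ContDiff ℝ ∞ f ∧ ∀ m : ℕ, ∃ C : ℝ, ∀ x, ‖iteratedFDeriv ℝ m f x‖ ≤ C

/-! ### Weak derivatives and exponentially weighted Sobolev spaces -/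

/-- `g` is the weak partial derivative of `f` in the `i`-th coordinate direction. -/
def HasWeakPartial {N : ℕ} (i : Fin N) (f g : E N → ℂ) : Prop :=
  LocallyIntegrable f ∧ LocallyIntegrable g ∧
    ∀ φ : E N → ℝ, ContDiff ℝ ∞ φ → HasCompactSupport φ →
      ∫ x, fderiv ℝ φ x (EuclideanSpace.single i 1) • f x = -∫ x, φ x • g x

open Classical in
/-- The weak partial derivative `∂_i f` (determined almost everywhere);
the zero function if there is none. -/
def weakPartial {N : ℕ} (i : Fin N) (f : E N → ℂ) : E N → ℂ :=
  if h : ∃ g, HasWeakPartial i f g then h.choose else 0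

/-- `f ∈ W^{m,p}(ℝ^N)`: the weak derivatives of `f` of order at most `m` exist and are in `L^p`. -/
def MemSobolev {N : ℕ} (p : ℝ≥0∞) : ℕ → (E N → ℂ) → Prop
  | 0, f => MemLp f p
  | m + 1, f => MemLp f p ∧ ∀ i, ∃ g, HasWeakPartial i f g ∧ MemSobolev p m g

/-- The weight `e^{a⟨x⟩}`, where `⟨x⟩ = (1 + |x|²)^{1/2}`. -/
def weight {N : ℕ} (a : ℝ) (x : E N) : ℝ := Real.exp (a * Real.sqrt (1 + ‖x‖ ^ 2))

/-- `f ∈ L^p_a`, that is `e^{a⟨x⟩} f ∈ L^p`. -/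
def MemWLp {N : ℕ} (p : ℝ≥0∞) (a : ℝ) (f : E N → ℂ) : Prop :=
  MemLp (fun x => weight a x • f x) p

/-- `f ∈ W^{m,p}_a`, that is `e^{a⟨x⟩} f ∈ W^{m,p}`. -/
def MemWSobolev {N : ℕ} (m : ℕ) (p : ℝ≥0∞) (a : ℝ) (f : E N → ℂ) : Prop :=
  MemSobolev p m (fun x => weight a x • f x)

open Classical in
/-- The isometry `f ↦ e^{a⟨x⟩} f` of `L^p_a` onto the Banach space `L^p`, through which limits,
derivatives and integrals in `L^p_a` are expressed (extended by zero to all functions). -/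
def toWLp {N : ℕ} (p : ℝ≥0∞) (a : ℝ) (f : E N → ℂ) : Lp ℂ p (volume : Measure (E N)) :=
  if h : MemWLp p a f then MemLp.toLp _ h else 0

/-! ### Differential operators -/

/-- The coefficients of `∑ a_ij ∂_i ∂_j + ∑ b_i ∂_i + c`. -/
structure DiffOp (N : ℕ) where
  a : Fin N → Fin N → E N → ℝ
  b : Fin N → E N → ℝ
  c : E N → ℝ

namespace DiffOp

variable {N : ℕ}

/-- The operator applied to a function, with weak derivatives. -/
def apply (M : DiffOp N) (u : E N → ℂ) : E N → ℂ := fun x =>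
  (∑ i, ∑ j, M.a i j x • weakPartial i (weakPartial j u) x)
    + (∑ i, M.b i x • weakPartial i u x) + M.c x • u x

/-- The class `𝕃_γ`: real coefficients in `C_b^∞`, a symmetric matrix `[a_ij]`, and uniform
strong ellipticity with constant `γ`. -/
structure IsElliptic (L : DiffOp N) (γ : ℝ) : Prop where
  a_cb : ∀ i j, IsCbInfty (L.a i j)
  b_cb : ∀ i, IsCbInfty (L.b i)
  c_cb : IsCbInfty L.c
  symm : ∀ i j x, L.a i j x = L.a j i x
  elliptic : ∀ x ξ : E N, γ * ‖ξ‖ ^ 2 ≤ ∑ i, ∑ j, L.a i j x * ξ i * ξ j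

/-- The rescaled operator `L^{s,z} = ∑ a_ij^{s,z} ∂_i ∂_j + s ∑ b_i^{s,z} ∂_i + s² c^{s,z}`,
where `f^{s,z}(x) = f(z + s(x - z))`. -/
def dilate (L : DiffOp N) (s : ℝ) (z : E N) : DiffOp N where
  a i j x := L.a i j (z + s • (x - z))
  b i x := s * L.b i (z + s • (x - z))
  c x := s ^ 2 * L.c (z + s • (x - z))

/-- The Taylor coefficient `L_m^z = (1/m!) (d/ds)^m L^{s,z}` at `s = 0`. -/
def taylor (L : DiffOp N) (z : E N) (m : ℕ) : DiffOp N where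
  a i j x := iteratedDeriv m (fun s => (L.dilate s z).a i j x) 0 / m.factorial
  b i x := iteratedDeriv m (fun s => (L.dilate s z).b i x) 0 / m.factorial
  c x := iteratedDeriv m (fun s => (L.dilate s z).c x) 0 / m.factorial

/-- The operator `L_0^z = ∑ a_ij(z) ∂_i ∂_j`. -/
def frozen (L : DiffOp N) (z : E N) : DiffOp N where
  a i j _ := L.a i j z
  b _ _ := 0
  c _ := 0

end DiffOp

/-! ### The solution operators `e^{tM}` -/

/-- `u` is a classical solution in `L^p_a` of `∂_t u = M u`, `u(0) = f`: it is continuous on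
`[0,∞)` with values in `L^p_a`, continuously differentiable on `(0,∞)` with values in `L^p_a`, and
for `t > 0` it takes values in the domain `W^{2,p}_a` of `M` and satisfies the equation. (Because
of the equation, continuity for the graph norm of the domain is the continuity of `u` and `u'`.) -/
structure IsClassicalSolution {N : ℕ} (M : DiffOp N) (p : ℝ≥0∞) [Fact (1 ≤ p)] (a : ℝ)
    (f : E N → ℂ) (u : ℝ → E N → ℂ) : Prop where
  mem : ∀ t, 0 ≤ t → MemWLp p a (u t)
  cont : ContinuousOn (fun t => toWLp p a (u t)) (Set.Ici 0)
  initial : u 0 =ᵐ[volume] f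
  domain : ∀ t, 0 < t → MemWSobolev 2 p a (u t) ∧ MemWLp p a (M.apply (u t))
  deriv : ∀ t, 0 < t →
    HasDerivAt (fun r => toWLp p a (u r)) (toWLp p a (M.apply (u t))) t
  cont_deriv : ContinuousOn (fun t => toWLp p a (M.apply (u t))) (Set.Ioi 0)

open Classical in
/-- `e^{tM} f := u(t)`, where `u` is the classical solution in `L^p_a` with initial value `f`. -/
def expOp {N : ℕ} (M : DiffOp N) (p : ℝ≥0∞) [Fact (1 ≤ p)] (a : ℝ) (t : ℝ) (f : E N → ℂ) :
    E N → ℂ :=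
  if h : ∃ u, IsClassicalSolution M p a f u then h.choose t else 0

/-! ### The terms of the perturbative expansion -/

/-- The simplex `1 ≥ σ_1 ≥ ⋯ ≥ σ_k ≥ 0`. -/
def simplex (k : ℕ) : Set (Fin k → ℝ) := {σ | Antitone σ ∧ ∀ i, 0 ≤ σ i ∧ σ i ≤ 1}

/-- `(τ_0, …, τ_k) = (1 - σ_1, σ_1 - σ_2, …, σ_{k-1} - σ_k, σ_k)`. -/
def simplexTau {k : ℕ} (σ : Fin k → ℝ) : Fin (k + 1) → ℝ := fun j =>
  Fin.cons (α := fun _ => ℝ) 1 σ j - Fin.snoc (α := fun _ => ℝ) σ 0 j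

/-- `e^{τ_0 L_0^z} L_{α_1}^z e^{τ_1 L_0^z} L_{α_2}^z ⋯ L_{α_k}^z e^{τ_k L_0^z} f`, where the
exponentials act on `L^p_a`. -/
def dysonIntegrand {N : ℕ} (L : DiffOp N) (z : E N) (p : ℝ≥0∞) [Fact (1 ≤ p)] (a : ℝ) :
    (k : ℕ) → (Fin k → ℕ) → (Fin (k + 1) → ℝ) → (E N → ℂ) → E N → ℂ
  | 0, _, τ, f => expOp (L.frozen z) p a (τ 0) f
  | k + 1, α, τ, f =>
      expOp (L.frozen z) p a (τ 0)
        ((L.taylor z (α 0)).apply (dysonIntegrand L z p a k (Fin.tail α) (Fin.tail τ) f))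

/-- The integral over the simplex that defines `Λ_{α,z} f` converges absolutely in `L^p_a`. -/
def LambdaConverges {N : ℕ} (L : DiffOp N) (z : E N) {k : ℕ} (α : Fin k → ℕ)
    (p : ℝ≥0∞) [Fact (1 ≤ p)] (a : ℝ) (f : E N → ℂ) : Prop :=
  (∀ᵐ σ ∂(volume.restrict (simplex k)),
      MemWLp p a (dysonIntegrand L z p a k α (simplexTau σ) f)) ∧
    IntegrableOn (fun σ => toWLp p a (dysonIntegrand L z p a k α (simplexTau σ) f)) (simplex k)

/-- `Λ_{α,z} f = ∫_{Σ_k} e^{τ_0 L_0^z} L_{α_1}^z e^{τ_1 L_0^z} ⋯ L_{α_k}^z e^{τ_k L_0^z} f dτ`,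
an integral with values in `L^p_a`. -/
def Lambda {N : ℕ} (L : DiffOp N) (z : E N) {k : ℕ} (α : Fin k → ℕ)
    (p : ℝ≥0∞) [Fact (1 ≤ p)] (a : ℝ) (f : E N → ℂ) : E N → ℂ := fun x =>
  weight (-a) x •
    (∫ σ in simplex k, toWLp p a (dysonIntegrand L z p a k α (simplexTau σ) f)) x

/-- `Λ_z^ℓ`, the sum of `Λ_{α,z}` over all multi-indices `α = (α_1, …, α_k)` of positive integers
with `|α| = ℓ`; these multi-indices are the compositions of `ℓ`. -/
def LambdaSum {N : ℕ} (L : DiffOp N) (z : E N) (ℓ : ℕ)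
    (p : ℝ≥0∞) [Fact (1 ≤ p)] (a : ℝ) (f : E N → ℂ) : E N → ℂ := fun x =>
  ∑ α : Composition ℓ, Lambda L z α.blocksFun p a f x

/-- The smooth function `K` is the kernel of the operator `T`, which is given as a family of maps
`L^p_a → L^p_b`, `1 < p < ∞`, `b < a` (the map is written with the target weight `b`):
`T f (x) = ∫ K(x,y) f(y) dy`. -/
def HasSmoothKernel {N : ℕ} (T : (p : ℝ≥0∞) → [Fact (1 ≤ p)] → ℝ → (E N → ℂ) → E N → ℂ)
    (K : E N → E N → ℝ) : Prop :=
  ContDiff ℝ ∞ (fun q : E N × E N => K q.1 q.2) ∧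
    ∀ (p : ℝ≥0∞) [Fact (1 ≤ p)], 1 < p → p ≠ ⊤ → ∀ a b : ℝ, b < a →
      ∀ f : E N → ℂ, MemWLp p a f →
        (∀ x, Integrable (fun y => K x y • f y)) ∧
          T p b f =ᵐ[volume] fun x => ∫ y, K x y • f y

/-! ### The explicit kernels -/

/-- The matrix `A(z) = [a_ij(z)]`. -/
def matA {N : ℕ} (L : DiffOp N) (z : E N) : Matrix (Fin N) (Fin N) ℝ :=
  Matrix.of fun i j => L.a i j z

/-- `G(z; x) = (4π)^{-N/2} det(A(z))^{-1/2} e^{-xᵀ A(z)⁻¹ x / 4}`. -/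
def gaussG {N : ℕ} (L : DiffOp N) (z x : E N) : ℝ :=
  (4 * Real.pi) ^ (-(N : ℝ) / 2) * (matA L z).det ^ (-(1 / 2) : ℝ)
    * Real.exp (-(x.ofLp ⬝ᵥ ((matA L z)⁻¹ *ᵥ x.ofLp)) / 4)

/-- The multi-indices `β ∈ ℕ^N` with `|β| ≤ d`. -/
def multiIdx (N d : ℕ) : Finset (Fin N → ℕ) :=
  (Fintype.piFinset fun _ => Finset.range (d + 1)).filter fun β => ∑ i, β i ≤ d

/-- The monomial `x^β`. -/
def mono {N : ℕ} (β : Fin N → ℕ) (x : E N) : ℝ := ∏ i, x i ^ β i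

/-- `∑ a_{β,β'}(z) (x-z)^β (x-y)^{β'}`, summed over `|β| ≤ ℓ` and `|β'| ≤ 3ℓ`. -/
def polyP {N : ℕ} (ℓ : ℕ) (coef : (Fin N → ℕ) → (Fin N → ℕ) → E N → ℝ) (z x y : E N) : ℝ :=
  ∑ β ∈ multiIdx N ℓ, ∑ β' ∈ multiIdx N (3 * ℓ),
    coef β β' z * mono β (x - z) * mono β' (x - y)

end DysonTaylor

end

open DysonTaylor

set_option linter.unusedSectionVars false

namespace DysonTaylor

variable {N : ℕ}

/-! ### Weights -/

/-! Fix `z`, put `A = A(z)`, and let `G_t` be the heat kernel of `L_0 = ∑ A_ij ∂_i ∂_j`, so that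
`G(z; ·) = G_1`. The operator `e^{sL_0}` commutes with every `∂_j`. Writing `(y - z)_i = (x - z)_i -
(x - y)_i` and using `-v_i G_s(v) = 2s ∑_j A_ij ∂_j G_s(v)`, one also gets `e^{sL_0} (x - z)_i = ((x
- z)_i + 2s ∑_j A_ij ∂_j) e^{sL_0}`. The coefficients of `L_m^z` are polynomials in `x - z`. Hence
carrying `e^{sL_0}` from the left of `L_m^z` to its right replaces `L_m^z` by a differential
operator whose coefficients are polynomials in `x - z` and in `s`. When all heat operators of the
integrand have been carried to the right, they combine to `e^{L_0}`, because the times `τ_j` add up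
to 1.

What remains is a differential operator with polynomial coefficients acting in `x` on `G_1(x - y)`.
Such an operator maps kernels `q(x - z, x - y) G_1(x - y)` with `q` a polynomial to kernels of the
same form. So the whole computation takes place on polynomials in two groups of variables (`dX`,
`mulX`, `tayP`, `opP`, `dysonP`). Only the coefficients of the final polynomial depend on `τ`, and
integrating over the simplex integrates these scalars.

Degrees: each factor `x - z` of `L_m^z` raises both degrees by at most one, and each derivative
raises only the degree in `x - y`. So `L_m^z` contributes at most `m` and `m + 2`; the total is `ℓ`
and `ℓ + 2k ≤ 3ℓ`, since all `α_j ≥ 1`. Coefficients: they are built from continuous functions of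
`τ`, entries of `A` and `A⁻¹`, and derivatives of the coefficients of `L` at `z`. Ellipticity gives
`det A ≥ γ^N`, so Cramer's rule puts `A⁻¹` in `C_b^∞`.

The analytic part identifies `e^{tL_0}`, defined through classical solutions, with convolution by
`G_t` (`expOp_ae_eq`): convolution is a classical solution, and `s ↦ e^{(t-s)L_0} u(s)` is constant
for every classical solution `u`. Boundedness from `L^p_a` to `L^p_b` follows from the Schur test;
the gap `b < a` pays for the polynomial growth in `x - z` (`kernelBdd_polyKer`). The commutation
relations are `HeatRel.dX` and `HeatRel.mulX`, the integrand is computed in `dysonIntegrand_ae_eq`,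
the degrees in `PolyFamily.dysonP`, and the integral in `Lambda_ae_eq`. -/

lemma weight_pos (a : ℝ) (x : E N) : 0 < weight a x := Real.exp_pos _

lemma weight_mul (a b : ℝ) (x : E N) : weight a x * weight b x = weight (a + b) x := by
  rw [weight, weight, weight, ← Real.exp_add, add_mul]

lemma weight_zero (x : E N) : weight 0 x = 1 := by simp [weight]

lemma weight_mul_neg (a : ℝ) (x : E N) : weight a x * weight (-a) x = 1 := by
  rw [weight_mul, add_neg_cancel, weight_zero]

lemma weight_neg_mul (a : ℝ) (x : E N) : weight (-a) x * weight a x = 1 := by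
  rw [weight_mul, neg_add_cancel, weight_zero]

lemma contDiff_weight (a : ℝ) : ContDiff ℝ ∞ (weight (N := N) a) := by
  unfold weight
  refine Real.contDiff_exp.comp (contDiff_const.mul ?_)
  exact ContDiff.sqrt (contDiff_const.add (contDiff_norm_sq ℝ)) fun x => by positivity

lemma continuous_weight (a : ℝ) : Continuous (weight (N := N) a) := (contDiff_weight a).continuous

lemma norm_le_japanese (x : E N) : ‖x‖ ≤ Real.sqrt (1 + ‖x‖ ^ 2) :=
  Real.le_sqrt_of_sq_le (by linarith)

/-- The function `⟨x⟩` is 1-Lipschitz: `⟨x⟩² ≤ 1 + (|y| + |x - y|)² ≤ (⟨y⟩ + |x - y|)²`, by `|y| ≤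
⟨y⟩`. -/
lemma japanese_le (x y : E N) :
    Real.sqrt (1 + ‖x‖ ^ 2) ≤ Real.sqrt (1 + ‖y‖ ^ 2) + ‖x - y‖ := by
  have h1 := norm_le_japanese y
  have h2 : Real.sqrt (1 + ‖y‖ ^ 2) ^ 2 = 1 + ‖y‖ ^ 2 := Real.sq_sqrt (by positivity)
  have h3 : ‖x‖ ≤ ‖y‖ + ‖x - y‖ := by
    have := norm_add_le y (x - y); simpa using this
  have h4 := norm_nonneg (x - y)
  have h5 := norm_nonneg x
  rw [Real.sqrt_le_left (by positivity)]
  nlinarith [norm_nonneg y, mul_le_mul_of_nonneg_right h1 h4, mul_self_le_mul_self h5 h3]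

lemma abs_japanese_sub_le (x y : E N) :
    |Real.sqrt (1 + ‖x‖ ^ 2) - Real.sqrt (1 + ‖y‖ ^ 2)| ≤ ‖x - y‖ := by
  rw [abs_le]
  have h1 := japanese_le x y
  have h2 := japanese_le y x
  rw [norm_sub_rev] at h2
  constructor <;> linarith

/-- Moving the weight from one argument of a kernel to the other costs an exponential of the
distance, which Gaussian decay absorbs. -/
lemma weight_mul_weight_neg_le (a : ℝ) (x y : E N) :
    weight a x * weight (-a) y ≤ Real.exp (|a| * ‖x - y‖) := by
  rw [weight, weight, ← Real.exp_add, Real.exp_le_exp]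
  have h := abs_japanese_sub_le x y
  calc a * √(1 + ‖x‖ ^ 2) + -a * √(1 + ‖y‖ ^ 2)
      = a * (√(1 + ‖x‖ ^ 2) - √(1 + ‖y‖ ^ 2)) := by ring
    _ ≤ |a * (√(1 + ‖x‖ ^ 2) - √(1 + ‖y‖ ^ 2))| := le_abs_self _
    _ ≤ |a| * ‖x - y‖ := by rw [abs_mul]; gcongr

/-! ### Exponentially decaying functions -/

lemma integrable_exp_neg_mul_norm {c : ℝ} (hc : 0 < c) :
    Integrable (fun x : E N => Real.exp (-c * ‖x‖)) := by
  -- One power more than the dimension makes `(1 + ‖x‖)^(-n)` integrable; the constant comes from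
  -- `e^s ≥ s^n / n!` at `s = c (1 + ‖x‖)`.
  set n := Module.finrank ℝ (E N) + 1
  have h := (integrable_one_add_norm (E := E N) (μ := volume) (r := (n : ℝ))
    (by simp [n])).const_mul (n.factorial * Real.exp c / c ^ n)
  refine h.mono' (by fun_prop) (ae_of_all _ fun x => ?_)
  have hx := norm_nonneg x
  have h1 := Real.pow_div_factorial_le_exp (c * (1 + ‖x‖)) (by positivity) n
  rw [Real.norm_of_nonneg (Real.exp_nonneg _), Real.rpow_neg (by positivity), Real.rpow_natCast,
    neg_mul, Real.exp_neg, ← div_eq_mul_inv, div_div, inv_eq_one_div,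
    div_le_div_iff₀ (Real.exp_pos _) (by positivity)]
  rw [div_le_iff₀ (by positivity), mul_pow, mul_add, Real.exp_add] at h1
  rw [mul_one] at h1
  linarith

lemma memLp_exp_neg_norm_sub {q : ℝ≥0∞} (hq : 1 ≤ q) (x : E N) :
    MemLp (fun y : E N => Real.exp (-‖x - y‖)) q := by
  by_cases hqt : q = ⊤
  · subst hqt
    exact memLp_top_of_bound (by fun_prop) 1 (ae_of_all _ fun y => by simp)
  have hq0 : q ≠ 0 := (zero_lt_one.trans_le hq).ne'
  rw [← integrable_norm_rpow_iff (by fun_prop) hq0 hqt]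
  have h : 0 < q.toReal := ENNReal.toReal_pos hq0 hqt
  have := (integrable_exp_neg_mul_norm (N := N) h).comp_sub_left x
  refine this.congr (ae_of_all _ fun y => ?_)
  simp only [Real.norm_eq_abs, Real.abs_exp, ← Real.exp_mul]
  ring_nf

/-! ### The Schur test -/

/-- Split `h = h^(1/q) h^(1/p)` and apply Hölder in `y`, then Tonelli; by translation invariance
both marginals of `h (x - y)` equal `∫ h`. -/
lemma lintegral_schur {p : ℝ} (hp : 1 < p) {h F : E N → ℝ≥0∞} (hh : Measurable h)
    (hF : AEMeasurable F) :
    ∫⁻ x, (∫⁻ y, h (x - y) * F y) ^ p ≤ (∫⁻ x, h x) ^ p * ∫⁻ x, F x ^ p := by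
  obtain ⟨q, hpq⟩ : ∃ q, p.HolderConjugate q := ⟨_, Real.HolderConjugate.conjExponent hp⟩
  have hp0 : 0 < p := hpq.pos
  have hq0 : 0 < q := hpq.symm.pos
  have hsum : 1 / q + 1 / p = 1 := by
    rw [add_comm]; simpa using hpq.inv_add_inv_eq_one
  have hinv (x : E N) : ∫⁻ y, h (x - y) = ∫⁻ y, h y := lintegral_sub_left_eq_self h x
  have hmx (x : E N) : Measurable fun y => h (x - y) := hh.comp (by fun_prop)
  have key (x : E N) : (∫⁻ y, h (x - y) * F y) ^ p
      ≤ (∫⁻ y, h y) ^ (p / q) * ∫⁻ y, h (x - y) * F y ^ p := by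
    have := ENNReal.lintegral_mul_le_Lp_mul_Lq volume hpq.symm
      (f := fun y => h (x - y) ^ (1 / q)) (g := fun y => h (x - y) ^ (1 / p) * F y)
      ((hmx x).pow_const _).aemeasurable (((hmx x).pow_const _).aemeasurable.mul hF)
    have e1 : ∀ y, ((fun y => h (x - y) ^ (1 / q)) * fun y => h (x - y) ^ (1 / p) * F y) y
        = h (x - y) * F y := by
      intro y
      rw [Pi.mul_apply, ← mul_assoc, ← ENNReal.rpow_add_of_nonneg _ _ (by positivity)
        (by positivity), hsum, ENNReal.rpow_one]
    have e2 : ∀ y, (h (x - y) ^ (1 / q)) ^ q = h (x - y) := by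
      intro y
      rw [← ENNReal.rpow_mul, one_div_mul_cancel hq0.ne', ENNReal.rpow_one]
    have e3 : ∀ y, (h (x - y) ^ (1 / p) * F y) ^ p = h (x - y) * F y ^ p := by
      intro y
      rw [ENNReal.mul_rpow_of_nonneg _ _ hp0.le, ← ENNReal.rpow_mul,
        one_div_mul_cancel hp0.ne', ENNReal.rpow_one]
    simp_rw [e1, e2, e3, hinv] at this
    calc _ ≤ _ := ENNReal.rpow_le_rpow this hp0.le
      _ = _ := by
        rw [ENNReal.mul_rpow_of_nonneg _ _ hp0.le, ← ENNReal.rpow_mul, ← ENNReal.rpow_mul,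
          one_div_mul_cancel hp0.ne', ENNReal.rpow_one, one_div_mul_eq_div]
  calc _ ≤ ∫⁻ x, (∫⁻ y, h y) ^ (p / q) * ∫⁻ y, h (x - y) * F y ^ p := lintegral_mono key
    _ ≤ (∫⁻ y, h y) ^ (p / q) * ∫⁻ x, ∫⁻ y, h (x - y) * F y ^ p := by
        rw [lintegral_const_mul'']
        exact AEMeasurable.lintegral_prod_right' (f := fun z : E N × E N => h (z.1 - z.2) * F z.2 ^ p)
          ((hh.comp (by fun_prop)).aemeasurable.mul ((hF.comp_snd).pow_const _))
    _ = (∫⁻ y, h y) ^ (p / q) * ((∫⁻ y, h y) * ∫⁻ y, F y ^ p) := by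
        congr 1
        rw [lintegral_lintegral_swap]
        · rw [← lintegral_const_mul'' _ (hF.pow_const _)]
          refine lintegral_congr fun y => ?_
          have hm : Measurable fun x => h (x - y) := hh.comp (by fun_prop)
          rw [lintegral_mul_const _ hm, lintegral_sub_right_eq_self h y]
        · exact ((hh.comp (by fun_prop)).aemeasurable.mul ((hF.comp_snd).pow_const _))
    _ = _ := by
        rw [← mul_assoc]
        congr 1
        have e : p / q + 1 = p := by
          have := hpq.sub_one_mul_conj
          have h2 := hpq.div_conj_eq_sub_one
          linarith
        nth_rw 2 [← ENNReal.rpow_one (∫⁻ y, h y)]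
        rw [← ENNReal.rpow_add_of_nonneg _ _ (by positivity) zero_le_one, e]

lemma schur {p : ℝ≥0∞} (hp : 1 < p) (hpt : p ≠ ⊤) {F : Type*} [NormedAddCommGroup F]
    [NormedSpace ℝ F] {K : E N → E N → ℝ} (hK : Measurable (Function.uncurry K))
    {h : E N → ℝ} (hh : Integrable h) (hhm : Measurable h) (hKh : ∀ x y, |K x y| ≤ h (x - y))
    {f : E N → F} (hf : MemLp f p) :
    MemLp (fun x => ∫ y, K x y • f y) p ∧
      eLpNorm (fun x => ∫ y, K x y • f y) p volume
        ≤ ENNReal.ofReal (∫ x, h x) * eLpNorm f p volume := by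
  have hp0 : p ≠ 0 := (zero_lt_one.trans hp).ne'
  have hpr : 1 < p.toReal := by
    rw [← ENNReal.toReal_one]; exact (ENNReal.toReal_lt_toReal (by simp) hpt).2 hp
  -- Nonnegativity of `h` is forced by the kernel bound at `y = 0`.
  have h0 : ∀ v, 0 ≤ h v := fun v => by
    have := hKh v 0; rw [sub_zero] at this; exact (abs_nonneg _).trans this
  have hm : AEStronglyMeasurable (fun x => ∫ y, K x y • f y) volume :=
    AEStronglyMeasurable.integral_prod_right' (f := fun z : E N × E N => K z.1 z.2 • f z.2)
      (hK.aestronglyMeasurable.smul hf.1.comp_snd)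
  have hle : eLpNorm (fun x => ∫ y, K x y • f y) p volume
        ≤ ENNReal.ofReal (∫ x, h x) * eLpNorm f p volume := by
    rw [eLpNorm_eq_lintegral_rpow_enorm_toReal hp0 hpt,
      eLpNorm_eq_lintegral_rpow_enorm_toReal hp0 hpt,
      ofReal_integral_eq_lintegral_ofReal hh (ae_of_all _ h0)]
    have h1 := lintegral_schur hpr (h := fun v => ENNReal.ofReal (h v)) (F := fun y => ‖f y‖ₑ)
      hhm.ennreal_ofReal hf.1.enorm
    have h2 : ∫⁻ x, ‖∫ y, K x y • f y‖ₑ ^ p.toReal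
        ≤ ∫⁻ x, (∫⁻ y, ENNReal.ofReal (h (x - y)) * ‖f y‖ₑ) ^ p.toReal := by
      refine lintegral_mono fun x => ?_
      gcongr
      refine (enorm_integral_le_lintegral_enorm _).trans (lintegral_mono fun y => ?_)
      rw [enorm_smul]
      gcongr
      rw [Real.enorm_eq_ofReal_abs]
      exact ENNReal.ofReal_le_ofReal (hKh x y)
    calc _ ≤ _ := ENNReal.rpow_le_rpow (h2.trans h1) (by positivity)
      _ = _ := by
        rw [ENNReal.mul_rpow_of_nonneg _ _ (by positivity), ← ENNReal.rpow_mul,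
          mul_one_div_cancel (by positivity), ENNReal.rpow_one]
  exact ⟨⟨hm, hle.trans_lt (ENNReal.mul_lt_top ENNReal.ofReal_lt_top hf.2)⟩, hle⟩

end DysonTaylor
namespace DysonTaylor

variable {N : ℕ} {p : ℝ≥0∞}

/-! ### The spaces `L^p_a` -/

lemma MemWLp.congr {a : ℝ} {f g : E N → ℂ} (hf : MemWLp p a f) (h : f =ᵐ[volume] g) :
    MemWLp p a g :=
  (memLp_congr_ae (h.mono fun x hx => by simp only [hx])).1 hf

lemma memWLp_congr {a : ℝ} {f g : E N → ℂ} (h : f =ᵐ[volume] g) :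
    MemWLp p a f ↔ MemWLp p a g :=
  ⟨fun hf => hf.congr h, fun hg => hg.congr h.symm⟩

lemma MemWLp.add {a : ℝ} {f g : E N → ℂ} (hf : MemWLp p a f) (hg : MemWLp p a g) :
    MemWLp p a (f + g) := by
  have := MemLp.add hf hg
  refine (memLp_congr_ae (ae_of_all _ fun x => ?_)).1 this
  simp

lemma MemWLp.const_smul {a : ℝ} {f : E N → ℂ} (hf : MemWLp p a f) (c : ℝ) :
    MemWLp p a (c • f) := by
  have := MemLp.const_smul hf c
  refine (memLp_congr_ae (ae_of_all _ fun x => ?_)).1 this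
  simp only [Pi.smul_apply]
  rw [smul_comm]

lemma memWLp_zero {a : ℝ} : MemWLp p a (0 : E N → ℂ) := by
  have : MemLp (0 : E N → ℂ) p := MemLp.zero
  exact (memLp_congr_ae (ae_of_all _ fun x => by simp)).1 this

lemma memWLp_sum {a : ℝ} {ι : Type*} (s : Finset ι) {f : ι → E N → ℂ}
    (hf : ∀ i ∈ s, MemWLp p a (f i)) : MemWLp p a (∑ i ∈ s, f i) := by
  classical
  induction s using Finset.induction_on with
  | empty => simpa using memWLp_zero
  | insert i s hi ih =>
    rw [Finset.sum_insert hi]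
    exact (hf i (by simp)).add (ih fun j hj => hf j (by simp [hj]))

lemma MemWLp.aestronglyMeasurable {a : ℝ} {f : E N → ℂ} (hf : MemWLp p a f) :
    AEStronglyMeasurable f := by
  have := ((continuous_weight (N := N) (-a)).aestronglyMeasurable (μ := volume)).smul hf.1
  refine this.congr (ae_of_all _ fun x => ?_)
  simp only [Pi.smul_apply', smul_smul, weight_neg_mul, one_smul]

lemma weight_le_weight {a b : ℝ} (h : b ≤ a) (x : E N) : weight b x ≤ weight a x := by
  unfold weight
  gcongr

lemma MemWLp.mul_bounded {a : ℝ} {f : E N → ℂ} (hf : MemWLp p a f) {b : ℝ} {ρ : E N → ℝ}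
    (hρ : Continuous ρ) {C : ℝ} (h : ∀ x, |ρ x| ≤ C * weight (a - b) x) :
    MemWLp p b (fun x => ρ x • f x) := by
  refine MemLp.of_le_mul (c := C) hf
    ((continuous_weight b).aestronglyMeasurable.smul
      (hρ.aestronglyMeasurable.smul hf.aestronglyMeasurable)) (ae_of_all _ fun x => ?_)
  rw [norm_smul, norm_smul, norm_smul, Real.norm_of_nonneg (weight_pos _ _).le,
    Real.norm_of_nonneg (weight_pos _ _).le, Real.norm_eq_abs, ← mul_assoc, ← mul_assoc]
  refine mul_le_mul_of_nonneg_right ?_ (norm_nonneg _)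
  calc weight b x * |ρ x| ≤ weight b x * (C * weight (a - b) x) :=
        mul_le_mul_of_nonneg_left (h x) (weight_pos _ _).le
    _ = C * (weight b x * weight (a - b) x) := by ring
    _ = C * weight a x := by rw [weight_mul]; ring_nf

lemma MemWLp.mono_weight {a b : ℝ} {f : E N → ℂ} (hf : MemWLp p a f) (h : b ≤ a) :
    MemWLp p b f := by
  have := hf.mul_bounded (b := b) (ρ := fun _ => 1) continuous_const (C := 1) fun x => by
    rw [abs_one, one_mul, ← weight_zero x]
    exact weight_le_weight (by linarith) x
  simpa using this

variable [Fact (1 ≤ p)]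

lemma coeFn_toWLp {a : ℝ} {f : E N → ℂ} (hf : MemWLp p a f) :
    toWLp p a f =ᵐ[volume] fun x => weight a x • f x := by
  rw [toWLp, dif_pos hf]; exact MemLp.coeFn_toLp _

lemma toWLp_congr {a : ℝ} {f g : E N → ℂ} (h : f =ᵐ[volume] g) : toWLp p a f = toWLp p a g := by
  by_cases hf : MemWLp p a f
  · apply Lp.ext
    filter_upwards [coeFn_toWLp hf, coeFn_toWLp (hf.congr h), h] with x h1 h2 h3
    rw [h1, h2, h3]
  · rw [toWLp, toWLp, dif_neg hf, dif_neg (mt (memWLp_congr h).2 hf)]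

lemma toWLp_inj {a : ℝ} {f g : E N → ℂ} (hf : MemWLp p a f) (hg : MemWLp p a g)
    (h : toWLp p a f = toWLp p a g) : f =ᵐ[volume] g := by
  have h2 := coeFn_toWLp hg
  rw [← h] at h2
  filter_upwards [coeFn_toWLp hf, h2] with x h3 h4
  exact smul_right_injective _ (weight_pos a x).ne' (h3.symm.trans h4)

lemma toWLp_add {a : ℝ} {f g : E N → ℂ} (hf : MemWLp p a f) (hg : MemWLp p a g) :
    toWLp p a (f + g) = toWLp p a f + toWLp p a g := by
  apply Lp.ext
  filter_upwards [coeFn_toWLp hf, coeFn_toWLp hg, coeFn_toWLp (hf.add hg),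
    Lp.coeFn_add (toWLp p a f) (toWLp p a g)] with x h1 h2 h3 h4
  rw [h3, h4, Pi.add_apply, Pi.add_apply, h1, h2, smul_add]

lemma toWLp_smul {a : ℝ} {f : E N → ℂ} (hf : MemWLp p a f) (c : ℝ) :
    toWLp p a (c • f) = c • toWLp p a f := by
  apply Lp.ext
  filter_upwards [coeFn_toWLp hf, coeFn_toWLp (hf.const_smul c),
    Lp.coeFn_smul c (toWLp p a f)] with x h1 h2 h3
  rw [h2, h3, Pi.smul_apply, Pi.smul_apply, h1, smul_comm]

lemma toWLp_sum {a : ℝ} {ι : Type*} (s : Finset ι) {f : ι → E N → ℂ}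
    (hf : ∀ i ∈ s, MemWLp p a (f i)) : toWLp p a (∑ i ∈ s, f i) = ∑ i ∈ s, toWLp p a (f i) := by
  classical
  induction s using Finset.induction_on with
  | empty =>
    have := toWLp_smul (p := p) (a := a) (memWLp_zero (N := N)) 0
    simpa using this
  | insert i s hi ih =>
    rw [Finset.sum_insert hi, Finset.sum_insert hi, toWLp_add (hf i (by simp))
      (memWLp_sum s fun j hj => hf j (by simp [hj])), ih fun j hj => hf j (by simp [hj])]

/-- The inverse of `toWLp`. -/
noncomputable def ofWLp (a : ℝ) (F : Lp ℂ p (volume : Measure (E N))) : E N → ℂ :=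
  fun x => weight (-a) x • F x

lemma memWLp_ofWLp (a : ℝ) (F : Lp ℂ p (volume : Measure (E N))) : MemWLp p a (ofWLp a F) := by
  refine (memLp_congr_ae (ae_of_all _ fun x => ?_)).1 (Lp.memLp F)
  simp only [ofWLp, smul_smul, weight_mul_neg, one_smul]

lemma toWLp_ofWLp (a : ℝ) (F : Lp ℂ p (volume : Measure (E N))) : toWLp p a (ofWLp a F) = F := by
  apply Lp.ext
  refine (coeFn_toWLp (memWLp_ofWLp a F)).trans (ae_of_all _ fun x => ?_)
  simp only [ofWLp, smul_smul, weight_mul_neg, one_smul]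

lemma ofWLp_toWLp {a : ℝ} {f : E N → ℂ} (hf : MemWLp p a f) :
    ofWLp a (toWLp p a f) =ᵐ[volume] f :=
  toWLp_inj (memWLp_ofWLp _ _) hf (toWLp_ofWLp _ _)

/-! ### Integral operators between the spaces `L^p_a` -/

/-- A continuous kernel dominated by an exponential of the distance from `L^p_a` to `L^p_b`. -/
structure KernelBdd (a b : ℝ) (K : E N → E N → ℝ) : Prop where
  cont : Continuous (Function.uncurry K)
  bound : ∃ C, ∀ x y, weight b x * |K x y| * weight (-a) y ≤ C * Real.exp (-‖x - y‖)
end DysonTaylor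
namespace DysonTaylor

variable {N : ℕ} {p : ℝ≥0∞}

/-- The integral operator with kernel `K`. -/
noncomputable def kerOp (K : E N → E N → ℝ) (f : E N → ℂ) : E N → ℂ := fun x => ∫ y, K x y • f y

lemma kerOp_congr {K : E N → E N → ℝ} {f g : E N → ℂ} (h : f =ᵐ[volume] g) :
    kerOp K f = kerOp K g := by
  funext x
  exact integral_congr_ae (h.mono fun y hy => by simp only [hy])

namespace KernelBdd

variable {a b : ℝ} {K K' : E N → E N → ℝ}

lemma continuous_right (hK : KernelBdd a b K) (x : E N) : Continuous (K x) :=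
  hK.cont.comp (by fun_prop : Continuous fun y => (x, y))

lemma add (hK : KernelBdd a b K) (hK' : KernelBdd a b K') :
    KernelBdd a b (fun x y => K x y + K' x y) := by
  obtain ⟨C, hC⟩ := hK.bound
  obtain ⟨C', hC'⟩ := hK'.bound
  refine ⟨hK.cont.add hK'.cont, C + C', fun x y => ?_⟩
  have h1 := hC x y
  have h2 := hC' x y
  have h3 : weight b x * |K x y + K' x y| * weight (-a) y
      ≤ weight b x * (|K x y| + |K' x y|) * weight (-a) y := by
    have := weight_pos b x
    have := weight_pos (-a) y
    gcongr
    exact abs_add_le _ _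
  linarith

lemma const_mul (hK : KernelBdd a b K) (c : ℝ) : KernelBdd a b (fun x y => c * K x y) := by
  obtain ⟨C, hC⟩ := hK.bound
  refine ⟨hK.cont.const_smul c, |c| * C, fun x y => ?_⟩
  have := mul_le_mul_of_nonneg_left (hC x y) (abs_nonneg c)
  rw [abs_mul]
  linarith

/-- By Hölder: `K x · weight (-a)` is dominated by a multiple of `e^{-|x - y|}`, hence lies in the
conjugate `L^q`, while `weight a • f` is in `L^p`. This gives absolute convergence at every `x`, not
only almost every one. -/
lemma integrable (hK : KernelBdd a b K) (hp : 1 < p) {f : E N → ℂ}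
    (hf : MemWLp p a f) (x : E N) : Integrable (fun y => K x y • f y) := by
  obtain ⟨C, hC⟩ := hK.bound
  have hq : 1 ≤ p.conjExponent := by
    unfold ENNReal.conjExponent; simp
  have hpq : ENNReal.HolderConjugate p p.conjExponent := .conjExponent hp.le
  have hpq' : ENNReal.HolderConjugate p.conjExponent p := hpq.symm
  have h1 : MemLp (fun y => K x y * weight (-a) y) p.conjExponent := by
    refine MemLp.of_le_mul (c := C * weight (-b) x) (memLp_exp_neg_norm_sub hq x)
      ((hK.continuous_right x).mul (continuous_weight _)).aestronglyMeasurable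
      (ae_of_all _ fun y => ?_)
    rw [Real.norm_eq_abs, abs_mul, abs_of_pos (weight_pos _ _), Real.norm_eq_abs, Real.abs_exp]
    calc |K x y| * weight (-a) y
        = weight (-b) x * (weight b x * |K x y| * weight (-a) y) := by
          rw [← mul_assoc, ← mul_assoc, weight_neg_mul, one_mul]
      _ ≤ weight (-b) x * (C * Real.exp (-‖x - y‖)) :=
          mul_le_mul_of_nonneg_left (hC x y) (weight_pos _ _).le
      _ = _ := by ring
  have h2 : MemLp (fun y => weight a y • f y) p := hf
  have h3 : MemLp (fun y => (K x y * weight (-a) y) • (weight a y • f y)) 1 := h2.smul h1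
  rw [memLp_one_iff_integrable] at h3
  refine h3.congr (ae_of_all _ fun y => ?_)
  simp only [smul_smul]
  rw [mul_assoc, weight_neg_mul, mul_one]

lemma weighted_cont (hK : KernelBdd a b K) :
    Continuous (Function.uncurry fun x y => weight b x * K x y * weight (-a) y) :=
  (((continuous_weight b).comp continuous_fst).mul hK.cont).mul
    ((continuous_weight (-a)).comp continuous_snd)

lemma abs_weighted (x y : E N) : |weight b x * K x y * weight (-a) y|
    = weight b x * |K x y| * weight (-a) y := by
  rw [abs_mul, abs_mul, abs_of_pos (weight_pos _ _), abs_of_pos (weight_pos _ _)]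

lemma integrable_const_mul_exp (C : ℝ) :
    Integrable (fun v : E N => C * Real.exp (-‖v‖)) := by
  have := (integrable_exp_neg_mul_norm (N := N) zero_lt_one).const_mul C
  simpa using this

/-- Conjugating by the weights turns the claim into the unweighted Schur test for `weight b x * K x
y * weight (-a) y`. -/
lemma memWLp_and_bound (hK : KernelBdd a b K) (hp : 1 < p) (hpt : p ≠ ⊤) {f : E N → ℂ}
    (hf : MemWLp p a f) {h : E N → ℝ} (hh : Integrable h) (hhm : Measurable h)
    (hKh : ∀ x y, weight b x * |K x y| * weight (-a) y ≤ h (x - y)) :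
    MemWLp p b (kerOp K f) ∧ eLpNorm (fun x => weight b x • kerOp K f x) p volume
        ≤ ENNReal.ofReal (∫ x, h x) * eLpNorm (fun x => weight a x • f x) p volume := by
  have e : (fun x => weight b x • kerOp K f x)
      = fun x => ∫ y, (weight b x * K x y * weight (-a) y) • (weight a y • f y) := by
    funext x
    rw [kerOp, ← integral_smul]
    refine integral_congr_ae (ae_of_all _ fun y => ?_)
    simp only [smul_smul]
    rw [mul_assoc, weight_neg_mul, mul_one]
  have := schur hp hpt (K := fun x y => weight b x * K x y * weight (-a) y)
    hK.weighted_cont.measurable hh hhm (fun x y => by rw [abs_weighted]; exact hKh x y) hf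
  rw [MemWLp, e]
  exact this

lemma memWLp (hK : KernelBdd a b K) (hp : 1 < p) (hpt : p ≠ ⊤) {f : E N → ℂ}
    (hf : MemWLp p a f) : MemWLp p b (kerOp K f) := by
  obtain ⟨C, hC⟩ := hK.bound
  exact (hK.memWLp_and_bound hp hpt hf (integrable_const_mul_exp C) (by fun_prop) hC).1

lemma norm_toWLp_le [Fact (1 ≤ p)] (hK : KernelBdd a b K) (hp : 1 < p) (hpt : p ≠ ⊤)
    {f : E N → ℂ} (hf : MemWLp p a f) {h : E N → ℝ} (hh : Integrable h) (hhm : Measurable h)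
    (hKh : ∀ x y, weight b x * |K x y| * weight (-a) y ≤ h (x - y)) :
    ‖toWLp p b (kerOp K f)‖ ≤ (∫ x, h x) * ‖toWLp p a f‖ := by
  have h1 := hK.memWLp_and_bound hp hpt hf hh hhm hKh
  have h0 : 0 ≤ ∫ x, h x := integral_nonneg fun v => by
    have := hKh v 0
    rw [sub_zero] at this
    exact (mul_nonneg (mul_nonneg (weight_pos _ _).le (abs_nonneg _)) (weight_pos _ _).le).trans this
  rw [Lp.norm_def, Lp.norm_def, eLpNorm_congr_ae (coeFn_toWLp h1.1),
    eLpNorm_congr_ae (coeFn_toWLp hf)]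
  have := ENNReal.toReal_mono (ENNReal.mul_ne_top ENNReal.ofReal_ne_top (MemLp.eLpNorm_ne_top hf))
    h1.2
  rwa [ENNReal.toReal_mul, ENNReal.toReal_ofReal h0] at this

lemma abs_kernel (hK : KernelBdd a b K) : KernelBdd a b (fun x y => |K x y|) :=
  ⟨hK.cont.abs, by simpa only [abs_abs] using hK.bound⟩

/-- Apply boundedness to `|K|` and `|f|`. This supplies the absolute integrability needed for Fubini
in `KernelBdd.hasWeakPartial`. -/
lemma memLp_integral_norm (hK : KernelBdd a b K) (hp : 1 < p) (hpt : p ≠ ⊤) {f : E N → ℂ}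
    (hf : MemWLp p a f) : MemWLp p b (fun x => ((∫ y, ‖K x y • f y‖ : ℝ) : ℂ)) := by
  have hf' : MemWLp p a (fun y => ((‖f y‖ : ℝ) : ℂ)) := by
    refine MemLp.of_le (MemLp.norm hf) ?_ (ae_of_all _ fun y => ?_)
    · exact (continuous_weight a).aestronglyMeasurable.smul
        (Complex.continuous_ofReal.comp_aestronglyMeasurable hf.aestronglyMeasurable.norm)
    · simp
  have := hK.abs_kernel.memWLp hp hpt hf'
  convert this using 2 with x
  rw [kerOp, ← integral_complex_ofReal]
  refine integral_congr_ae (ae_of_all _ fun y => ?_)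
  simp

lemma kerOp_add_fun (hK : KernelBdd a b K) (hp : 1 < p) {f g : E N → ℂ}
    (hf : MemWLp p a f) (hg : MemWLp p a g) : kerOp K (f + g) = kerOp K f + kerOp K g := by
  funext x
  simp only [kerOp, Pi.add_apply, smul_add]
  exact integral_add (hK.integrable hp hf x) (hK.integrable hp hg x)

lemma kerOp_add (hK : KernelBdd a b K) (hK' : KernelBdd a b K') (hp : 1 < p) {f : E N → ℂ}
    (hf : MemWLp p a f) :
    kerOp (fun x y => K x y + K' x y) f = kerOp K f + kerOp K' f := by
  funext x
  simp only [kerOp, Pi.add_apply, add_smul]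
  exact integral_add (hK.integrable hp hf x) (hK'.integrable hp hf x)

end KernelBdd

lemma kerOp_smul_fun (K : E N → E N → ℝ) (c : ℝ) (f : E N → ℂ) :
    kerOp K (c • f) = c • kerOp K f := by
  funext x
  simp only [kerOp, Pi.smul_apply]
  rw [← integral_smul]
  exact integral_congr_ae (ae_of_all _ fun y => smul_comm _ _ _)

lemma kerOp_const_mul (K : E N → E N → ℝ) (c : ℝ) (f : E N → ℂ) :
    kerOp (fun x y => c * K x y) f = c • kerOp K f := by
  funext x
  simp only [kerOp, Pi.smul_apply]
  rw [← integral_smul]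
  exact integral_congr_ae (ae_of_all _ fun y => by simp only [mul_smul])

/-! ### Convolution with rapidly decaying functions -/

/-- A continuous function decaying faster than every exponential. -/
structure ExpDecay (k : E N → ℝ) : Prop where
  cont : Continuous k
  bound : ∀ c : ℝ, ∃ C, ∀ v, |k v| ≤ C * Real.exp (-c * ‖v‖)

/-- The convolution `∫ k(x - y) f(y) dy`. -/
noncomputable def conv (k : E N → ℝ) (f : E N → ℂ) : E N → ℂ := kerOp (fun x y => k (x - y)) f

namespace ExpDecay

variable {k k' : E N → ℝ}

lemma add (hk : ExpDecay k) (hk' : ExpDecay k') : ExpDecay (fun v => k v + k' v) := by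
  refine ⟨hk.cont.add hk'.cont, fun c => ?_⟩
  obtain ⟨C, hC⟩ := hk.bound c
  obtain ⟨C', hC'⟩ := hk'.bound c
  refine ⟨C + C', fun v => ?_⟩
  have := abs_add_le (k v) (k' v)
  have := hC v
  have := hC' v
  linarith

lemma const_mul (hk : ExpDecay k) (c : ℝ) : ExpDecay (fun v => c * k v) := by
  refine ⟨hk.cont.const_smul c, fun d => ?_⟩
  obtain ⟨C, hC⟩ := hk.bound d
  refine ⟨|c| * C, fun v => ?_⟩
  rw [abs_mul, mul_assoc]
  gcongr
  exact hC v

lemma sub (hk : ExpDecay k) (hk' : ExpDecay k') : ExpDecay (fun v => k v - k' v) := by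
  simpa [sub_eq_add_neg] using hk.add (hk'.const_mul (-1))

lemma exp_mul_le (hk : ExpDecay k) (b : ℝ) :
    ∃ C, ∀ v, Real.exp (|b| * ‖v‖) * |k v| ≤ C * Real.exp (-‖v‖) := by
  obtain ⟨C, hC⟩ := hk.bound (|b| + 1)
  refine ⟨C, fun v => ?_⟩
  calc _ ≤ Real.exp (|b| * ‖v‖) * (C * Real.exp (-(|b| + 1) * ‖v‖)) := by gcongr; exact hC v
    _ = C * (Real.exp (|b| * ‖v‖) * Real.exp (-(|b| + 1) * ‖v‖)) := by ring
    _ = _ := by rw [← Real.exp_add]; ring_nf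

lemma integrable_exp_mul (hk : ExpDecay k) (b : ℝ) :
    Integrable (fun v => Real.exp (|b| * ‖v‖) * |k v|) := by
  obtain ⟨C, hC⟩ := hk.exp_mul_le b
  refine (KernelBdd.integrable_const_mul_exp C).mono' ?_ (ae_of_all _ fun v => ?_)
  · have := hk.cont
    exact (by fun_prop : Continuous fun v => Real.exp (|b| * ‖v‖) * |k v|).aestronglyMeasurable
  · rw [Real.norm_of_nonneg (by positivity)]; exact hC v

lemma integrable (hk : ExpDecay k) : Integrable k := by
  have := hk.integrable_exp_mul 0
  simp only [abs_zero, zero_mul, Real.exp_zero, one_mul] at this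
  exact (integrable_norm_iff hk.cont.aestronglyMeasurable).1 this

lemma weighted_le (b : ℝ) (k : E N → ℝ) (x y : E N) :
    weight b x * |k (x - y)| * weight (-b) y ≤ Real.exp (|b| * ‖x - y‖) * |k (x - y)| := by
  calc _ = weight b x * weight (-b) y * |k (x - y)| := by ring
    _ ≤ _ := by gcongr; exact weight_mul_weight_neg_le b x y

lemma kernelBdd (hk : ExpDecay k) (b : ℝ) : KernelBdd b b (fun x y => k (x - y)) := by
  refine ⟨hk.cont.comp (by fun_prop), ?_⟩
  obtain ⟨C, hC⟩ := hk.exp_mul_le b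
  exact ⟨C, fun x y => (weighted_le b k x y).trans (hC _)⟩

lemma memWLp (hk : ExpDecay k) {b : ℝ} (hp : 1 < p) (hpt : p ≠ ⊤) {f : E N → ℂ}
    (hf : MemWLp p b f) : MemWLp p b (conv k f) :=
  (hk.kernelBdd b).memWLp hp hpt hf

lemma norm_toWLp_le [Fact (1 ≤ p)] (hk : ExpDecay k) {b : ℝ} (hp : 1 < p) (hpt : p ≠ ⊤)
    {f : E N → ℂ} (hf : MemWLp p b f) :
    ‖toWLp p b (conv k f)‖ ≤ (∫ v, Real.exp (|b| * ‖v‖) * |k v|) * ‖toWLp p b f‖ :=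
  (hk.kernelBdd b).norm_toWLp_le hp hpt hf (hk.integrable_exp_mul b)
    (by have := hk.cont.measurable; fun_prop) (weighted_le b k)

end ExpDecay

variable [Fact (1 ≤ p)]

open Classical in
/-- Convolution with `k` as an operator on `L^p_b`, transported to `L^p`. -/
noncomputable def convCLM (p : ℝ≥0∞) [Fact (1 ≤ p)] (b : ℝ) (k : E N → ℝ) :
    Lp ℂ p (volume : Measure (E N)) →L[ℝ] Lp ℂ p (volume : Measure (E N)) :=
  if h : ExpDecay k ∧ 1 < p ∧ p ≠ ⊤ then
    LinearMap.mkContinuous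
      { toFun := fun F => toWLp p b (conv k (ofWLp b F))
        map_add' := fun F G => by
          have hF := memWLp_ofWLp b F
          have hG := memWLp_ofWLp b G
          rw [← toWLp_add (h.1.memWLp h.2.1 h.2.2 hF) (h.1.memWLp h.2.1 h.2.2 hG), conv, conv,
            conv, ← (h.1.kernelBdd b).kerOp_add_fun h.2.1 hF hG]
          congr 1
          -- The representatives `ofWLp b (F + G)` and `ofWLp b F + ofWLp b G` agree only almost
          -- everywhere, which the integral does not see.
          refine kerOp_congr ?_
          refine toWLp_inj (memWLp_ofWLp _ _) (hF.add hG) ?_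
          rw [toWLp_add hF hG, toWLp_ofWLp, toWLp_ofWLp, toWLp_ofWLp]
        map_smul' := fun c F => by
          have hF := memWLp_ofWLp b F
          rw [RingHom.id_apply, ← toWLp_smul (h.1.memWLp h.2.1 h.2.2 hF), conv, conv,
            ← kerOp_smul_fun]
          congr 1
          refine kerOp_congr ?_
          refine toWLp_inj (memWLp_ofWLp _ _) (hF.const_smul c) ?_
          rw [toWLp_smul hF, toWLp_ofWLp, toWLp_ofWLp] }
      (∫ v, Real.exp (|b| * ‖v‖) * |k v|)
      (fun F => by
        have := h.1.norm_toWLp_le h.2.1 h.2.2 (memWLp_ofWLp b F)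
        rw [toWLp_ofWLp] at this
        exact this)
  else 0

lemma convCLM_toWLp {b : ℝ} {k : E N → ℝ} (hk : ExpDecay k) (hp : 1 < p) (hpt : p ≠ ⊤)
    {f : E N → ℂ} (hf : MemWLp p b f) :
    convCLM p b k (toWLp p b f) = toWLp p b (conv k f) := by
  rw [convCLM, dif_pos ⟨hk, hp, hpt⟩]
  change toWLp p b (conv k (ofWLp b (toWLp p b f))) = _
  rw [conv, kerOp_congr (ofWLp_toWLp hf), conv]

lemma norm_convCLM_le {b : ℝ} {k : E N → ℝ} (hk : ExpDecay k) (hp : 1 < p) (hpt : p ≠ ⊤) :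
    ‖convCLM p b k‖ ≤ ∫ v, Real.exp (|b| * ‖v‖) * |k v| := by
  rw [convCLM, dif_pos ⟨hk, hp, hpt⟩]
  exact LinearMap.mkContinuous_norm_le _ (integral_nonneg fun v => by positivity) _

lemma convCLM_add {b : ℝ} {k k' : E N → ℝ} (hk : ExpDecay k) (hk' : ExpDecay k') (hp : 1 < p)
    (hpt : p ≠ ⊤) :
    convCLM p b (fun v => k v + k' v) = convCLM p b k + convCLM p b k' := by
  ext1 F
  have hF := memWLp_ofWLp b F
  rw [← toWLp_ofWLp b F, add_apply, convCLM_toWLp hk hp hpt hF,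
    convCLM_toWLp hk' hp hpt hF, convCLM_toWLp (hk.add hk') hp hpt hF,
    ← toWLp_add (hk.memWLp hp hpt hF) (hk'.memWLp hp hpt hF)]
  exact congrArg _ ((hk.kernelBdd b).kerOp_add (hk'.kernelBdd b) hp hF)

lemma convCLM_const_mul {b : ℝ} {k : E N → ℝ} (hk : ExpDecay k) (c : ℝ) (hp : 1 < p)
    (hpt : p ≠ ⊤) : convCLM p b (fun v => c * k v) = c • convCLM p b k := by
  ext1 F
  have hF := memWLp_ofWLp b F
  rw [← toWLp_ofWLp b F, smul_apply, convCLM_toWLp hk hp hpt hF,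
    convCLM_toWLp (hk.const_mul c) hp hpt hF, ← toWLp_smul (hk.memWLp hp hpt hF)]
  exact congrArg _ (kerOp_const_mul _ _ _)

lemma convCLM_sub {b : ℝ} {k k' : E N → ℝ} (hk : ExpDecay k) (hk' : ExpDecay k') (hp : 1 < p)
    (hpt : p ≠ ⊤) :
    convCLM p b (fun v => k v - k' v) = convCLM p b k - convCLM p b k' := by
  have := convCLM_add (b := b) hk (hk'.const_mul (-1)) hp hpt
  rw [convCLM_const_mul hk' _ hp hpt] at this
  simpa [sub_eq_add_neg] using this

/-- The norm of the difference is at most `∫ e^{|b||v|} |k_r - k₀|`, which tends to zero by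
dominated convergence. The convergence is therefore in operator norm, so that the product rule
applies to `S(t - s) U(s)` later. -/
lemma tendsto_convCLM {ι : Type*} {l : Filter ι} [l.IsCountablyGenerated] {b : ℝ}
    {k : ι → E N → ℝ} {k₀ g : E N → ℝ} (hk : ∀ᶠ r in l, ExpDecay (k r)) (hk₀ : ExpDecay k₀)
    (hg : ExpDecay g) (hkg : ∀ᶠ r in l, ∀ v, |k r v| ≤ g v)
    (hlim : ∀ v, Tendsto (fun r => k r v) l (𝓝 (k₀ v))) (hp : 1 < p) (hpt : p ≠ ⊤) :
    Tendsto (fun r => convCLM p b (k r)) l (𝓝 (convCLM p b k₀)) := by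
  rw [tendsto_iff_norm_sub_tendsto_zero]
  have hlim' : Tendsto (fun r => ∫ v, Real.exp (|b| * ‖v‖) * |k r v - k₀ v|) l (𝓝 0) := by
    have h0 : ∫ v : E N, (0 : ℝ) = 0 := by simp
    rw [← h0]
    refine tendsto_integral_filter_of_dominated_convergence
      (fun v => Real.exp (|b| * ‖v‖) * |g v| + Real.exp (|b| * ‖v‖) * |k₀ v|) ?_ ?_
      ((hg.integrable_exp_mul b).add (hk₀.integrable_exp_mul b)) ?_
    · filter_upwards [hk] with r hr
      exact ((hr.sub hk₀).integrable_exp_mul b).1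
    · filter_upwards [hkg] with r hr
      refine ae_of_all _ fun v => ?_
      rw [Real.norm_of_nonneg (by positivity), ← mul_add]
      gcongr
      exact (abs_sub _ _).trans (by have := hr v; have := le_abs_self (g v); linarith)
    · refine ae_of_all _ fun v => ?_
      have := ((hlim v).sub_const (k₀ v)).abs.const_mul (Real.exp (|b| * ‖v‖))
      simpa using this
  refine squeeze_zero' (Eventually.of_forall fun _ => norm_nonneg _) ?_ hlim'
  filter_upwards [hk] with r hr
  rw [← convCLM_sub hr hk₀ hp hpt]
  exact norm_convCLM_le (hr.sub hk₀) hp hpt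

/-- Convolution is linear in its kernel, so the difference quotient of the operators is convolution
with the difference quotient of the kernels, and `tendsto_convCLM` applies. -/
lemma hasDerivAt_convCLM {b : ℝ} {k : ℝ → E N → ℝ} {k' g : E N → ℝ} {r₀ : ℝ}
    (hk : ∀ᶠ r in 𝓝 r₀, ExpDecay (k r)) (hk' : ExpDecay k') (hg : ExpDecay g)
    (hkg : ∀ᶠ r in 𝓝[≠] r₀, ∀ v, |slope (fun r => k r v) r₀ r| ≤ g v)
    (hlim : ∀ v, HasDerivAt (fun r => k r v) (k' v) r₀) (hp : 1 < p) (hpt : p ≠ ⊤) :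
    HasDerivAt (fun r => convCLM p b (k r)) (convCLM p b k') r₀ := by
  rw [hasDerivAt_iff_tendsto_slope]
  have hk0 : ExpDecay (k r₀) := hk.self_of_nhds
  have hkw : ∀ᶠ r in 𝓝[≠] r₀, ExpDecay (k r) := hk.filter_mono nhdsWithin_le_nhds
  have h1 : Tendsto (fun r => convCLM p b (fun v => slope (fun r => k r v) r₀ r)) (𝓝[≠] r₀)
      (𝓝 (convCLM p b k')) := by
    refine tendsto_convCLM ?_ hk' hg hkg (fun v => (hlim v).tendsto_slope) hp hpt
    filter_upwards [hkw] with r hr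
    simp only [slope_def_field, div_eq_inv_mul]
    exact (hr.sub hk0).const_mul _
  refine h1.congr' ?_
  filter_upwards [hkw] with r hr
  simp only [slope_def_field, slope_def_module, div_eq_inv_mul]
  rw [convCLM_const_mul (hr.sub hk0) _ hp hpt, convCLM_sub hr hk0 hp hpt]

end DysonTaylor
namespace DysonTaylor

variable {N : ℕ} {p : ℝ≥0∞}

/-! ### Weak derivatives -/

/-- The classical partial derivative. -/
noncomputable def pd (i : Fin N) (φ : E N → ℝ) (x : E N) : ℝ :=
  fderiv ℝ φ x (EuclideanSpace.single i 1)

lemma contDiff_pd {φ : E N → ℝ} (hφ : ContDiff ℝ ∞ φ) (i : Fin N) : ContDiff ℝ ∞ (pd i φ) :=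
  (hφ.fderiv_right (m := ∞) (by simp)).clm_apply contDiff_const

lemma pd_mul {φ ψ : E N → ℝ} (hφ : ContDiff ℝ ∞ φ) (hψ : ContDiff ℝ ∞ ψ) (i : Fin N) (x : E N) :
    pd i (fun y => φ y * ψ y) x = pd i φ x * ψ x + φ x * pd i ψ x := by
  have h1 := (hφ.differentiable (by simp)) x
  have h2 := (hψ.differentiable (by simp)) x
  rw [pd, fderiv_fun_mul h1 h2]
  simp [pd]
  ring

lemma hasCompactSupport_pd {φ : E N → ℝ} (hφ : HasCompactSupport φ) (i : Fin N) :
    HasCompactSupport (pd i φ) :=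
  (hφ.fderiv ℝ).comp_left (g := fun T : E N →L[ℝ] ℝ => T (EuclideanSpace.single i 1)) rfl

lemma locallyIntegrable_smul {ρ : E N → ℝ} (hρ : Continuous ρ) {f : E N → ℂ}
    (hf : LocallyIntegrable f) : LocallyIntegrable (fun x => ρ x • f x) := by
  rw [← locallyIntegrableOn_univ] at hf ⊢
  exact hf.continuousOn_smul isOpen_univ.isLocallyClosed hρ.continuousOn

lemma MemWLp.locallyIntegrable (hp : 1 ≤ p) {a : ℝ} {f : E N → ℂ} (hf : MemWLp p a f) :
    LocallyIntegrable f := by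
  have := locallyIntegrable_smul (continuous_weight (-a)) (MemLp.locallyIntegrable hf hp)
  simpa only [smul_smul, weight_neg_mul, one_smul] using this

namespace HasWeakPartial

variable {i : Fin N} {f f' g g' : E N → ℂ}

lemma congr (h : HasWeakPartial i f g) (hf : f =ᵐ[volume] f') (hg : g =ᵐ[volume] g') :
    HasWeakPartial i f' g' := by
  refine ⟨h.1.congr hf, h.2.1.congr hg, fun φ h1 h2 => ?_⟩
  have e1 : ∫ x, fderiv ℝ φ x (EuclideanSpace.single i 1) • f x
      = ∫ x, fderiv ℝ φ x (EuclideanSpace.single i 1) • f' x :=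
    integral_congr_ae (hf.mono fun x hx => by simp only [hx])
  have e2 : ∫ x, φ x • g x = ∫ x, φ x • g' x :=
    integral_congr_ae (hg.mono fun x hx => by simp only [hx])
  rw [← e1, ← e2, h.2.2 φ h1 h2]

lemma ae_unique (h : HasWeakPartial i f g) (h' : HasWeakPartial i f g') : g =ᵐ[volume] g' := by
  refine ae_eq_of_integral_contDiff_smul_eq h.2.1 h'.2.1 fun φ h1 h2 => ?_
  rw [← neg_inj, ← h.2.2 φ h1 h2, h'.2.2 φ h1 h2]

lemma weakPartial_ae (h : HasWeakPartial i f g) : weakPartial i f =ᵐ[volume] g := by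
  have hex : ∃ g, HasWeakPartial i f g := ⟨g, h⟩
  rw [weakPartial, dif_pos hex]
  exact hex.choose_spec.ae_unique h

lemma add (h : HasWeakPartial i f g) (h' : HasWeakPartial i f' g') :
    HasWeakPartial i (f + f') (g + g') := by
  refine ⟨h.1.add h'.1, h.2.1.add h'.2.1, fun φ h1 h2 => ?_⟩
  have hc1 := (contDiff_pd h1 i).continuous
  have hc2 := hasCompactSupport_pd h2 i
  have e1 := h.2.2 φ h1 h2
  have e2 := h'.2.2 φ h1 h2
  simp only [Pi.add_apply, smul_add]
  change ∫ x, pd i φ x • f x + pd i φ x • f' x = _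
  rw [integral_add (h.1.integrable_smul_left_of_hasCompactSupport hc1 hc2)
    (h'.1.integrable_smul_left_of_hasCompactSupport hc1 hc2),
    integral_add (h.2.1.integrable_smul_left_of_hasCompactSupport h1.continuous h2)
    (h'.2.1.integrable_smul_left_of_hasCompactSupport h1.continuous h2), neg_add, ← e1, ← e2]
  rfl

/-- The Leibniz rule comes from testing the weak identity for `f` with `φ * ρ`, which is again
smooth with compact support. -/
lemma smul_contDiff (h : HasWeakPartial i f g) {ρ : E N → ℝ} (hρ : ContDiff ℝ ∞ ρ) :
    HasWeakPartial i (fun x => ρ x • f x) (fun x => ρ x • g x + pd i ρ x • f x) := by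
  have hρ' := contDiff_pd hρ i
  refine ⟨locallyIntegrable_smul hρ.continuous h.1,
    (locallyIntegrable_smul hρ.continuous h.2.1).add
      (locallyIntegrable_smul hρ'.continuous h.1), fun φ h1 h2 => ?_⟩
  have e := h.2.2 (fun x => φ x * ρ x) (h1.mul hρ) h2.mul_right
  have e1 : ∀ x, fderiv ℝ (fun x => φ x * ρ x) x (EuclideanSpace.single i 1) • f x
      = pd i φ x • ρ x • f x + (φ x * pd i ρ x) • f x := by
    intro x
    have := pd_mul h1 hρ i x
    rw [pd] at this
    rw [this, add_smul, mul_smul]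
  have i1 : Integrable fun x => pd i φ x • ρ x • f x :=
    (locallyIntegrable_smul hρ.continuous h.1).integrable_smul_left_of_hasCompactSupport
      (contDiff_pd h1 i).continuous (hasCompactSupport_pd h2 i)
  have i2 : Integrable fun x => (φ x * pd i ρ x) • f x :=
    h.1.integrable_smul_left_of_hasCompactSupport (h1.continuous.mul hρ'.continuous) h2.mul_right
  have i3 : Integrable fun x => φ x • ρ x • g x :=
    (locallyIntegrable_smul hρ.continuous h.2.1).integrable_smul_left_of_hasCompactSupport
      h1.continuous h2
  rw [integral_congr_ae (ae_of_all _ e1), integral_add i1 i2] at e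
  change ∫ x, pd i φ x • ρ x • f x = _
  have e2 : ∫ x, φ x • (ρ x • g x + pd i ρ x • f x)
      = (∫ x, φ x • ρ x • g x) + ∫ x, (φ x * pd i ρ x) • f x := by
    rw [← integral_add i3 i2]
    exact integral_congr_ae (ae_of_all _ fun x => by simp only [smul_add, mul_smul])
  rw [e2]
  simp only [mul_smul] at e ⊢
  rw [neg_add]
  exact eq_add_neg_of_add_eq e

end HasWeakPartial

/-- The choice in `weakPartial` depends on `f` only through the predicate `HasWeakPartial i f`, and
functions equal almost everywhere have the same predicate. Hence the equality holds at every point.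
-/
lemma weakPartial_congr {i : Fin N} {f f' : E N → ℂ} (h : f =ᵐ[volume] f') :
    weakPartial i f = weakPartial i f' := by
  have : HasWeakPartial i f = HasWeakPartial i f' := by
    funext g
    exact propext ⟨fun hg => hg.congr h (ae_eq_refl _), fun hg => hg.congr h.symm (ae_eq_refl _)⟩
  classical
  let F : ((E N → ℂ) → Prop) → E N → ℂ := fun P => if h : ∃ g, P g then h.choose else 0
  have e (f : E N → ℂ) : weakPartial i f = F (HasWeakPartial i f) := by
    unfold weakPartial F
    congr!
  rw [e, e, this]

lemma DiffOp.apply_congr (M : DiffOp N) {f f' : E N → ℂ} (h : f =ᵐ[volume] f') :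
    M.apply f =ᵐ[volume] M.apply f' := by
  filter_upwards [h] with x hx
  simp only [DiffOp.apply, weakPartial_congr h, hx]

/-- Integration by parts against a smooth function that need not have compact support. -/
lemma HasWeakPartial.integral_eq {i : Fin N} {f g : E N → ℂ} (h : HasWeakPartial i f g)
    {φ : E N → ℝ} (hφ : ContDiff ℝ ∞ φ) (h1 : Integrable fun x => φ x • f x)
    (h2 : Integrable fun x => φ x • g x) (h3 : Integrable fun x => pd i φ x • f x) :
    ∫ x, pd i φ x • f x = -∫ x, φ x • g x := by
  -- The cutoffs `χ(x / (n + 1))` tend to 1 and their derivatives are `O(1 / (n + 1))`. The weak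
  -- identity is tested with `χn n * φ`, and dominated convergence removes the cutoff.
  let χ : ContDiffBump (0 : E N) := ⟨1, 2, by norm_num, by norm_num⟩
  have hχ : ContDiff ℝ ∞ (χ : E N → ℝ) := χ.contDiff
  set c : ℕ → ℝ := fun n => 1 / ((n : ℝ) + 1) with hc
  have hc0 : Tendsto c atTop (𝓝 0) := tendsto_one_div_add_atTop_nhds_zero_nat
  set χn : ℕ → E N → ℝ := fun n x => χ (c n • x)
  have hχn (n) : ContDiff ℝ ∞ (χn n) := hχ.comp (contDiff_const_smul _)
  have hcn (n) : c n ≠ 0 := by simp only [hc]; positivity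
  have hsupp (n) : HasCompactSupport (χn n) := χ.hasCompactSupport.comp_smul (hcn n)
  have hpd (n x) : pd i (χn n) x = c n * pd i χ (c n • x) := by
    have hd : HasFDerivAt (χn n)
        ((fderiv ℝ χ (c n • x)).comp (c n • ContinuousLinearMap.id ℝ (E N))) x := by
      refine HasFDerivAt.comp x (g := (χ : E N → ℝ))
        (hχ.differentiable (by simp) _).hasFDerivAt ?_
      exact (hasFDerivAt_id x).const_smul (c n)
    rw [pd, hd.fderiv]
    simp [pd]
  obtain ⟨C, hC⟩ : ∃ C, ∀ x, |pd i χ x| ≤ C := by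
    obtain ⟨C, hC⟩ := (hasCompactSupport_pd χ.hasCompactSupport i).exists_bound_of_continuous
      (contDiff_pd hχ i).continuous
    exact ⟨C, hC⟩
  have hC0 : 0 ≤ C := (abs_nonneg _).trans (hC 0)
  have hχ1 (n x) : |χn n x| ≤ 1 := by
    rw [abs_of_nonneg χ.nonneg]; exact χ.le_one
  have hlim (x) : Tendsto (fun n => χn n x) atTop (𝓝 1) := by
    have h4 : Tendsto (fun n => c n • x) atTop (𝓝 0) := by simpa using hc0.smul_const x
    have := (hχ.continuous.tendsto 0).comp h4
    have h5 : χ (0 : E N) = 1 := χ.one_of_mem_closedBall (Metric.mem_closedBall_self χ.rIn_pos.le)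
    rwa [h5] at this
  have hc1 (n) : |c n| ≤ 1 := by
    simp only [hc]
    rw [abs_of_pos (by positivity), div_le_one (by positivity)]
    linarith [n.cast_nonneg (α := ℝ)]
  have key (n) : ∫ x, (χn n x • (pd i φ x • f x) + pd i (χn n) x • (φ x • f x))
      = -∫ x, χn n x • (φ x • g x) := by
    have := h.2.2 (fun x => χn n x * φ x) ((hχn n).mul hφ) (hsupp n).mul_right
    simp only [mul_smul] at this
    rw [← this]
    refine integral_congr_ae (ae_of_all _ fun x => ?_)
    have h6 := pd_mul (hχn n) hφ i x
    rw [pd] at h6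
    simp only [h6, add_smul, mul_smul]
    rw [add_comm]
  have L1 : Tendsto (fun n => ∫ x, (χn n x • (pd i φ x • f x) + pd i (χn n) x • (φ x • f x)))
      atTop (𝓝 (∫ x, pd i φ x • f x)) := by
    refine tendsto_integral_of_dominated_convergence
      (fun x => ‖pd i φ x • f x‖ + C * ‖φ x • f x‖) (fun n => ?_) (h3.norm.add (h1.norm.const_mul C))
      (fun n => ae_of_all _ fun x => ?_) (ae_of_all _ fun x => ?_)
    · exact ((hχn n).continuous.aestronglyMeasurable.smul h3.1).add
        ((contDiff_pd (hχn n) i).continuous.aestronglyMeasurable.smul h1.1)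
    · refine (norm_add_le _ _).trans (add_le_add ?_ ?_)
      · rw [norm_smul]
        exact mul_le_of_le_one_left (norm_nonneg _) (hχ1 n x)
      · rw [norm_smul (pd i (χn n) x)]
        refine mul_le_mul_of_nonneg_right ?_ (norm_nonneg _)
        rw [hpd, Real.norm_eq_abs, abs_mul]
        calc |c n| * |pd i χ (c n • x)| ≤ 1 * C := by
              gcongr
              · exact hc1 n
              · exact hC _
          _ = C := one_mul C
    · have t1 := (hlim x).smul_const (pd i φ x • f x)
      have t2 : Tendsto (fun n => pd i (χn n) x) atTop (𝓝 0) := by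
        simp only [hpd]
        refine squeeze_zero_norm (a := fun n => c n * C) (fun n => ?_) (by simpa using hc0.mul_const C)
        rw [Real.norm_eq_abs, abs_mul, abs_of_pos (by simp only [hc]; positivity)]
        have : 0 < c n := by simp only [hc]; positivity
        gcongr
        exact hC _
      simpa using t1.add (t2.smul_const (φ x • f x))
  have L2 : Tendsto (fun n => -∫ x, χn n x • (φ x • g x)) atTop (𝓝 (-∫ x, φ x • g x)) := by
    refine Tendsto.neg (tendsto_integral_of_dominated_convergence
      (fun x => ‖φ x • g x‖) (fun n => ?_) h2.norm
      (fun n => ae_of_all _ fun x => ?_) (ae_of_all _ fun x => ?_))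
    · exact (hχn n).continuous.aestronglyMeasurable.smul h2.1
    · rw [norm_smul]
      exact mul_le_of_le_one_left (norm_nonneg _) (hχ1 n x)
    · simpa using (hlim x).smul_const (φ x • g x)
  simp only [key] at L1
  exact tendsto_nhds_unique L1 L2

/-- Derivatives may be moved from a function to a convolution kernel. -/
lemma HasWeakPartial.conv_eq {i : Fin N} {f g : E N → ℂ} (h : HasWeakPartial i f g) {b : ℝ}
    (hp : 1 < p) (hf : MemWLp p b f) (hg : MemWLp p b g) {k : E N → ℝ} (hk : ContDiff ℝ ∞ k)
    (hk0 : ExpDecay k) (hk1 : ExpDecay (pd i k)) : conv k g = conv (pd i k) f := by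
  funext x
  -- The sign from differentiating `k (x - y)` in `y` cancels the sign of the integration by parts.
  have hd (y) : pd i (fun y => k (x - y)) y = -pd i k (x - y) := by
    have hd : HasFDerivAt (fun y => k (x - y))
        ((fderiv ℝ k (x - y)).comp (-ContinuousLinearMap.id ℝ (E N))) y := by
      refine HasFDerivAt.comp y (g := k) (hk.differentiable (by simp) _).hasFDerivAt ?_
      exact (hasFDerivAt_id y).const_sub x
    rw [pd, hd.fderiv]
    simp [pd]
  have := h.integral_eq (φ := fun y => k (x - y)) (hk.comp (contDiff_const.sub contDiff_id))
    ((hk0.kernelBdd b).integrable hp hf x) ((hk0.kernelBdd b).integrable hp hg x)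
    (by
      simp only [hd, neg_smul]
      exact ((hk1.kernelBdd b).integrable hp hf x).neg)
  simp only [hd, neg_smul, integral_neg, neg_inj] at this
  exact this.symm

/-- Differentiation of an integral operator with respect to its outer variable. -/
lemma KernelBdd.hasWeakPartial {a b : ℝ} {K K' : E N → E N → ℝ} (hK : KernelBdd a b K)
    (hK' : KernelBdd a b K') {i : Fin N}
    (hd : ∀ x y, HasLineDerivAt ℝ (fun x => K x y) (K' x y) x (EuclideanSpace.single i 1))
    (hp : 1 < p) (hpt : p ≠ ⊤) {f : E N → ℂ} (hf : MemWLp p a f) :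
    HasWeakPartial i (kerOp K f) (kerOp K' f) := by
  refine ⟨(hK.memWLp hp hpt hf).locallyIntegrable hp.le,
    (hK'.memWLp hp hpt hf).locallyIntegrable hp.le, fun φ h1 h2 => ?_⟩
  -- Fubini against a compactly supported function reduces the claim to an integration by parts in
  -- `x` for each fixed `y`.
  have fub (ψ : E N → ℝ) (hψ : Continuous ψ) (hψ' : HasCompactSupport ψ) (M : E N → E N → ℝ)
      (hM : KernelBdd a b M) : ∫ x, ψ x • kerOp M f x = ∫ y, (∫ x, ψ x * M x y) • f y := by
    have hint : Integrable (Function.uncurry fun x y => (ψ x * M x y) • f y)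
        (volume.prod volume) := by
      have hm : AEStronglyMeasurable (Function.uncurry fun x y => (ψ x * M x y) • f y)
          (volume.prod volume) := by
        refine AEStronglyMeasurable.smul (f := fun z : E N × E N => ψ z.1 * M z.1 z.2) ?_
          hf.aestronglyMeasurable.comp_snd
        exact ((hψ.comp continuous_fst).mul hM.cont).aestronglyMeasurable
      rw [integrable_prod_iff hm]
      constructor
      · refine ae_of_all _ fun x => ?_
        simp only [Function.uncurry, mul_smul]
        exact (hM.integrable hp hf x).smul (ψ x)
      · have h3 := ((hM.memLp_integral_norm hp hpt hf).locallyIntegrable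
          hp.le).integrable_smul_left_of_hasCompactSupport hψ hψ'
        refine h3.norm.congr (ae_of_all _ fun x => ?_)
        simp only [Function.uncurry, mul_smul]
        rw [norm_smul, Complex.norm_real,
          Real.norm_of_nonneg (integral_nonneg fun y => norm_nonneg _), ← integral_const_mul]
        exact integral_congr_ae (ae_of_all _ fun y => (norm_smul _ _).symm)
    have := integral_integral_swap hint
    calc _ = ∫ x, ∫ y, (ψ x * M x y) • f y := by
          refine integral_congr_ae (ae_of_all _ fun x => ?_)
          simp only [kerOp, mul_smul, integral_smul]
      _ = _ := this
      _ = _ := by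
          refine integral_congr_ae (ae_of_all _ fun y => ?_)
          simp only [integral_smul_const]
  have e1 := fub (pd i φ) (contDiff_pd h1 i).continuous (hasCompactSupport_pd h2 i) K hK
  have e2 := fub φ h1.continuous h2 K' hK'
  change ∫ x, pd i φ x • kerOp K f x = _
  rw [e1, e2, ← integral_neg]
  refine integral_congr_ae (ae_of_all _ fun y => ?_)
  simp only
  rw [← neg_smul]
  congr 1
  have hKc (M : E N → E N → ℝ) (hM : KernelBdd a b M) : Continuous fun x => M x y :=
    hM.cont.comp (by fun_prop : Continuous fun x => (x, y))
  have := integral_bilinear_hasLineDerivAt_right_eq_neg_left_of_integrable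
    (μ := (volume : Measure (E N))) (B := ContinuousLinearMap.mul ℝ ℝ)
    (f := φ) (f' := pd i φ) (g := fun x => K x y) (g' := fun x => K' x y)
    (v := EuclideanSpace.single i 1)
    ((((contDiff_pd h1 i).continuous.mul (hKc K hK))).integrable_of_hasCompactSupport
      (hasCompactSupport_pd h2 i).mul_right)
    ((h1.continuous.mul (hKc K' hK')).integrable_of_hasCompactSupport h2.mul_right)
    ((h1.continuous.mul (hKc K hK)).integrable_of_hasCompactSupport h2.mul_right)
    (fun x _ => (h1.differentiable (by simp) x).hasFDerivAt.hasLineDerivAt _)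
    (fun x _ => hd x y)
  simp only [ContinuousLinearMap.mul_apply'] at this
  rw [this, neg_neg]

end DysonTaylor
namespace DysonTaylor

variable {N : ℕ} {p : ℝ≥0∞}

/-! ### Weighted Sobolev spaces of order two -/

lemma pd_weight (c : ℝ) (i : Fin N) (x : E N) :
    pd i (weight c) x = c * (x i / Real.sqrt (1 + ‖x‖ ^ 2)) * weight c x := by
  have h0 : (1 + ‖x‖ ^ 2 : ℝ) ≠ 0 := by positivity
  have h1 : HasFDerivAt (fun x : E N => 1 + ‖x‖ ^ 2) (2 • innerSL ℝ x) x :=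
    (hasStrictFDerivAt_norm_sq x).hasFDerivAt.const_add 1
  have h2 := ((h1.sqrt h0).const_mul c).exp
  have h3 : fderiv ℝ (weight c) x = _ := h2.fderiv
  rw [pd, h3, weight]
  simp [EuclideanSpace.inner_single_right]
  have : Real.sqrt (1 + ‖x‖ ^ 2) ≠ 0 := by positivity
  field_simp

lemma pd_const_mul {φ : E N → ℝ} (hφ : ContDiff ℝ ∞ φ) (c : ℝ) (i : Fin N) (x : E N) :
    pd i (fun y => c * φ y) x = c * pd i φ x := by
  have := pd_mul (φ := fun _ => c) contDiff_const hφ i x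
  simpa [pd] using this

lemma pd_coord (i j : Fin N) (x : E N) :
    pd j (fun y : E N => y i) x = if i = j then 1 else 0 := by
  have h : HasFDerivAt (fun y : E N => y i) (EuclideanSpace.proj i : E N →L[ℝ] ℝ) x :=
    (EuclideanSpace.proj i : E N →L[ℝ] ℝ).hasFDerivAt
  rw [pd, h.fderiv]
  simp

lemma contDiff_coord (i : Fin N) : ContDiff ℝ ∞ (fun y : E N => y i) :=
  (EuclideanSpace.proj i : E N →L[ℝ] ℝ).contDiff

lemma contDiff_inv_japanese : ContDiff ℝ ∞ (fun x : E N => (Real.sqrt (1 + ‖x‖ ^ 2))⁻¹) := by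
  refine ContDiff.inv (ContDiff.sqrt (contDiff_const.add (contDiff_norm_sq ℝ)) fun x => ?_)
    fun x => ?_ <;> positivity

lemma pd_inv_japanese (j : Fin N) (x : E N) :
    pd j (fun x : E N => (Real.sqrt (1 + ‖x‖ ^ 2))⁻¹) x = -x j / Real.sqrt (1 + ‖x‖ ^ 2) ^ 3 := by
  have h0 : (1 + ‖x‖ ^ 2 : ℝ) ≠ 0 := by positivity
  have h0' : Real.sqrt (1 + ‖x‖ ^ 2) ≠ 0 := by positivity
  have h1 : HasFDerivAt (fun x : E N => 1 + ‖x‖ ^ 2) (2 • innerSL ℝ x) x :=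
    (hasStrictFDerivAt_norm_sq x).hasFDerivAt.const_add 1
  have h2 := (hasDerivAt_inv h0').comp_hasFDerivAt x (h1.sqrt h0)
  have h3 : fderiv ℝ (fun x : E N => (Real.sqrt (1 + ‖x‖ ^ 2))⁻¹) x = _ := h2.fderiv
  rw [pd, h3]
  simp [EuclideanSpace.inner_single_right]
  field_simp

lemma abs_coord_div_le (i : Fin N) (x : E N) : |x i / Real.sqrt (1 + ‖x‖ ^ 2)| ≤ 1 := by
  rw [abs_div, abs_of_pos (by positivity : 0 < Real.sqrt (1 + ‖x‖ ^ 2)),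
    div_le_one (by positivity)]
  exact (PiLp.norm_apply_le x i).trans (norm_le_japanese x)

lemma one_le_japanese (x : E N) : 1 ≤ Real.sqrt (1 + ‖x‖ ^ 2) :=
  Real.one_le_sqrt.2 (by nlinarith [sq_nonneg ‖x‖])

lemma abs_pd_weight_le (c : ℝ) (i : Fin N) (x : E N) :
    |pd i (weight c) x| ≤ |c| * weight c x := by
  rw [pd_weight, abs_mul, abs_mul, abs_of_pos (weight_pos c x)]
  have := weight_pos c x
  gcongr
  exact mul_le_of_le_one_right (abs_nonneg _) (abs_coord_div_le i x)

/-- Both `x_i / ⟨x⟩` and `1 / ⟨x⟩` are bounded by 1, so the first derivatives of `⟨x⟩` are at most 1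
and the second at most 2 in absolute value. -/
lemma abs_pd_pd_weight_le (c : ℝ) (i j : Fin N) (x : E N) :
    |pd j (pd i (weight c)) x| ≤ (|c| * (2 + |c|)) * weight c x := by
  set J := fun x : E N => (Real.sqrt (1 + ‖x‖ ^ 2))⁻¹ with hJ
  have hJc : ContDiff ℝ ∞ J := contDiff_inv_japanese
  have e : pd i (weight c) = fun y : E N => c * ((y i * J y) * weight c y) := by
    funext y
    rw [pd_weight, hJ, div_eq_mul_inv, mul_assoc]
  have hw := weight_pos c x
  rw [e, pd_const_mul (((contDiff_coord i).mul hJc).mul (contDiff_weight c)),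
    pd_mul ((contDiff_coord i).mul hJc) (contDiff_weight c), pd_mul (contDiff_coord i) hJc,
    pd_coord, pd_inv_japanese, pd_weight, abs_mul, mul_assoc |c|]
  refine mul_le_mul_of_nonneg_left ?_ (abs_nonneg c)
  have hS := one_le_japanese x
  set S := Real.sqrt (1 + ‖x‖ ^ 2) with hSdef
  have hS0 : 0 < S := by linarith
  have e1 : ((if i = j then 1 else 0) * J x + x i * (-x j / S ^ 3)) * weight c x
      + x i * J x * (c * (x j / S) * weight c x)
      = (((if i = j then 1 else 0) * S⁻¹ - (x i / S) * (x j / S) * S⁻¹)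
        + (x i / S) * (x j / S) * c) * weight c x := by
    simp only [hJ, ← hSdef]
    field_simp
    ring
  rw [e1, abs_mul, abs_of_pos hw]
  refine mul_le_mul_of_nonneg_right ?_ hw.le
  have hi := abs_coord_div_le i x
  have hj := abs_coord_div_le j x
  rw [← hSdef] at hi hj
  have hij : |x i / S * (x j / S)| ≤ 1 := by
    rw [abs_mul]; exact mul_le_one₀ hi (abs_nonneg _) hj
  have hSi : |S⁻¹| ≤ 1 := by
    rw [abs_of_pos (by positivity)]; exact inv_le_one_of_one_le₀ hS
  have hd : |(if i = j then (1 : ℝ) else 0)| ≤ 1 := by split_ifs <;> simp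
  calc _ ≤ |(if i = j then (1 : ℝ) else 0) * S⁻¹| + |x i / S * (x j / S) * S⁻¹|
        + |x i / S * (x j / S) * c| :=
        (abs_add_le _ _).trans (by gcongr; exact abs_sub _ _)
    _ ≤ 1 + 1 + 1 * |c| := by
        rw [abs_mul, abs_mul _ S⁻¹, abs_mul _ c]
        gcongr
        · exact mul_le_one₀ hd (abs_nonneg _) hSi
        · exact mul_le_one₀ hij (abs_nonneg _) hSi
    _ = 2 + |c| := by ring

/-- `f ∈ W^{2,p}_a`, with first weak derivatives `g` and second weak derivatives `H`. -/
structure HasW2 (p : ℝ≥0∞) (a : ℝ) (f : E N → ℂ) (g : Fin N → E N → ℂ)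
    (H : Fin N → Fin N → E N → ℂ) : Prop where
  mem : MemWLp p a f
  partial_one : ∀ i, HasWeakPartial i f (g i)
  mem_one : ∀ i, MemWLp p a (g i)
  partial_two : ∀ i j, HasWeakPartial j (g i) (H i j)
  mem_two : ∀ i j, MemWLp p a (H i j)

lemma MemWLp.smul_weight {a : ℝ} {f : E N → ℂ} (hf : MemWLp p a f) (c : ℝ) {ρ : E N → ℝ}
    (hρ : Continuous ρ) {C : ℝ} (h : ∀ x, |ρ x| ≤ C * weight c x) :
    MemWLp p (a - c) (fun x => ρ x • f x) :=
  hf.mul_bounded hρ (C := C) (by simpa using h)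

/-- The derivatives of the weight up to order two are bounded by multiples of the weight. Used with
`c = a` and `c = -a`, this shows that weak derivatives of `e^{a⟨x⟩} f` in `L^p` and weak derivatives
of `f` in `L^p_a` describe the same space. -/
lemma HasW2.smul_weight {a : ℝ} {f : E N → ℂ} {g : Fin N → E N → ℂ}
    {H : Fin N → Fin N → E N → ℂ} (h : HasW2 p a f g H) (c : ℝ) :
    ∃ g' H', HasW2 p (a - c) (fun x => weight c x • f x) g' H' := by
  have hw := contDiff_weight (N := N) c
  have hw1 (i) := contDiff_pd hw i
  have b0 (x : E N) : |weight c x| ≤ 1 * weight c x := by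
    rw [one_mul, abs_of_pos (weight_pos c x)]
  refine ⟨fun i x => weight c x • g i x + pd i (weight c) x • f x,
    fun i j x => (weight c x • H i j x + pd j (weight c) x • g i x)
      + (pd i (weight c) x • g j x + pd j (pd i (weight c)) x • f x),
    h.mem.smul_weight c hw.continuous b0, fun i => (h.partial_one i).smul_contDiff hw,
    fun i => ((h.mem_one i).smul_weight c hw.continuous b0).add
      (h.mem.smul_weight c (hw1 i).continuous (abs_pd_weight_le c i)), fun i j => ?_, fun i j => ?_⟩
  · exact ((h.partial_two i j).smul_contDiff hw).add ((h.partial_one j).smul_contDiff (hw1 i))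
  · exact (((h.mem_two i j).smul_weight c hw.continuous b0).add
      ((h.mem_one i).smul_weight c (hw1 j).continuous (abs_pd_weight_le c j))).add
      (((h.mem_one j).smul_weight c (hw1 i).continuous (abs_pd_weight_le c i)).add
      (h.mem.smul_weight c (contDiff_pd (hw1 i) j).continuous (abs_pd_pd_weight_le c i j)))

lemma memWLp_zero_iff {f : E N → ℂ} : MemWLp p 0 f ↔ MemLp f p := by
  simp only [MemWLp, weight_zero, one_smul]

lemma HasW2.memWSobolev {a : ℝ} {f : E N → ℂ} {g : Fin N → E N → ℂ}
    {H : Fin N → Fin N → E N → ℂ} (h : HasW2 p a f g H) : MemWSobolev 2 p a f := by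
  obtain ⟨g', H', h'⟩ := h.smul_weight a
  rw [sub_self] at h'
  exact ⟨memWLp_zero_iff.1 h'.mem, fun i => ⟨g' i, h'.partial_one i,
    memWLp_zero_iff.1 (h'.mem_one i), fun j => ⟨H' i j, h'.partial_two i j,
    memWLp_zero_iff.1 (h'.mem_two i j)⟩⟩⟩

lemma MemWSobolev.hasW2 {a : ℝ} {f : E N → ℂ} (h : MemWSobolev 2 p a f) :
    ∃ g H, HasW2 p a f g H := by
  obtain ⟨h0, h1⟩ := h
  choose g hg using h1
  have h2 (i j) := (hg i).2.2 j
  choose H hH using h2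
  have hw : HasW2 p 0 (fun x => weight a x • f x) g H :=
    ⟨memWLp_zero_iff.2 h0, fun i => (hg i).1, fun i => memWLp_zero_iff.2 (hg i).2.1,
      fun i j => (hH i j).1, fun i j => memWLp_zero_iff.2 (hH i j).2⟩
  have := hw.smul_weight (-a)
  simpa only [smul_smul, weight_neg_mul, one_smul, sub_neg_eq_add, zero_add] using this

end DysonTaylor
namespace DysonTaylor

variable {N : ℕ} {p : ℝ≥0∞}

/-! ### The heat kernel of a constant coefficient operator -/

/-- The `i`-th coordinate of `A⁻¹ v`. -/
noncomputable def invCoord (A : Matrix (Fin N) (Fin N) ℝ) (i : Fin N) (v : E N) : ℝ :=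
  ∑ j, A⁻¹ i j * v j

/-- The quadratic form `vᵀ A⁻¹ v`. -/
noncomputable def invForm (A : Matrix (Fin N) (Fin N) ℝ) (v : E N) : ℝ :=
  v.ofLp ⬝ᵥ (A⁻¹ *ᵥ v.ofLp)

/-- The heat kernel of `∑ A_ij ∂_i ∂_j`. -/
noncomputable def heatK (A : Matrix (Fin N) (Fin N) ℝ) (t : ℝ) (v : E N) : ℝ :=
  (4 * Real.pi * t) ^ (-(N : ℝ) / 2) * A.det ^ (-(1 / 2) : ℝ) * Real.exp (-invForm A v / (4 * t))

/-- The time derivative of the heat kernel. -/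
noncomputable def heatKt (A : Matrix (Fin N) (Fin N) ℝ) (t : ℝ) (v : E N) : ℝ :=
  (-(N : ℝ) / (2 * t) + invForm A v / (4 * t ^ 2)) * heatK A t v

variable {A : Matrix (Fin N) (Fin N) ℝ}

lemma invForm_eq_sum (v : E N) : invForm A v = ∑ i, v i * invCoord A i v := rfl

lemma pd_sum {ι : Type*} (s : Finset ι) {φ : ι → E N → ℝ} (hφ : ∀ k ∈ s, ContDiff ℝ ∞ (φ k))
    (i : Fin N) (x : E N) : pd i (fun y => ∑ k ∈ s, φ k y) x = ∑ k ∈ s, pd i (φ k) x := by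
  rw [pd, fderiv_fun_sum fun k hk => (hφ k hk).differentiable (by simp) x]
  simp [pd]

lemma contDiff_invCoord (i : Fin N) : ContDiff ℝ ∞ (invCoord A i) :=
  ContDiff.sum fun j _ => contDiff_const.mul (contDiff_coord j)

lemma contDiff_invForm : ContDiff ℝ ∞ (invForm A) := by
  have : invForm A = fun v => ∑ i, v i * invCoord A i v := funext invForm_eq_sum
  rw [this]
  exact ContDiff.sum fun i _ => (contDiff_coord i).mul (contDiff_invCoord i)

lemma pd_invCoord (i j : Fin N) (v : E N) : pd j (invCoord A i) v = A⁻¹ i j := by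
  unfold invCoord
  rw [pd_sum _ fun k _ => contDiff_const.mul (contDiff_coord k)]
  simp_rw [pd_const_mul (contDiff_coord _), pd_coord]
  simp

lemma inv_symm (hA : A.PosDef) (i j : Fin N) : A⁻¹ i j = A⁻¹ j i := by
  simpa using hA.isHermitian.inv.apply j i

lemma pd_invForm (hA : A.PosDef) (j : Fin N) (v : E N) :
    pd j (invForm A) v = 2 * invCoord A j v := by
  have : invForm A = fun v => ∑ i, v i * invCoord A i v := funext invForm_eq_sum
  rw [this, pd_sum _ fun i _ => (contDiff_coord i).mul (contDiff_invCoord i)]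
  simp_rw [pd_mul (contDiff_coord _) (contDiff_invCoord _), pd_coord, pd_invCoord]
  rw [Finset.sum_add_distrib, two_mul]
  congr 1
  · simp
  · exact Finset.sum_congr rfl fun i _ => by rw [inv_symm hA i j, mul_comm]

lemma contDiff_heatK (t : ℝ) : ContDiff ℝ ∞ (heatK A t) :=
  contDiff_const.mul (Real.contDiff_exp.comp (contDiff_invForm.neg.div_const _))

lemma pd_heatK (hA : A.PosDef) {t : ℝ} (ht : 0 < t) (i : Fin N) (v : E N) :
    pd i (heatK A t) v = -(1 / (2 * t)) * invCoord A i v * heatK A t v := by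
  have h1 := (contDiff_invForm (A := A)).differentiable (by simp) v
  have h2 : HasFDerivAt (heatK A t) _ v :=
    (((h1.hasFDerivAt.neg.mul_const (4 * t)⁻¹).exp).const_mul
    ((4 * Real.pi * t) ^ (-(N : ℝ) / 2) * A.det ^ (-(1 / 2) : ℝ)))
  have h3 := pd_invForm hA i v
  rw [pd] at h3
  rw [pd, h2.fderiv]
  simp [h3, heatK, ← div_eq_mul_inv]
  field_simp
  ring

lemma pd_pd_heatK (hA : A.PosDef) {t : ℝ} (ht : 0 < t) (i j : Fin N) (v : E N) :
    pd j (pd i (heatK A t)) v = (-(1 / (2 * t)) * A⁻¹ i j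
      + 1 / (4 * t ^ 2) * (invCoord A i v * invCoord A j v)) * heatK A t v := by
  have e : pd i (heatK A t) = fun v => -(1 / (2 * t)) * (invCoord A i v * heatK A t v) := by
    funext v
    rw [pd_heatK hA ht, mul_assoc]
  rw [e, pd_const_mul ((contDiff_invCoord i).mul (contDiff_heatK t)),
    pd_mul (contDiff_invCoord i) (contDiff_heatK t), pd_invCoord, pd_heatK hA ht]
  field_simp
  ring

lemma sum_mul_invCoord (hA : A.PosDef) (i : Fin N) (v : E N) :
    ∑ j, A i j * invCoord A j v = v i := by
  have hu : IsUnit A.det := hA.det_pos.ne'.isUnit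
  have : A *ᵥ (A⁻¹ *ᵥ v.ofLp) = v.ofLp := by
    rw [Matrix.mulVec_mulVec, Matrix.mul_nonsing_inv _ hu, Matrix.one_mulVec]
  exact congrFun this i

/-- This is the heat equation: `tr (A A⁻¹) = N` produces the first term of `heatKt`, and `A (A⁻¹ v)
= v` contracts the quadratic term to `vᵀ A⁻¹ v`. -/
lemma sum_pd_pd_heatK (hA : A.PosDef) {t : ℝ} (ht : 0 < t) (v : E N) :
    ∑ i, ∑ j, A i j * pd i (pd j (heatK A t)) v = heatKt A t v := by
  have hu : IsUnit A.det := hA.det_pos.ne'.isUnit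
  simp_rw [pd_pd_heatK hA ht]
  have e : ∀ i j, A i j * ((-(1 / (2 * t)) * A⁻¹ j i
      + 1 / (4 * t ^ 2) * (invCoord A j v * invCoord A i v)) * heatK A t v)
      = (-(1 / (2 * t)) * (A i j * A⁻¹ j i)
        + 1 / (4 * t ^ 2) * (invCoord A i v * (A i j * invCoord A j v))) * heatK A t v := by
    intro i j; ring
  simp_rw [e, ← Finset.sum_mul, Finset.sum_add_distrib, ← Finset.mul_sum, sum_mul_invCoord hA]
  have h1 : ∑ i, ∑ j, A i j * A⁻¹ j i = N := by
    have : (A * A⁻¹).trace = ∑ i, ∑ j, A i j * A⁻¹ j i := by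
      simp [Matrix.trace, Matrix.mul_apply]
    rw [← this, Matrix.mul_nonsing_inv _ hu]
    simp
  rw [h1, heatKt, invForm_eq_sum]
  simp_rw [mul_comm (invCoord A _ v)]
  ring

lemma hasDerivAt_heatK {t : ℝ} (ht : 0 < t) (v : E N) :
    HasDerivAt (fun t => heatK A t v) (heatKt A t v) t := by
  have h1 : HasDerivAt (fun t : ℝ => 4 * Real.pi * t) (4 * Real.pi) t := by
    simpa using (hasDerivAt_id t).const_mul (4 * Real.pi)
  have h0 : 0 < 4 * Real.pi * t := by positivity
  have h2 := h1.rpow_const (p := -(N : ℝ) / 2) (Or.inl h0.ne')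
  have h3 : HasDerivAt (fun t : ℝ => -invForm A v / (4 * t)) (invForm A v / (4 * t ^ 2)) t := by
    have := ((hasDerivAt_inv ht.ne').const_mul (-invForm A v / 4))
    refine (this.congr_of_eventuallyEq (Eventually.of_forall fun s => ?_)).congr_deriv ?_
    · simp only; rw [div_mul_eq_div_div, div_eq_mul_inv _ s]
    · field_simp
  refine ((h2.mul_const (A.det ^ (-(1 / 2) : ℝ))).mul h3.exp).congr_deriv ?_
  rw [heatKt, heatK, Real.rpow_sub_one h0.ne']
  field_simp

open scoped MatrixOrder in
-- Through `C` the form `vᵀ A⁻¹ v` becomes `|C v|²`, which gives its lower bound and the integral of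
-- the Gaussian by a linear change of variables.
lemma exists_sqrt_inv (hA : A.PosDef) : ∃ C : Matrix (Fin N) (Fin N) ℝ, A⁻¹ = Cᵀ * C ∧
    C.det ≠ 0 := by
  obtain ⟨C, hC⟩ := CStarAlgebra.nonneg_iff_eq_star_mul_self.mp hA.inv.posSemidef.nonneg
  rw [Matrix.star_eq_conjTranspose, Matrix.conjTranspose_eq_transpose_of_trivial] at hC
  refine ⟨C, hC, fun h => ?_⟩
  have := hA.inv.det_pos
  rw [hC, Matrix.det_mul, h] at this
  simp at this

lemma invForm_eq_norm_sq {C : Matrix (Fin N) (Fin N) ℝ} (hC : A⁻¹ = Cᵀ * C) (v : E N) :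
    invForm A v = ‖Matrix.toEuclideanLin C v‖ ^ 2 := by
  rw [invForm, hC, ← Matrix.mulVec_mulVec, Matrix.dotProduct_mulVec, Matrix.vecMul_transpose,
    EuclideanSpace.real_norm_sq_eq]
  simp [dotProduct, sq, Matrix.toEuclideanLin]

lemma invForm_lower_bound (hA : A.PosDef) : ∃ δ > 0, ∀ v, δ * ‖v‖ ^ 2 ≤ invForm A v := by
  obtain ⟨C, hC, hdet⟩ := exists_sqrt_inv hA
  set T := (Matrix.toEuclideanLin C⁻¹).toContinuousLinearMap with hT
  have hTC (v : E N) : T (Matrix.toEuclideanLin C v) = v := by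
    have hu : IsUnit C.det := hdet.isUnit
    simp [hT, Matrix.toEuclideanLin, Matrix.toLpLin_apply, Matrix.nonsing_inv_mul _ hu]
  -- Here `T` inverts `C`, so `|v| ≤ ‖T‖ |C v|`; the added 1 keeps the constant meaningful for `N =
  -- 0`, where `‖T‖ = 0`.
  refine ⟨((‖T‖ + 1) ^ 2)⁻¹, by positivity, fun v => ?_⟩
  rw [invForm_eq_norm_sq hC, inv_mul_le_iff₀ (by positivity), ← mul_pow]
  gcongr
  calc ‖v‖ = ‖T (Matrix.toEuclideanLin C v)‖ := by rw [hTC]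
    _ ≤ ‖T‖ * ‖Matrix.toEuclideanLin C v‖ := T.le_opNorm _
    _ ≤ _ := by gcongr; linarith

lemma heatK_pos (hA : A.PosDef) {t : ℝ} (ht : 0 < t) (v : E N) : 0 < heatK A t v := by
  have := hA.det_pos
  unfold heatK
  positivity

lemma ExpDecay.mul_heatK (hA : A.PosDef) {t : ℝ} (ht : 0 < t) {k : E N → ℝ} (hk : Continuous k)
    {C m : ℝ} (hkb : ∀ v, |k v| ≤ C * Real.exp (m * ‖v‖)) :
    ExpDecay (fun v => k v * heatK A t v) := by
  obtain ⟨δ, hδ, hb⟩ := invForm_lower_bound hA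
  have hdet := hA.det_pos
  refine ⟨hk.mul (contDiff_heatK t).continuous, fun c => ?_⟩
  set κ := (4 * Real.pi * t) ^ (-(N : ℝ) / 2) * A.det ^ (-(1 / 2) : ℝ) with hκ
  have hκ0 : 0 < κ := by positivity
  -- The exponent `(m + c)² t / δ` is the maximum over `r` of `(m + c) r - δ r² / (4t)`, found by
  -- completing the square.
  refine ⟨C * κ * Real.exp ((m + c) ^ 2 * t / δ), fun v => ?_⟩
  have hC : 0 ≤ C := by
    have := (abs_nonneg _).trans (hkb 0)
    simpa using this
  rw [abs_mul, abs_of_pos (heatK_pos hA ht v), heatK, ← hκ]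
  have h2 : Real.exp (m * ‖v‖) * Real.exp (-invForm A v / (4 * t))
      ≤ Real.exp ((m + c) ^ 2 * t / δ) * Real.exp (-c * ‖v‖) := by
    rw [← Real.exp_add, ← Real.exp_add, Real.exp_le_exp]
    have h3 : -invForm A v / (4 * t) ≤ -(δ * ‖v‖ ^ 2) / (4 * t) := by
      gcongr; exact hb v
    have h4 : (m + c) * ‖v‖ ≤ (m + c) ^ 2 * t / δ + δ * ‖v‖ ^ 2 / (4 * t) := by
      have h5 : (m + c) ^ 2 * t / δ + δ * ‖v‖ ^ 2 / (4 * t) - (m + c) * ‖v‖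
          = ((m + c) * (2 * t) - δ * ‖v‖) ^ 2 / (4 * t * δ) := by
        field_simp; ring
      have : 0 ≤ ((m + c) * (2 * t) - δ * ‖v‖) ^ 2 / (4 * t * δ) := by positivity
      linarith
    have h6 : -(δ * ‖v‖ ^ 2) / (4 * t) = -(δ * ‖v‖ ^ 2 / (4 * t)) := neg_div _ _
    linarith
  calc |k v| * (κ * Real.exp (-invForm A v / (4 * t)))
      ≤ (C * Real.exp (m * ‖v‖)) * (κ * Real.exp (-invForm A v / (4 * t))) := by
        gcongr; exact hkb v
    _ = C * κ * (Real.exp (m * ‖v‖) * Real.exp (-invForm A v / (4 * t))) := by ring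
    _ ≤ C * κ * (Real.exp ((m + c) ^ 2 * t / δ) * Real.exp (-c * ‖v‖)) := by gcongr
    _ = _ := by ring

/-- Substitute `w = C v`: the Jacobian `|det C|⁻¹` cancels the factor `(det A)^(-1/2) = |det C|`,
and a standard Gaussian integral remains. -/
lemma integral_heatK (hA : A.PosDef) {t : ℝ} (ht : 0 < t) : ∫ v, heatK A t v = 1 := by
  obtain ⟨C, hC, hdet⟩ := exists_sqrt_inv hA
  have hb : (0 : ℝ) < 1 / (4 * t) := by positivity
  have h1 := GaussianFourier.integral_rexp_neg_mul_sq_norm (V := E N) hb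
  set L := Matrix.toEuclideanLin C with hL
  have hLdet : LinearMap.det L = C.det := by
    rw [hL, Matrix.toEuclideanLin_eq_toLin_orthonormal, LinearMap.det_toLin]
  have hLdet0 : LinearMap.det L ≠ 0 := by rwa [hLdet]
  have hmap := Measure.map_linearMap_addHaar_eq_smul_addHaar (volume : Measure (E N)) hLdet0
  have h2 : ∫ v, Real.exp (-(1 / (4 * t)) * ‖L v‖ ^ 2)
      = |C.det|⁻¹ * ∫ w : E N, Real.exp (-(1 / (4 * t)) * ‖w‖ ^ 2) := by
    have hLc : Continuous L := L.continuous_of_finiteDimensional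
    have := integral_map (μ := (volume : Measure (E N))) (φ := L) hLc.measurable.aemeasurable
      (f := fun w => Real.exp (-(1 / (4 * t)) * ‖w‖ ^ 2))
      (by fun_prop : Continuous fun w : E N =>
        Real.exp (-(1 / (4 * t)) * ‖w‖ ^ 2)).aestronglyMeasurable
    rw [← this, hmap, integral_smul_measure, hLdet, ENNReal.toReal_ofReal (by positivity), abs_inv,
      smul_eq_mul]
  have e : ∀ v, heatK A t v = ((4 * Real.pi * t) ^ (-(N : ℝ) / 2) * A.det ^ (-(1 / 2) : ℝ))
      * Real.exp (-(1 / (4 * t)) * ‖L v‖ ^ 2) := by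
    intro v
    rw [heatK, invForm_eq_norm_sq hC]
    congr 2
    ring
  simp_rw [e]
  rw [integral_const_mul, h2, h1]
  have h3 : Real.pi / (1 / (4 * t)) = 4 * Real.pi * t := by field_simp
  have h4 : A.det ^ (-(1 / 2) : ℝ) = |C.det| := by
    have h5 : (A.det)⁻¹ = C.det ^ 2 := by
      have := congrArg Matrix.det hC
      rw [Matrix.det_mul, Matrix.det_transpose, Matrix.det_nonsing_inv, Ring.inverse_eq_inv'] at this
      rw [this, sq]
    rw [Real.rpow_neg hA.det_pos.le, ← Real.inv_rpow hA.det_pos.le, h5, ← Real.sqrt_eq_rpow,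
      Real.sqrt_sq_eq_abs]
  have h6 : (0 : ℝ) < 4 * Real.pi * t := by positivity
  rw [h3, h4]
  have h7 : (4 * Real.pi * t) ^ (-(N : ℝ) / 2) * (4 * Real.pi * t) ^ ((N : ℝ) / 2) = 1 := by
    rw [← Real.rpow_add h6]; ring_nf; exact Real.rpow_zero _
  have h8 : |C.det| * |C.det|⁻¹ = 1 := mul_inv_cancel₀ (abs_pos.2 hdet).ne'
  rw [finrank_euclideanSpace_fin]
  calc _ = ((4 * Real.pi * t) ^ (-(N : ℝ) / 2) * (4 * Real.pi * t) ^ ((N : ℝ) / 2))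
        * (|C.det| * |C.det|⁻¹) := by ring
    _ = 1 := by rw [h7, h8, one_mul]

end DysonTaylor
namespace DysonTaylor

variable {N : ℕ} {p : ℝ≥0∞}

/-! ### Functions of exponential growth -/

/-- A continuous function of at most exponential growth. -/
structure ExpGrowth (k : E N → ℝ) : Prop where
  cont : Continuous k
  bound : ∃ C m : ℝ, ∀ v, |k v| ≤ C * Real.exp (m * ‖v‖)

namespace ExpGrowth

variable {k k' : E N → ℝ}

lemma const (c : ℝ) : ExpGrowth (fun _ : E N => c) :=
  ⟨continuous_const, |c|, 0, fun v => by simp⟩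

lemma coord (i : Fin N) : ExpGrowth (fun v : E N => v i) := by
  refine ⟨(contDiff_coord i).continuous, 1, 1, fun v => ?_⟩
  have h1 : |v i| ≤ ‖v‖ := PiLp.norm_apply_le v i
  have h2 := Real.add_one_le_exp ‖v‖
  rw [one_mul, one_mul]
  linarith

lemma mul (hk : ExpGrowth k) (hk' : ExpGrowth k') : ExpGrowth (fun v => k v * k' v) := by
  obtain ⟨C, m, h⟩ := hk.bound
  obtain ⟨C', m', h'⟩ := hk'.bound
  refine ⟨hk.cont.mul hk'.cont, C * C', m + m', fun v => ?_⟩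
  rw [abs_mul, add_mul, Real.exp_add]
  calc _ ≤ (C * Real.exp (m * ‖v‖)) * (C' * Real.exp (m' * ‖v‖)) :=
        mul_le_mul (h v) (h' v) (abs_nonneg _) ((abs_nonneg _).trans (h v))
    _ = _ := by ring

lemma add (hk : ExpGrowth k) (hk' : ExpGrowth k') : ExpGrowth (fun v => k v + k' v) := by
  obtain ⟨C, m, h⟩ := hk.bound
  obtain ⟨C', m', h'⟩ := hk'.bound
  have hC : 0 ≤ C := by have := (abs_nonneg _).trans (h 0); simpa using this
  have hC' : 0 ≤ C' := by have := (abs_nonneg _).trans (h' 0); simpa using this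
  refine ⟨hk.cont.add hk'.cont, C + C', max m m', fun v => ?_⟩
  calc _ ≤ |k v| + |k' v| := abs_add_le _ _
    _ ≤ C * Real.exp (m * ‖v‖) + C' * Real.exp (m' * ‖v‖) := add_le_add (h v) (h' v)
    _ ≤ C * Real.exp (max m m' * ‖v‖) + C' * Real.exp (max m m' * ‖v‖) := by
        gcongr
        · exact le_max_left _ _
        · exact le_max_right _ _
    _ = _ := by ring

lemma sum {ι : Type*} (s : Finset ι) {k : ι → E N → ℝ} (hk : ∀ i ∈ s, ExpGrowth (k i)) :
    ExpGrowth (fun v => ∑ i ∈ s, k i v) := by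
  classical
  induction s using Finset.induction_on with
  | empty => simpa using const 0
  | insert i s hi ih =>
    simp_rw [Finset.sum_insert hi]
    exact (hk i (by simp)).add (ih fun j hj => hk j (by simp [hj]))

variable {A : Matrix (Fin N) (Fin N) ℝ}

lemma invCoord (i : Fin N) : ExpGrowth (invCoord A i) :=
  sum _ fun j _ => (const _).mul (coord j)

lemma invForm : ExpGrowth (invForm A) :=
  sum Finset.univ fun i _ => (coord i).mul (invCoord (A := A) i)

lemma expDecay (hk : ExpGrowth k) (hA : A.PosDef) {t : ℝ} (ht : 0 < t) :
    ExpDecay (fun v => k v * heatK A t v) := by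
  obtain ⟨C, m, h⟩ := hk.bound
  exact ExpDecay.mul_heatK hA ht hk.cont h

end ExpGrowth

variable {A : Matrix (Fin N) (Fin N) ℝ}

lemma expDecay_heatK (hA : A.PosDef) {t : ℝ} (ht : 0 < t) : ExpDecay (heatK A t) := by
  simpa using (ExpGrowth.const 1).expDecay hA ht

lemma expDecay_heatKt (hA : A.PosDef) {t : ℝ} (ht : 0 < t) : ExpDecay (heatKt A t) := by
  refine ((ExpGrowth.const _).add ?_).expDecay hA ht
  simpa only [div_eq_mul_inv] using ExpGrowth.invForm.mul (ExpGrowth.const _)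

lemma expDecay_pd_heatK (hA : A.PosDef) {t : ℝ} (ht : 0 < t) (i : Fin N) :
    ExpDecay (pd i (heatK A t)) := by
  have : pd i (heatK A t) = _ := funext fun v => pd_heatK hA ht i v
  rw [this]
  exact ((ExpGrowth.const _).mul (ExpGrowth.invCoord i)).expDecay hA ht

lemma expDecay_pd_pd_heatK (hA : A.PosDef) {t : ℝ} (ht : 0 < t) (i j : Fin N) :
    ExpDecay (pd j (pd i (heatK A t))) := by
  have : pd j (pd i (heatK A t)) = _ := funext fun v => pd_pd_heatK hA ht i j v
  rw [this]
  exact ((ExpGrowth.const _).add ((ExpGrowth.const _).mul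
    ((ExpGrowth.invCoord i).mul (ExpGrowth.invCoord j)))).expDecay hA ht

lemma invForm_nonneg (hA : A.PosDef) (v : E N) : 0 ≤ invForm A v := by
  obtain ⟨δ, hδ, h⟩ := invForm_lower_bound hA
  exact (by positivity : 0 ≤ δ * ‖v‖ ^ 2).trans (h v)

/-! ### Dependence of the heat operators on time -/

/-- The time derivatives of the heat kernel are dominated locally uniformly in time. -/
lemma exists_bound_heatKt (hA : A.PosDef) {t : ℝ} (ht : 0 < t) :
    ∃ g : E N → ℝ, ExpDecay g ∧ ∀ r ∈ Set.Icc (t / 2) (2 * t), ∀ v, |heatKt A r v| ≤ g v := by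
  have hdet := hA.det_pos
  -- On `[t/2, 2t]` the prefactor `(4πr)^(-N/2)` is largest at `r = t/2` and the exponential at `r =
  -- 2t`; `κ` is the ratio of the prefactors at these two times.
  set κ := (4 * Real.pi * (t / 2)) ^ (-(N : ℝ) / 2) / (4 * Real.pi * (2 * t)) ^ (-(N : ℝ) / 2)
  have hκ : 0 < κ := by positivity
  refine ⟨fun v => (κ * (N / t) + invForm A v * (κ / t ^ 2)) * heatK A (2 * t) v,
    ((ExpGrowth.const _).add (ExpGrowth.invForm.mul (ExpGrowth.const _))).expDecay hA
      (by positivity), fun r hr v => ?_⟩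
  have hr0 : 0 < r := by have := hr.1; linarith
  have hQ := invForm_nonneg hA v
  have h1 : heatK A r v ≤ κ * heatK A (2 * t) v := by
    have e1 : κ * heatK A (2 * t) v = (4 * Real.pi * (t / 2)) ^ (-(N : ℝ) / 2)
        * A.det ^ (-(1 / 2) : ℝ) * Real.exp (-invForm A v / (4 * (2 * t))) := by
      simp only [heatK, κ]
      field_simp
    rw [e1, heatK]
    have e2 : (4 * Real.pi * r) ^ (-(N : ℝ) / 2) ≤ (4 * Real.pi * (t / 2)) ^ (-(N : ℝ) / 2) := by
      refine Real.rpow_le_rpow_of_nonpos (by positivity) ?_ ?_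
      · have := hr.1; gcongr
      · rw [neg_div]; exact neg_nonpos.2 (by positivity)
    have e3 : -invForm A v / (4 * r) ≤ -invForm A v / (4 * (2 * t)) := by
      rw [neg_div, neg_div, neg_le_neg_iff]
      have := hr.2
      gcongr
    gcongr
  have h2 : |-(N : ℝ) / (2 * r) + invForm A v / (4 * r ^ 2)| ≤ N / t + invForm A v / t ^ 2 := by
    refine (abs_add_le _ _).trans (add_le_add ?_ ?_)
    · rw [abs_div, abs_neg, abs_of_nonneg (by positivity : (0 : ℝ) ≤ N), abs_of_pos (by positivity)]
      have := hr.1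
      gcongr
      linarith
    · rw [abs_of_nonneg (by positivity)]
      have := hr.1
      gcongr
      nlinarith
  rw [heatKt, abs_mul, abs_of_pos (heatK_pos hA hr0 v)]
  calc _ ≤ (N / t + invForm A v / t ^ 2) * (κ * heatK A (2 * t) v) := by
        have := (heatK_pos hA hr0 v).le
        gcongr
    _ = _ := by ring

lemma Icc_mem_nhds_time {t : ℝ} (ht : 0 < t) : Set.Icc (t / 2) (2 * t) ∈ 𝓝 t :=
  Icc_mem_nhds (by linarith) (by linarith)

variable [Fact (1 ≤ p)]

lemma hasDerivAt_convCLM_heatK (hA : A.PosDef) {t : ℝ} (ht : 0 < t) (b : ℝ) (hp : 1 < p)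
    (hpt : p ≠ ⊤) :
    HasDerivAt (fun r => convCLM p b (heatK A r)) (convCLM p b (heatKt A t)) t := by
  obtain ⟨g, hg, hgb⟩ := exists_bound_heatKt hA ht
  refine hasDerivAt_convCLM (g := g) ?_ (expDecay_heatKt hA ht) hg ?_
    (fun v => hasDerivAt_heatK ht v) hp hpt
  · filter_upwards [lt_mem_nhds ht] with r hr using expDecay_heatK hA hr
  · filter_upwards [nhdsWithin_le_nhds (Icc_mem_nhds_time ht), self_mem_nhdsWithin] with r hr hne v
    -- The mean value inequality turns the bound on the time derivative into a bound on difference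
    -- quotients.
    have := (convex_Icc (t / 2) (2 * t)).norm_image_sub_le_of_norm_hasDerivWithin_le
      (f := fun r => heatK A r v) (f' := fun r => heatKt A r v) (C := g v) (x := t) (y := r)
      (fun s hs => (hasDerivAt_heatK (by have := hs.1; linarith) v).hasDerivWithinAt)
      (fun s hs => hgb s hs v) (mem_of_mem_nhds (Icc_mem_nhds_time ht)) hr
    rw [slope_def_field, abs_div, div_le_iff₀ (abs_pos.2 (sub_ne_zero.2 hne))]
    exact this

lemma continuousOn_convCLM_heatKt (hA : A.PosDef) (b : ℝ) (hp : 1 < p) (hpt : p ≠ ⊤) :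
    ContinuousOn (fun r => convCLM p b (heatKt A r)) (Set.Ioi 0) := by
  intro t ht
  refine ContinuousAt.continuousWithinAt ?_
  rw [Set.mem_Ioi] at ht
  obtain ⟨g, hg, hgb⟩ := exists_bound_heatKt hA ht
  refine tendsto_convCLM (g := g) ?_ (expDecay_heatKt hA ht) hg ?_ (fun v => ?_) hp hpt
  · filter_upwards [lt_mem_nhds ht] with r hr using expDecay_heatKt hA hr
  · filter_upwards [Icc_mem_nhds_time ht] with r hr using hgb r hr
  · have h1 : ContinuousAt (fun r => heatK A r v) t := (hasDerivAt_heatK ht v).continuousAt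
    have h2 : ContinuousAt (fun r : ℝ => -(N : ℝ) / (2 * r) + invForm A v / (4 * r ^ 2)) t := by
      refine ContinuousAt.add (ContinuousAt.div ?_ ?_ ?_) (ContinuousAt.div ?_ ?_ ?_)
      all_goals first | fun_prop | positivity
    exact h2.mul h1

/-- Parabolic scaling `v = √t w` replaces all small times by one fixed Gaussian, which makes the
limits and bounds as `t → 0` uniform. -/
lemma integral_heatK_smul {F : Type*} [NormedAddCommGroup F] [NormedSpace ℝ F] {t : ℝ}
    (ht : 0 < t) (φ : E N → F) :
    ∫ v, heatK A t v • φ v = ∫ w, heatK A 1 w • φ (Real.sqrt t • w) := by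
  have hs : 0 < Real.sqrt t := Real.sqrt_pos.2 ht
  have h1 := Measure.integral_comp_smul (volume : Measure (E N)) (fun v => heatK A t v • φ v)
    (Real.sqrt t)
  have h2 (w : E N) : heatK A t (Real.sqrt t • w) = ((Real.sqrt t) ^ N)⁻¹ * heatK A 1 w := by
    have e1 : invForm A (Real.sqrt t • w) = t * invForm A w := by
      simp only [invForm, WithLp.ofLp_smul, Matrix.mulVec_smul, smul_dotProduct, dotProduct_smul,
        smul_eq_mul]
      rw [← mul_assoc, Real.mul_self_sqrt ht.le]
    have e2 : (4 * Real.pi * t) ^ (-(N : ℝ) / 2)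
        = ((Real.sqrt t) ^ N)⁻¹ * (4 * Real.pi * 1) ^ (-(N : ℝ) / 2) := by
      rw [Real.mul_rpow (by positivity) ht.le, mul_one, mul_comm]
      congr 1
      rw [Real.sqrt_eq_rpow, ← Real.rpow_natCast, ← Real.rpow_mul ht.le, ← Real.rpow_neg ht.le]
      ring_nf
    rw [heatK, heatK, e1, e2, mul_one]
    have : -(t * invForm A w) / (4 * t) = -invForm A w / 4 := by field_simp
    rw [this]
    ring_nf
  rw [abs_of_pos (by positivity)] at h1
  simp only [h2, finrank_euclideanSpace_fin] at h1
  simp only [mul_smul, integral_smul] at h1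
  exact (smul_right_injective F (by positivity : ((Real.sqrt t) ^ N)⁻¹ ≠ 0) h1).symm

/-- After scaling, `t` enters only through `e^{|b| √t |w|}`, which increases with `t`. This bounds
the heat operators uniformly for `0 < t ≤ 1`. -/
lemma integral_exp_mul_heatK_le (hA : A.PosDef) {t : ℝ} (ht : 0 < t) (ht1 : t ≤ 1) (b : ℝ) :
    ∫ v, Real.exp (|b| * ‖v‖) * |heatK A t v| ≤ ∫ v, Real.exp (|b| * ‖v‖) * |heatK A 1 v| := by
  have e (s : ℝ) (hs : 0 < s) : ∫ v, Real.exp (|b| * ‖v‖) * |heatK A s v|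
      = ∫ w, heatK A 1 w • Real.exp (|b| * ‖Real.sqrt s • w‖) := by
    rw [← integral_heatK_smul hs (fun v => Real.exp (|b| * ‖v‖))]
    refine integral_congr_ae (ae_of_all _ fun v => ?_)
    simp only
    rw [abs_of_pos (heatK_pos hA hs v), smul_eq_mul, mul_comm]
  rw [e t ht]
  refine integral_mono_of_nonneg (ae_of_all _ fun w => ?_)
    ((expDecay_heatK hA zero_lt_one).integrable_exp_mul b) (ae_of_all _ fun w => ?_)
  · exact smul_nonneg (heatK_pos hA zero_lt_one w).le (Real.exp_nonneg _)
  · have h0 := heatK_pos hA zero_lt_one w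
    simp only
    rw [abs_of_pos h0, smul_eq_mul, mul_comm]
    gcongr
    rw [norm_smul, Real.norm_of_nonneg (Real.sqrt_nonneg _)]
    exact mul_le_of_le_one_left (norm_nonneg _) (Real.sqrt_le_one.2 ht1)

end DysonTaylor
namespace DysonTaylor

variable {N : ℕ} {p : ℝ≥0∞}

/-! ### Strong continuity at time zero -/

lemma tendsto_eLpNorm_sub_of_dominated {ι : Type*} {l : Filter ι} [l.IsCountablyGenerated]
    {α : Type*} [MeasurableSpace α] {μ : Measure α} (hp0 : p ≠ 0) (hpt : p ≠ ⊤)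
    {F : ι → α → ℂ} {f : α → ℂ} {g : α → ℝ} (hF : ∀ᶠ n in l, AEStronglyMeasurable (F n) μ)
    (hf : AEStronglyMeasurable f μ) (hg : MemLp g p μ) (hb : ∀ᶠ n in l, ∀ x, ‖F n x - f x‖ ≤ g x)
    (hlim : ∀ x, Tendsto (fun n => F n x) l (𝓝 (f x))) :
    Tendsto (fun n => eLpNorm (F n - f) p μ) l (𝓝 0) := by
  have hpr : 0 < p.toReal := ENNReal.toReal_pos hp0 hpt
  have h1 : Tendsto (fun n => ∫⁻ x, ‖F n x - f x‖ₑ ^ p.toReal ∂μ) l (𝓝 (∫⁻ _, 0 ∂μ)) := by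
    refine tendsto_lintegral_filter_of_dominated_convergence' (fun x => ‖g x‖ₑ ^ p.toReal)
      ?_ ?_ ?_ ?_
    · filter_upwards [hF] with n hn
      exact ((hn.sub hf).enorm).pow_const _
    · filter_upwards [hb] with n hn
      refine ae_of_all _ fun x => ?_
      gcongr
      rw [enorm_le_iff_norm_le]
      exact (hn x).trans (le_abs_self _)
    · exact (lintegral_rpow_enorm_lt_top_of_eLpNorm_lt_top hp0 hpt hg.2).ne
    · refine ae_of_all _ fun x => ?_
      have h2 : Tendsto (fun n => ‖F n x - f x‖ₑ) l (𝓝 0) := by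
        have := ((hlim x).sub_const (f x)).enorm
        simpa using this
      have := (ENNReal.continuous_rpow_const (y := p.toReal)).tendsto 0
      rw [ENNReal.zero_rpow_of_pos hpr] at this
      exact this.comp h2
  rw [lintegral_zero] at h1
  have h3 := (ENNReal.continuous_rpow_const (y := 1 / p.toReal)).tendsto 0
  rw [ENNReal.zero_rpow_of_pos (by positivity)] at h3
  refine (h3.comp h1).congr fun n => ?_
  rw [eLpNorm_eq_lintegral_rpow_enorm_toReal hp0 hpt]
  rfl

variable {A : Matrix (Fin N) (Fin N) ℝ}

lemma conv_eq_integral_sub (k : E N → ℝ) (f : E N → ℂ) (x : E N) :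
    conv k f x = ∫ v, k v • f (x - v) := by
  rw [conv, kerOp, ← integral_sub_left_eq_self (fun v => k v • f (x - v)) volume x]
  simp

/-- After parabolic scaling the integrand is `G_1(w) g(x - √t w)`; it is dominated by a multiple of
`G_1`, whose integral is 1. -/
lemma tendsto_conv_heatK (hA : A.PosDef) {g : E N → ℂ} (hg : Continuous g)
    (hgs : HasCompactSupport g) (x : E N) :
    Tendsto (fun t => conv (heatK A t) g x) (𝓝[>] 0) (𝓝 (g x)) := by
  obtain ⟨C, hC⟩ := hgs.exists_bound_of_continuous hg
  have hint := (expDecay_heatK hA zero_lt_one).integrable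
  have h1 : Tendsto (fun t => ∫ w, heatK A 1 w • g (x - Real.sqrt t • w)) (𝓝[>] 0)
      (𝓝 (∫ w, heatK A 1 w • g x)) := by
    refine tendsto_integral_filter_of_dominated_convergence (fun w => C * heatK A 1 w)
      (Eventually.of_forall fun t => ?_) (Eventually.of_forall fun t => ae_of_all _ fun w => ?_)
      (hint.const_mul C) (ae_of_all _ fun w => ?_)
    · exact ((contDiff_heatK 1).continuous.smul (hg.comp (by fun_prop))).aestronglyMeasurable
    · have := (heatK_pos hA zero_lt_one w).le
      rw [norm_smul, Real.norm_of_nonneg this, mul_comm]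
      gcongr
      exact hC _
    · refine Tendsto.const_smul ?_ _
      have : Continuous fun t : ℝ => g (x - Real.sqrt t • w) := hg.comp (by fun_prop)
      have h2 := this.tendsto 0
      simp only [Real.sqrt_zero, zero_smul, sub_zero] at h2
      exact h2.mono_left nhdsWithin_le_nhds
  rw [integral_smul_const, integral_heatK hA zero_lt_one, one_smul] at h1
  refine h1.congr' ?_
  filter_upwards [self_mem_nhdsWithin] with t ht
  rw [conv_eq_integral_sub, integral_heatK_smul (Set.mem_Ioi.1 ht) (fun v => g (x - v))]

variable [Fact (1 ≤ p)]

/-- The decay rate `B` of `g` is preserved with a constant independent of `t ≤ 1`. This is the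
dominating function for the limit `t → 0` in `L^p_b`. -/
lemma norm_conv_heatK_le (hA : A.PosDef) {g : E N → ℂ} {B C : ℝ}
    (hg : ∀ y, ‖g y‖ ≤ C * weight (-B) y) {t : ℝ} (ht : 0 < t) (ht1 : t ≤ 1) (x : E N) :
    ‖conv (heatK A t) g x‖
      ≤ C * (∫ v, Real.exp (|B| * ‖v‖) * |heatK A 1 v|) * weight (-B) x := by
  have hC : 0 ≤ C := by
    have h := (norm_nonneg _).trans (hg 0)
    exact nonneg_of_mul_nonneg_left h (weight_pos _ _)
  have h1 := (expDecay_heatK hA ht).integrable_exp_mul B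
  calc ‖conv (heatK A t) g x‖
      = ‖∫ v, heatK A t v • g (x - v)‖ := by rw [conv_eq_integral_sub]
    _ ≤ ∫ v, C * weight (-B) x * (Real.exp (|B| * ‖v‖) * |heatK A t v|) := by
        refine norm_integral_le_of_norm_le (h1.const_mul _) (ae_of_all _ fun v => ?_)
        have h2 : weight (-B) (x - v) ≤ weight (-B) x * Real.exp (|B| * ‖v‖) := by
          have := weight_mul_weight_neg_le B x (x - v)
          rw [sub_sub_cancel] at this
          have h3 := mul_le_mul_of_nonneg_left this (weight_pos (-B) x).le
          rwa [← mul_assoc, weight_neg_mul, one_mul] at h3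
        rw [norm_smul, Real.norm_eq_abs]
        calc _ ≤ |heatK A t v| * (C * (weight (-B) x * Real.exp (|B| * ‖v‖))) := by
              gcongr
              exact (hg _).trans (by gcongr)
          _ = _ := by ring
    _ = C * weight (-B) x * ∫ v, Real.exp (|B| * ‖v‖) * |heatK A t v| := integral_const_mul _ _
    _ ≤ C * weight (-B) x * ∫ v, Real.exp (|B| * ‖v‖) * |heatK A 1 v| := by
        have := weight_pos (-B) x
        exact mul_le_mul_of_nonneg_left (integral_exp_mul_heatK_le hA ht ht1 B) (by positivity)
    _ = _ := by ring

lemma norm_toWLp_eq {b : ℝ} {f : E N → ℂ} (hf : MemWLp p b f) :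
    ‖toWLp p b f‖ = (eLpNorm (fun x => weight b x • f x) p volume).toReal := by
  rw [Lp.norm_def, eLpNorm_congr_ae (coeFn_toWLp hf)]

lemma memLp_weight_neg_one (hp : 1 < p) (C : ℝ) :
    MemLp (fun x : E N => C * weight (-1) x) p := by
  refine MemLp.of_le_mul (c := |C|) (memLp_exp_neg_norm_sub hp.le (0 : E N))
    ((continuous_weight (-1)).const_smul C).aestronglyMeasurable (ae_of_all _ fun x => ?_)
  rw [norm_mul, Real.norm_eq_abs, Real.norm_of_nonneg (weight_pos _ _).le,
    Real.norm_of_nonneg (Real.exp_nonneg _)]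
  gcongr
  rw [weight, zero_sub, norm_neg, Real.exp_le_exp]
  linarith [norm_le_japanese x]

lemma tendsto_convCLM_heatK_of_compact (hA : A.PosDef) (b : ℝ) (hp : 1 < p) (hpt : p ≠ ⊤)
    {g : E N → ℂ} (hg : Continuous g) (hgs : HasCompactSupport g) (hgm : MemWLp p b g) :
    Tendsto (fun t => convCLM p b (heatK A t) (toWLp p b g)) (𝓝[>] 0) (𝓝 (toWLp p b g)) := by
  have hp0 : p ≠ 0 := (zero_lt_one.trans hp).ne'
  -- One unit of decay beyond `b` is kept: after multiplication by `weight b`, the bound is a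
  -- multiple of `weight (-1)`, which lies in `L^p`.
  obtain ⟨C, hC⟩ : ∃ C, ∀ y, ‖g y‖ ≤ C * weight (-(b + 1)) y := by
    have hs : HasCompactSupport (weight (b + 1) • g) := hgs.smul_left
    obtain ⟨C, hC⟩ := hs.exists_bound_of_continuous ((continuous_weight (b + 1)).smul hg)
    refine ⟨C, fun y => ?_⟩
    have := hC y
    rw [Pi.smul_apply', norm_smul, Real.norm_of_nonneg (weight_pos _ _).le] at this
    have h2 := mul_le_mul_of_nonneg_right this (weight_pos (-(b + 1)) y).le
    rwa [mul_comm (weight (b + 1) y), mul_assoc, weight_mul_neg, mul_one] at h2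
  set M := ∫ v, Real.exp (|b + 1| * ‖v‖) * |heatK A 1 v|
  have hev : ∀ᶠ t : ℝ in 𝓝[>] 0, 0 < t ∧ t ≤ 1 := by
    filter_upwards [Ioc_mem_nhdsGT (zero_lt_one' ℝ)] with t ht using ht
  have key := tendsto_eLpNorm_sub_of_dominated (μ := (volume : Measure (E N))) (l := 𝓝[>] (0 : ℝ))
    hp0 hpt
    (F := fun t x => weight b x • conv (heatK A t) g x) (f := fun x => weight b x • g x)
    (g := fun x => (C * M + C) * weight (-1) x) ?_ hgm.1 (memLp_weight_neg_one hp _) ?_ ?_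
  · rw [tendsto_iff_norm_sub_tendsto_zero]
    have h3 := (ENNReal.tendsto_toReal ENNReal.zero_ne_top).comp key
    rw [ENNReal.toReal_zero] at h3
    refine h3.congr' ?_
    filter_upwards [hev] with t ht
    have hm := (expDecay_heatK hA ht.1).memWLp hp hpt hgm
    have hk := expDecay_heatK hA ht.1
    have e1 : convCLM p b (heatK A t) (toWLp p b g) - toWLp p b g
        = toWLp p b (conv (heatK A t) g + (-1 : ℝ) • g) := by
      rw [convCLM_toWLp hk hp hpt hgm, toWLp_add hm (hgm.const_smul _), toWLp_smul hgm]
      simp [sub_eq_add_neg]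
    rw [e1, norm_toWLp_eq (hm.add (hgm.const_smul _))]
    simp only [Function.comp]
    congr 2
    funext x
    simp only [Pi.sub_apply, Pi.add_apply, Pi.smul_apply, smul_add]
    rw [neg_one_smul, smul_neg, sub_eq_add_neg]
  · filter_upwards [hev] with t ht
    exact ((expDecay_heatK hA ht.1).memWLp hp hpt hgm).1
  · filter_upwards [hev] with t ht x
    rw [← smul_sub, norm_smul, Real.norm_of_nonneg (weight_pos _ _).le]
    have h1 := norm_conv_heatK_le hA hC ht.1 ht.2 x
    calc weight b x * ‖conv (heatK A t) g x - g x‖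
        ≤ weight b x * ((C * M + C) * weight (-(b + 1)) x) := by
          have := weight_pos b x
          gcongr
          refine (norm_sub_le _ _).trans ?_
          rw [add_mul]
          exact add_le_add h1 (hC x)
      _ = (C * M + C) * (weight b x * weight (-(b + 1)) x) := by ring
      _ = _ := by rw [weight_mul]; ring_nf
  · intro x
    exact (tendsto_conv_heatK hA hg hgs x).const_smul _

lemma norm_convCLM_heatK_le (hA : A.PosDef) (b : ℝ) (hp : 1 < p) (hpt : p ≠ ⊤) {t : ℝ}
    (ht : 0 < t) (ht1 : t ≤ 1) :
    ‖convCLM p b (heatK A t)‖ ≤ ∫ v, Real.exp (|b| * ‖v‖) * |heatK A 1 v| :=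
  (norm_convCLM_le (expDecay_heatK hA ht) hp hpt).trans (integral_exp_mul_heatK_le hA ht ht1 b)

/-- Continuous functions with compact support are dense, and the operators are uniformly bounded for
`t ≤ 1`; so convergence on the dense set extends to all of `L^p_b`. -/
lemma tendsto_convCLM_heatK (hA : A.PosDef) (b : ℝ) (hp : 1 < p) (hpt : p ≠ ⊤)
    (F : Lp ℂ p (volume : Measure (E N))) :
    Tendsto (fun t => convCLM p b (heatK A t) F) (𝓝[>] 0) (𝓝 F) := by
  set M := ∫ v, Real.exp (|b| * ‖v‖) * |heatK A 1 v| with hM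
  have hM0 : 0 ≤ M := integral_nonneg fun v => by positivity
  have hev : ∀ᶠ t : ℝ in 𝓝[>] 0, 0 < t ∧ t ≤ 1 := by
    filter_upwards [Ioc_mem_nhdsGT (zero_lt_one' ℝ)] with t ht using ht
  rw [Metric.tendsto_nhds]
  intro ε hε
  set η := ε / (2 * (M + 1)) with hη
  have hη0 : 0 < η := by positivity
  obtain ⟨g, hgs, hgε, hgc, hgm⟩ := (Lp.memLp F).exists_hasCompactSupport_eLpNorm_sub_le hpt
    (ε := ENNReal.ofReal η) (by simpa using hη0)
  set g' : E N → ℂ := fun x => weight (-b) x • g x with hg'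
  have hg'm : MemWLp p b g' := by
    refine (memLp_congr_ae (ae_of_all _ fun x => ?_)).1 hgm
    simp only [hg', smul_smul, weight_mul_neg, one_smul]
  have hg's : HasCompactSupport (weight (-b) • g) := hgs.smul_left
  have hlim := tendsto_convCLM_heatK_of_compact hA b hp hpt (g := g')
    ((continuous_weight (-b)).smul hgc) hg's hg'm
  set G := toWLp p b g'
  have hFG : ‖F - G‖ ≤ η := by
    rw [Lp.norm_def]
    refine ENNReal.toReal_le_of_le_ofReal hη0.le ?_
    refine le_trans (le_of_eq (eLpNorm_congr_ae ?_)) hgε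
    filter_upwards [Lp.coeFn_sub F G, coeFn_toWLp hg'm] with x h1 h2
    rw [h1, Pi.sub_apply, Pi.sub_apply, h2]
    simp only [hg', smul_smul, weight_mul_neg, one_smul]
  filter_upwards [hev, Metric.tendsto_nhds.1 hlim (ε / 2) (by positivity)] with t ht h2
  rw [dist_eq_norm] at h2 ⊢
  have h3 : convCLM p b (heatK A t) F - F = convCLM p b (heatK A t) (F - G)
      + (convCLM p b (heatK A t) G - G) - (F - G) := by
    rw [map_sub]; abel
  have h4 : ‖convCLM p b (heatK A t) (F - G)‖ ≤ M * η :=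
    ((convCLM p b (heatK A t)).le_opNorm _).trans
      (mul_le_mul (norm_convCLM_heatK_le hA b hp hpt ht.1 ht.2) hFG (norm_nonneg _) hM0)
  have h5 : (M + 1) * η = ε / 2 := by rw [hη]; field_simp
  rw [h3]
  calc _ ≤ ‖convCLM p b (heatK A t) (F - G)‖ + ‖convCLM p b (heatK A t) G - G‖ + ‖F - G‖ :=
        (norm_sub_le _ _).trans (by gcongr; exact norm_add_le _ _)
    _ < M * η + ε / 2 + η := by linarith
    _ = ε := by linarith

end DysonTaylor
namespace DysonTaylor

variable {N : ℕ} {p : ℝ≥0∞}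

/-! ### Classical solutions for constant coefficients -/

/-- The operator `∑ A_ij ∂_i ∂_j`. -/
def constOp (A : Matrix (Fin N) (Fin N) ℝ) : DiffOp N where
  a i j _ := A i j
  b _ _ := 0
  c _ := 0

lemma hasLineDerivAt_comp_sub {k : E N → ℝ} (hk : ContDiff ℝ ∞ k) (i : Fin N) (x y : E N) :
    HasLineDerivAt ℝ (fun x => k (x - y)) (pd i k (x - y)) x (EuclideanSpace.single i 1) := by
  have hd : HasFDerivAt (fun x => k (x - y))
      ((fderiv ℝ k (x - y)).comp (ContinuousLinearMap.id ℝ (E N))) x := by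
    refine HasFDerivAt.comp x (g := k) (hk.differentiable (by simp) _).hasFDerivAt ?_
    exact (hasFDerivAt_id x).sub_const y
  simpa [pd] using hd.hasLineDerivAt (EuclideanSpace.single i 1)

lemma hasWeakPartial_conv {k : E N → ℝ} (hk : ContDiff ℝ ∞ k) (hk0 : ExpDecay k) {i : Fin N}
    (hk1 : ExpDecay (pd i k)) {b : ℝ} (hp : 1 < p) (hpt : p ≠ ⊤) {f : E N → ℂ}
    (hf : MemWLp p b f) : HasWeakPartial i (conv k f) (conv (pd i k) f) :=
  (hk0.kernelBdd b).hasWeakPartial (hk1.kernelBdd b) (hasLineDerivAt_comp_sub hk i) hp hpt hf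

variable {A : Matrix (Fin N) (Fin N) ℝ}

lemma hasW2_conv_heatK (hA : A.PosDef) {t : ℝ} (ht : 0 < t) {b : ℝ} (hp : 1 < p) (hpt : p ≠ ⊤)
    {f : E N → ℂ} (hf : MemWLp p b f) :
    HasW2 p b (conv (heatK A t) f) (fun i => conv (pd i (heatK A t)) f)
      (fun i j => conv (pd j (pd i (heatK A t))) f) where
  mem := (expDecay_heatK hA ht).memWLp hp hpt hf
  partial_one i := hasWeakPartial_conv (contDiff_heatK t) (expDecay_heatK hA ht)
    (expDecay_pd_heatK hA ht i) hp hpt hf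
  mem_one i := (expDecay_pd_heatK hA ht i).memWLp hp hpt hf
  partial_two i j := hasWeakPartial_conv (contDiff_pd (contDiff_heatK t) i)
    (expDecay_pd_heatK hA ht i) (expDecay_pd_pd_heatK hA ht i j) hp hpt hf
  mem_two i j := (expDecay_pd_pd_heatK hA ht i j).memWLp hp hpt hf

lemma weakPartial_weakPartial_ae {b : ℝ} {f : E N → ℂ} {g : Fin N → E N → ℂ}
    {H : Fin N → Fin N → E N → ℂ} (h : HasW2 p b f g H) (i j : Fin N) :
    weakPartial i (weakPartial j f) =ᵐ[volume] H j i := by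
  rw [weakPartial_congr (h.partial_one j).weakPartial_ae]
  exact (h.partial_two j i).weakPartial_ae

lemma DiffOp.apply_ae {b : ℝ} {f : E N → ℂ} {g : Fin N → E N → ℂ}
    {H : Fin N → Fin N → E N → ℂ} (h : HasW2 p b f g H) (M : DiffOp N) :
    M.apply f =ᵐ[volume] fun x => (∑ i, ∑ j, M.a i j x • H j i x)
      + (∑ i, M.b i x • g i x) + M.c x • f x := by
  have h1 : ∀ᵐ x, ∀ i j, weakPartial i (weakPartial j f) x = H j i x := by
    rw [ae_all_iff]; intro i
    rw [ae_all_iff]; intro j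
    exact weakPartial_weakPartial_ae h i j
  have h2 : ∀ᵐ x, ∀ i, weakPartial i f x = g i x := by
    rw [ae_all_iff]; exact fun i => (h.partial_one i).weakPartial_ae
  filter_upwards [h1, h2] with x hx1 hx2
  simp only [DiffOp.apply, hx1, hx2]

lemma constOp_apply_ae {b : ℝ} {f : E N → ℂ} {g : Fin N → E N → ℂ}
    {H : Fin N → Fin N → E N → ℂ} (h : HasW2 p b f g H) :
    (constOp A).apply f =ᵐ[volume] ∑ i, ∑ j, A i j • H j i := by
  refine (DiffOp.apply_ae h _).trans (ae_of_all _ fun x => ?_)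
  simp [constOp]

lemma kerOp_sum {ι : Type*} (s : Finset ι) {K : ι → E N → E N → ℝ} {a b : ℝ}
    (hK : ∀ i ∈ s, KernelBdd a b (K i)) (hp : 1 < p) {f : E N → ℂ} (hf : MemWLp p a f) :
    kerOp (fun x y => ∑ i ∈ s, K i x y) f = ∑ i ∈ s, kerOp (K i) f := by
  funext x
  simp only [kerOp, Finset.sum_smul, Finset.sum_apply]
  exact integral_finsetSum s fun i hi => (hK i hi).integrable hp hf x

lemma kerOp_sum_fun {ι : Type*} (s : Finset ι) {K : E N → E N → ℝ} {a b : ℝ}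
    (hK : KernelBdd a b K) (hp : 1 < p) {f : ι → E N → ℂ} (hf : ∀ i ∈ s, MemWLp p a (f i)) :
    kerOp K (∑ i ∈ s, f i) = ∑ i ∈ s, kerOp K (f i) := by
  funext x
  simp only [kerOp, Finset.smul_sum, Finset.sum_apply]
  exact integral_finsetSum s fun i hi => hK.integrable hp (hf i hi) x

lemma sum_conv_pd_pd_heatK (hA : A.PosDef) {t : ℝ} (ht : 0 < t) {b : ℝ} (hp : 1 < p)
    {f : E N → ℂ} (hf : MemWLp p b f) :
    ∑ i, ∑ j, A i j • conv (pd i (pd j (heatK A t))) f = conv (heatKt A t) f := by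
  have hk (i j : Fin N) := ((expDecay_pd_pd_heatK hA ht j i).kernelBdd b).const_mul (A i j)
  have hks (i : Fin N) : KernelBdd b b (fun x y => ∑ j, A i j * pd i (pd j (heatK A t)) (x - y)) :=
    by
      have : ∀ s : Finset (Fin N),
          KernelBdd b b (fun x y => ∑ j ∈ s, A i j * pd i (pd j (heatK A t)) (x - y)) := by
        intro s
        induction s using Finset.induction_on with
        | empty =>
          simp only [Finset.sum_empty]
          exact ⟨continuous_const, 0, fun x y => by simp⟩
        | insert j s hj ih =>
          simp_rw [Finset.sum_insert hj]
          exact (hk i j).add ih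
      exact this _
  have e : conv (heatKt A t) f
      = kerOp (fun x y => ∑ i, ∑ j, A i j * pd i (pd j (heatK A t)) (x - y)) f := by
    simp_rw [sum_pd_pd_heatK hA ht]
    rfl
  rw [e, kerOp_sum _ (fun i _ => hks i) hp hf]
  refine Finset.sum_congr rfl fun i _ => ?_
  rw [kerOp_sum _ (fun j _ => hk i j) hp hf]
  refine Finset.sum_congr rfl fun j _ => ?_
  rw [kerOp_const_mul]
  rfl

lemma constOp_apply_conv_heatK (hA : A.PosDef) {t : ℝ} (ht : 0 < t) {b : ℝ} (hp : 1 < p)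
    (hpt : p ≠ ⊤) {f : E N → ℂ} (hf : MemWLp p b f) :
    (constOp A).apply (conv (heatK A t) f) =ᵐ[volume] conv (heatKt A t) f := by
  refine (constOp_apply_ae (hasW2_conv_heatK hA ht hp hpt hf)).trans (ae_of_all _ fun x => ?_)
  exact congrFun (sum_conv_pd_pd_heatK hA ht hp hf) x

/-- Both derivatives move from `f` to the kernel, and the symmetry of `A` absorbs their change of
order. So the generator commutes with the heat operator on `W^{2,p}_b`, the cancellation on which
uniqueness rests. -/
lemma conv_heatK_constOp_apply (hA : A.PosDef) {t : ℝ} (ht : 0 < t) {b : ℝ} (hp : 1 < p)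
    {f : E N → ℂ} {g : Fin N → E N → ℂ} {H : Fin N → Fin N → E N → ℂ}
    (h : HasW2 p b f g H) :
    conv (heatK A t) ((constOp A).apply f) = conv (heatKt A t) f := by
  have hk := (expDecay_heatK hA ht).kernelBdd b
  rw [conv, kerOp_congr (constOp_apply_ae h),
    kerOp_sum_fun (f := fun i => ∑ j, A i j • H j i) _ hk hp fun i _ =>
    memWLp_sum _ fun j _ => (h.mem_two j i).const_smul _,
    ← sum_conv_pd_pd_heatK hA ht hp h.mem, Finset.sum_comm]
  have e (i : Fin N) : kerOp (fun x y => heatK A t (x - y)) (∑ j, A i j • H j i)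
      = ∑ j, A i j • conv (pd j (pd i (heatK A t))) f := by
    rw [kerOp_sum_fun _ hk hp fun j _ => (h.mem_two j i).const_smul _]
    refine Finset.sum_congr rfl fun j _ => ?_
    rw [kerOp_smul_fun]
    congr 1
    change conv (heatK A t) (H j i) = _
    rw [(h.partial_two j i).conv_eq hp (h.mem_one j) (h.mem_two j i) (contDiff_heatK t)
      (expDecay_heatK hA ht) (expDecay_pd_heatK hA ht i),
      (h.partial_one j).conv_eq hp h.mem (h.mem_one j) (contDiff_pd (contDiff_heatK t) i)
      (expDecay_pd_heatK hA ht i) (expDecay_pd_pd_heatK hA ht i j)]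
  rw [Finset.sum_congr rfl fun i _ => e i]
  refine Finset.sum_congr rfl fun i _ => Finset.sum_congr rfl fun j _ => ?_
  have : A i j = A j i := by simpa using hA.isHermitian.apply j i
  rw [this]

variable [Fact (1 ≤ p)]

lemma isClassicalSolution_heat (hA : A.PosDef) {b : ℝ} (hp : 1 < p) (hpt : p ≠ ⊤)
    {f : E N → ℂ} (hf : MemWLp p b f) :
    IsClassicalSolution (constOp A) p b f
      (fun t => if 0 < t then conv (heatK A t) f else f) := by
  have e1 (t : ℝ) (ht : 0 < t) : toWLp p b (if 0 < t then conv (heatK A t) f else f)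
      = convCLM p b (heatK A t) (toWLp p b f) := by
    rw [if_pos ht, convCLM_toWLp (expDecay_heatK hA ht) hp hpt hf]
  have e2 (t : ℝ) (ht : 0 < t) :
      toWLp p b ((constOp A).apply (if 0 < t then conv (heatK A t) f else f))
      = convCLM p b (heatKt A t) (toWLp p b f) := by
    rw [if_pos ht, convCLM_toWLp (expDecay_heatKt hA ht) hp hpt hf]
    exact toWLp_congr (constOp_apply_conv_heatK hA ht hp hpt hf)
  have hderiv (t : ℝ) (ht : 0 < t) :
      HasDerivAt (fun r => toWLp p b (if 0 < r then conv (heatK A r) f else f))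
        (toWLp p b ((constOp A).apply (if 0 < t then conv (heatK A t) f else f))) t := by
    rw [e2 t ht]
    have := (hasDerivAt_convCLM_heatK hA ht b hp hpt).clm_apply
      (hasDerivAt_const t (toWLp p b f))
    simp only [map_zero, add_zero] at this
    refine this.congr_of_eventuallyEq ?_
    filter_upwards [lt_mem_nhds ht] with r hr using e1 r hr
  refine ⟨fun t ht => ?_, fun t ht => ?_, by simp, fun t ht => ?_, hderiv, ?_⟩
  · split_ifs with h
    · exact (expDecay_heatK hA h).memWLp hp hpt hf
    · exact hf
  · rcases (Set.mem_Ici.1 ht).eq_or_lt with h | h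
    · subst h
      -- At time zero the one-sided neighbourhood splits into the point itself, where the value is
      -- `f`, and positive times, where strong continuity applies.
      rw [ContinuousWithinAt, ← Set.Ioi_insert, nhdsWithin_insert]
      refine Tendsto.sup ?_ ?_
      · exact tendsto_pure_nhds _ _
      · rw [if_neg (lt_irrefl _)]
        refine (tendsto_convCLM_heatK hA b hp hpt (toWLp p b f)).congr' ?_
        filter_upwards [self_mem_nhdsWithin] with r hr using (e1 r hr).symm
    · exact (hderiv t h).continuousAt.continuousWithinAt
  · simp only [if_pos ht]
    exact ⟨(hasW2_conv_heatK hA ht hp hpt hf).memWSobolev,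
      ((expDecay_heatKt hA ht).memWLp hp hpt hf).congr
        (constOp_apply_conv_heatK hA ht hp hpt hf).symm⟩
  · have := (continuousOn_convCLM_heatKt hA b hp hpt).clm_apply
      (continuousOn_const (c := toWLp p b f))
    exact this.congr fun t ht => e2 t ht

/-- Uniqueness: with `S(r)` the heat operator, `s ↦ S(t - s) u(s)` has derivative `-S'(t - s) u +
S(t - s) L_0 u = 0` on `(0, t)`, and its limits at the two ends are `S(t) f` and `u(t)`. -/
lemma IsClassicalSolution.ae_eq (hA : A.PosDef) {b : ℝ} (hp : 1 < p) (hpt : p ≠ ⊤)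
    {f : E N → ℂ} {u : ℝ → E N → ℂ} (hu : IsClassicalSolution (constOp A) p b f u) {t : ℝ}
    (ht : 0 < t) : u t =ᵐ[volume] conv (heatK A t) f := by
  have hf : MemWLp p b f := (hu.mem 0 le_rfl).congr hu.initial
  set U : ℝ → Lp ℂ p (volume : Measure (E N)) := fun s => toWLp p b (u s) with hU
  set S : ℝ → (Lp ℂ p (volume : Measure (E N)) →L[ℝ] Lp ℂ p (volume : Measure (E N))) :=
    fun r => convCLM p b (heatK A r) with hS
  have hSd (r : ℝ) (hr : 0 < r) := hasDerivAt_convCLM_heatK (p := p) hA hr b hp hpt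
  have hd : ∀ s ∈ Set.Ioo 0 t, HasDerivAt (fun s => S (t - s) (U s)) 0 s := by
    intro s hs
    have hr : 0 < t - s := sub_pos.2 hs.2
    have h1 : HasDerivAt (fun s => S (t - s)) (-convCLM p b (heatKt A (t - s))) s := by
      have h2 : HasDerivAt (fun s => t - s) (-1) s := by
        simpa using (hasDerivAt_id s).const_sub t
      exact ((hSd (t - s) hr).scomp s h2).congr_deriv (by simp)
    have h3 := h1.clm_apply (hu.deriv s hs.1)
    refine h3.congr_deriv ?_
    obtain ⟨g, H, hw⟩ := (hu.domain s hs.1).1.hasW2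
    rw [neg_apply, convCLM_toWLp (expDecay_heatKt hA hr) hp hpt (hu.mem s hs.1.le),
      hS, convCLM_toWLp (expDecay_heatK hA hr) hp hpt (hu.domain s hs.1).2,
      conv_heatK_constOp_apply hA hr hp hw, neg_add_cancel]
  obtain ⟨c, hc⟩ : ∃ c, ∀ s ∈ Set.Ioo 0 t, S (t - s) (U s) = c := by
    refine ⟨S (t - t / 2) (U (t / 2)), fun s hs => ?_⟩
    refine isOpen_Ioo.is_const_of_deriv_eq_zero isPreconnected_Ioo
      (fun r hr => (hd r hr).differentiableAt.differentiableWithinAt)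
      (fun r hr => (hd r hr).deriv) hs ⟨by linarith, by linarith⟩
  -- At `s → 0` the operators `S(t - s)` stay away from time zero and converge in norm.
  have l0 : Tendsto (fun s => S (t - s) (U s)) (𝓝[>] 0) (𝓝 (S t (U 0))) := by
    have h1 : Tendsto (fun s => S (t - s)) (𝓝[>] 0) (𝓝 (S t)) := by
      have h2 : ContinuousAt S (t - 0) := by
        rw [sub_zero]; exact (hSd t ht).continuousAt
      have h3 : Tendsto (fun s : ℝ => t - s) (𝓝[>] 0) (𝓝 (t - 0)) :=
        ((continuous_const.sub continuous_id).tendsto 0).mono_left nhdsWithin_le_nhds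
      have := h2.tendsto.comp h3
      rwa [sub_zero] at this
    have h4 : Tendsto U (𝓝[>] 0) (𝓝 (U 0)) :=
      (hu.cont 0 (by simp)).tendsto.mono_left (nhdsWithin_mono _ Set.Ioi_subset_Ici_self)
    exact ((isBoundedBilinearMap_apply (𝕜 := ℝ)).continuous.tendsto (S t, U 0)).comp
      (h1.prodMk_nhds h4)
  -- At `s → t` only strong convergence is available, so `S(t - s) U(s)` is split as `S(t - s) (U(s)
  -- - U(t)) + S(t - s) U(t)`; the uniform bound controls the first term.
  have lt : Tendsto (fun s => S (t - s) (U s)) (𝓝[<] t) (𝓝 (U t)) := by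
    have h3 : Tendsto (fun s : ℝ => t - s) (𝓝[<] t) (𝓝[>] 0) := by
      rw [tendsto_nhdsWithin_iff]
      refine ⟨?_, ?_⟩
      · have : Continuous fun s : ℝ => t - s := by fun_prop
        exact (this.tendsto' t 0 (sub_self t)).mono_left nhdsWithin_le_nhds
      · filter_upwards [self_mem_nhdsWithin] with s hs using Set.mem_Ioi.2 (sub_pos.2 (Set.mem_Iio.1 hs))
    have h5 := (tendsto_convCLM_heatK hA b hp hpt (U t)).comp h3
    have h6 : Tendsto U (𝓝[<] t) (𝓝 (U t)) :=
      (hu.deriv t ht).continuousAt.tendsto.mono_left nhdsWithin_le_nhds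
    have h7 : Tendsto (fun s => S (t - s) (U s - U t)) (𝓝[<] t) (𝓝 0) := by
      have h8 := (tendsto_iff_norm_sub_tendsto_zero.1 h6).const_mul
        (∫ v, Real.exp (|b| * ‖v‖) * |heatK A 1 v|)
      rw [mul_zero] at h8
      refine squeeze_zero_norm' ?_ h8
      filter_upwards [h3 (Ioc_mem_nhdsGT (zero_lt_one' ℝ))] with s hs
      refine ((S (t - s)).le_opNorm _).trans ?_
      gcongr
      exact norm_convCLM_heatK_le hA b hp hpt hs.1 hs.2
    have h9 := h7.add h5
    rw [zero_add] at h9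
    refine h9.congr fun s => ?_
    simp only [Function.comp, map_sub, hS]
    abel
  have hc0 : S t (U 0) = c := by
    refine tendsto_nhds_unique l0 (tendsto_const_nhds.congr' ?_)
    filter_upwards [Ioo_mem_nhdsGT ht] with s hs using (hc s hs).symm
  have hct : U t = c := by
    refine tendsto_nhds_unique lt (tendsto_const_nhds.congr' ?_)
    filter_upwards [Ioo_mem_nhdsLT ht] with s hs using (hc s hs).symm
  refine toWLp_inj (hu.mem t ht.le) ((expDecay_heatK hA ht).memWLp hp hpt hf) ?_
  rw [← convCLM_toWLp (expDecay_heatK hA ht) hp hpt hf, ← toWLp_congr hu.initial]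
  exact hct.trans hc0.symm

/-- By uniqueness it does not matter which solution `expOp` selects. -/
lemma expOp_ae_eq (hA : A.PosDef) {b : ℝ} (hp : 1 < p) (hpt : p ≠ ⊤) {f : E N → ℂ}
    (hf : MemWLp p b f) {t : ℝ} (ht : 0 < t) :
    expOp (constOp A) p b t f =ᵐ[volume] conv (heatK A t) f := by
  have hex : ∃ u, IsClassicalSolution (constOp A) p b f u :=
    ⟨_, isClassicalSolution_heat hA hp hpt hf⟩
  rw [expOp, dif_pos hex]
  exact hex.choose_spec.ae_eq hA hp hpt ht

/-- The semigroup property of the heat operators. -/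
lemma conv_heatK_conv_heatK (hA : A.PosDef) {b : ℝ} (hp : 1 < p) (hpt : p ≠ ⊤) {f : E N → ℂ}
    (hf : MemWLp p b f) {s t : ℝ} (hs : 0 < s) (ht : 0 < t) :
    conv (heatK A s) (conv (heatK A t) f) =ᵐ[volume] conv (heatK A (s + t)) f := by
  have h := isClassicalSolution_heat hA hp hpt hf
  set u : ℝ → E N → ℂ := fun t => if 0 < t then conv (heatK A t) f else f with hu
  have h0 (r : ℝ) (hr : 0 ≤ r) : 0 < r + t := by linarith
  -- The solution starting from `f`, shifted by `t`, is a classical solution with initial value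
  -- `conv (heatK A t) f`; uniqueness does the rest.
  have hv : IsClassicalSolution (constOp A) p b (conv (heatK A t) f) (fun r => u (r + t)) := by
    refine ⟨fun r hr => h.mem _ (h0 r hr).le, ?_, ?_, fun r hr => h.domain _ (h0 r hr.le),
      fun r hr => (h.deriv _ (h0 r hr.le)).comp_add_const r t, ?_⟩
    · exact h.cont.comp (by fun_prop) fun r hr => (h0 r hr).le
    · simp [hu, ht]
    · exact h.cont_deriv.comp (f := fun r => r + t) (by fun_prop) fun r hr => h0 r (le_of_lt hr)
  have := hv.ae_eq hA hp hpt hs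
  simp only [hu, if_pos (h0 s hs.le)] at this
  exact this.symm

end DysonTaylor
namespace DysonTaylor

variable {N : ℕ} {p : ℝ≥0∞}

/-! ### Kernels of polynomial times Gaussian form -/

/-- Polynomials in the coordinates of `x - z` (left) and of `x - y` (right). -/
abbrev KerPoly (N : ℕ) : Type := MvPolynomial (Fin N ⊕ Fin N) ℝ

/-- Evaluation at `x - z = u` and `x - y = v`. -/
noncomputable def evalP (u v : E N) (q : KerPoly N) : ℝ :=
  MvPolynomial.eval (Sum.elim u.ofLp v.ofLp) q

/-- The kernel `q(x - z, x - y) G_T(x - y)`. -/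
noncomputable def polyKer (A : Matrix (Fin N) (Fin N) ℝ) (T : ℝ) (z : E N) (q : KerPoly N)
    (x y : E N) : ℝ :=
  evalP (x - z) (x - y) q * heatK A T (x - y)

open MvPolynomial in
/-- The action on polynomials of the derivative with respect to the coordinate `x_i`. -/
noncomputable def dX (A : Matrix (Fin N) (Fin N) ℝ) (T : ℝ) (i : Fin N) (q : KerPoly N) :
    KerPoly N :=
  pderiv (Sum.inl i) q + pderiv (Sum.inr i) q
    + ∑ j, C (-(1 / (2 * T)) * A⁻¹ i j) * (X (Sum.inr j) * q)

open MvPolynomial in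
/-- The action on polynomials of the conjugate of multiplication by `(x - z)_i` with the heat
operator at time `s`. -/
noncomputable def mulX (A : Matrix (Fin N) (Fin N) ℝ) (T s : ℝ) (i : Fin N) (q : KerPoly N) :
    KerPoly N :=
  X (Sum.inl i) * q + ∑ j, C (2 * s * A i j) * dX A T j q

variable {A : Matrix (Fin N) (Fin N) ℝ} {T : ℝ} {z : E N}

lemma mulX_zero (i : Fin N) (q : KerPoly N) :
    mulX A T 0 i q = MvPolynomial.X (Sum.inl i) * q := by
  simp [mulX]

lemma evalP_add (u v : E N) (q q' : KerPoly N) :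
    evalP u v (q + q') = evalP u v q + evalP u v q' := map_add _ _ _

lemma evalP_mul (u v : E N) (q q' : KerPoly N) :
    evalP u v (q * q') = evalP u v q * evalP u v q' := map_mul _ _ _

lemma evalP_sum {ι : Type*} (s : Finset ι) (u v : E N) (q : ι → KerPoly N) :
    evalP u v (∑ i ∈ s, q i) = ∑ i ∈ s, evalP u v (q i) := map_sum _ _ _

lemma evalP_C (u v : E N) (c : ℝ) : evalP u v (MvPolynomial.C c) = c := MvPolynomial.eval_C _

lemma evalP_X_inl (u v : E N) (i : Fin N) : evalP u v (MvPolynomial.X (Sum.inl i)) = u i :=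
  MvPolynomial.eval_X _

lemma evalP_X_inr (u v : E N) (i : Fin N) : evalP u v (MvPolynomial.X (Sum.inr i)) = v i :=
  MvPolynomial.eval_X _

lemma contDiff_evalP (q : KerPoly N) :
    ContDiff ℝ ∞ (fun w : E N × E N => evalP w.1 w.2 q) := by
  induction q using MvPolynomial.induction_on with
  | C c => simpa only [evalP_C] using contDiff_const
  | add q q' h h' => simpa only [evalP_add] using h.add h'
  | mul_X q i h =>
    simp only [evalP_mul]
    refine h.mul ?_
    rcases i with i | i
    · simp only [evalP_X_inl]
      exact (contDiff_coord i).comp contDiff_fst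
    · simp only [evalP_X_inr]
      exact (contDiff_coord i).comp contDiff_snd

/-- The rate `ε` is arbitrary because it must fit into the gap between two weights. In the induction
each factor takes half of the rate. -/
lemma abs_evalP_le (q : KerPoly N) {ε : ℝ} (hε : 0 < ε) :
    ∃ C, ∀ u v, |evalP u v q| ≤ C * Real.exp (ε * ‖u‖ + ε * ‖v‖) := by
  have hcoord (ε : ℝ) (hε : 0 < ε) (v : E N) (i : Fin N) : |v i| ≤ ε⁻¹ * Real.exp (ε * ‖v‖) := by
    have h1 : |v i| ≤ ‖v‖ := PiLp.norm_apply_le v i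
    have h2 := Real.add_one_le_exp (ε * ‖v‖)
    rw [inv_mul_eq_div, le_div_iff₀ hε]
    nlinarith
  induction q using MvPolynomial.induction_on generalizing ε with
  | C c =>
    refine ⟨|c|, fun u v => ?_⟩
    rw [evalP_C]
    exact le_mul_of_one_le_right (abs_nonneg _) (Real.one_le_exp (by positivity))
  | add q q' h h' =>
    obtain ⟨C, hC⟩ := h hε
    obtain ⟨C', hC'⟩ := h' hε
    refine ⟨C + C', fun u v => ?_⟩
    rw [evalP_add, add_mul]
    exact (abs_add_le _ _).trans (add_le_add (hC u v) (hC' u v))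
  | mul_X q i h =>
    obtain ⟨C, hC⟩ := h (half_pos hε)
    refine ⟨C * (ε / 2)⁻¹, fun u v => ?_⟩
    have hi : |evalP u v (MvPolynomial.X i)|
        ≤ (ε / 2)⁻¹ * Real.exp (ε / 2 * ‖u‖ + ε / 2 * ‖v‖) := by
      rcases i with i | i
      · rw [evalP_X_inl]
        refine (hcoord _ (half_pos hε) u i).trans ?_
        gcongr
        exact le_add_of_nonneg_right (by positivity)
      · rw [evalP_X_inr]
        refine (hcoord _ (half_pos hε) v i).trans ?_
        gcongr
        exact le_add_of_nonneg_left (by positivity)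
    rw [evalP_mul, abs_mul]
    calc _ ≤ (C * Real.exp (ε / 2 * ‖u‖ + ε / 2 * ‖v‖))
          * ((ε / 2)⁻¹ * Real.exp (ε / 2 * ‖u‖ + ε / 2 * ‖v‖)) :=
          mul_le_mul (hC u v) hi (abs_nonneg _) ((abs_nonneg _).trans (hC u v))
      _ = C * (ε / 2)⁻¹ * (Real.exp (ε / 2 * ‖u‖ + ε / 2 * ‖v‖)
          * Real.exp (ε / 2 * ‖u‖ + ε / 2 * ‖v‖)) := by ring
      _ = _ := by rw [← Real.exp_add]; ring_nf

lemma continuous_evalP (q : KerPoly N) :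
    Continuous (fun w : E N × E N => evalP w.1 w.2 q) := (contDiff_evalP q).continuous

lemma continuous_polyKer (z : E N) (q : KerPoly N) :
    Continuous (Function.uncurry (polyKer A T z q)) := by
  have h0 : Continuous fun w : E N × E N => (w.1 - z, w.1 - w.2) := by fun_prop
  have h1 : Continuous fun w : E N × E N => evalP (w.1 - z) (w.1 - w.2) q := by
    have := (continuous_evalP q).comp h0
    exact this
  have h2 : Continuous fun w : E N × E N => heatK A T (w.1 - w.2) :=
    (contDiff_heatK T).continuous.comp (by fun_prop)
  exact h1.mul h2

/-- The growth in `x - z` is absorbed by `weight (b - a) x`, which is where the strict inequality `b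
< a` enters; the growth in `x - y` and the transfer of the weight are absorbed by the Gaussian. -/
lemma kernelBdd_polyKer (hA : A.PosDef) (hT : 0 < T) (z : E N) (q : KerPoly N) {a b : ℝ}
    (hab : b < a) : KernelBdd a b (polyKer A T z q) := by
  refine ⟨continuous_polyKer z q, ?_⟩
  set ε := a - b with hε
  have hε0 : 0 < ε := sub_pos.2 hab
  obtain ⟨C, hC⟩ := abs_evalP_le q hε0
  -- The rate `ε` pays for the polynomial in `x - y`, `|a|` for moving the weight, and 1 is left
  -- over for `KernelBdd`.
  obtain ⟨D, hD⟩ := (expDecay_heatK hA hT).bound (ε + |a| + 1)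
  have hC0 : 0 ≤ C := by
    have := (abs_nonneg _).trans (hC 0 0)
    simpa using this
  refine ⟨C * Real.exp (ε * ‖z‖) * D, fun x y => ?_⟩
  have h1 : weight b x * weight (-a) y ≤ weight (-ε) x * Real.exp (|a| * ‖x - y‖) := by
    have h2 := weight_mul_weight_neg_le a x y
    have h3 : weight b x = weight (-ε) x * weight a x := by
      rw [weight_mul]; congr 1; rw [hε]; ring
    rw [h3, mul_assoc]
    exact mul_le_mul_of_nonneg_left h2 (weight_pos _ _).le
  have h4 : Real.exp (ε * ‖x - z‖) * weight (-ε) x ≤ Real.exp (ε * ‖z‖) := by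
    rw [weight, ← Real.exp_add, Real.exp_le_exp]
    have h5 := norm_sub_le x z
    have h6 := norm_le_japanese x
    nlinarith
  calc weight b x * |polyKer A T z q x y| * weight (-a) y
      = (weight b x * weight (-a) y) * |evalP (x - z) (x - y) q| * |heatK A T (x - y)| := by
        rw [polyKer, abs_mul]; ring
    _ ≤ (weight (-ε) x * Real.exp (|a| * ‖x - y‖))
        * (C * Real.exp (ε * ‖x - z‖ + ε * ‖x - y‖))
        * (D * Real.exp (-(ε + |a| + 1) * ‖x - y‖)) := by
        have := (weight_pos (-ε) x).le
        gcongr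
        · exact hC _ _
        · exact hD _
    _ = C * D * (Real.exp (ε * ‖x - z‖) * weight (-ε) x) * (Real.exp (|a| * ‖x - y‖)
        * Real.exp (ε * ‖x - y‖) * Real.exp (-(ε + |a| + 1) * ‖x - y‖)) := by
        rw [Real.exp_add]; ring
    _ ≤ C * D * Real.exp (ε * ‖z‖) * (Real.exp (|a| * ‖x - y‖)
        * Real.exp (ε * ‖x - y‖) * Real.exp (-(ε + |a| + 1) * ‖x - y‖)) := by
        have hD0 : 0 ≤ D := by
          have := (abs_nonneg _).trans (hD 0)
          simpa using this
        gcongr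
    _ = _ := by
        rw [← Real.exp_add, ← Real.exp_add]
        ring_nf

/-- The variable `x` occurs in both groups `x - z` and `x - y`, so both partial derivatives
contribute. -/
lemma hasLineDerivAt_evalP (q : KerPoly N) (z : E N) (i : Fin N) (x y : E N) :
    HasLineDerivAt ℝ (fun x => evalP (x - z) (x - y) q)
      (evalP (x - z) (x - y)
        (MvPolynomial.pderiv (Sum.inl i) q + MvPolynomial.pderiv (Sum.inr i) q)) x
      (EuclideanSpace.single i 1) := by
  have hX (w : E N) (j : Fin N) : HasDerivAt
      (fun t : ℝ => (x + t • EuclideanSpace.single i (1 : ℝ) - w) j)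
      (if j = i then 1 else 0) 0 := by
    have : (fun t : ℝ => (x + t • EuclideanSpace.single i (1 : ℝ) - w) j)
        = fun t => (x j - w j) + t * (if j = i then 1 else 0) := by
      funext t
      simp
      ring
    rw [this]
    simpa using ((hasDerivAt_id (0 : ℝ)).mul_const (if j = i then (1 : ℝ) else 0)).const_add
      (x j - w j)
  unfold HasLineDerivAt
  induction q using MvPolynomial.induction_on with
  | C c =>
    simp only [evalP_C, MvPolynomial.pderiv_C, add_zero]
    have : evalP (x - z) (x - y) (0 : KerPoly N) = 0 := map_zero _
    rw [this]
    exact hasDerivAt_const _ _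
  | add q q' h h' =>
    simp only [evalP_add] at h h' ⊢
    refine (h.add h').congr_deriv ?_
    simp only [map_add, evalP_add]
    ring
  | mul_X q k h =>
    simp only [evalP_mul]
    have hk : HasDerivAt (fun t : ℝ => evalP (x + t • EuclideanSpace.single i (1 : ℝ) - z)
        (x + t • EuclideanSpace.single i (1 : ℝ) - y) (MvPolynomial.X k))
        (if k = Sum.inl i ∨ k = Sum.inr i then 1 else 0) 0 := by
      rcases k with k | k
      · simpa only [evalP_X_inl, Sum.inl.injEq, reduceCtorEq, or_false] using hX z k
      · simpa only [evalP_X_inr, Sum.inr.injEq, reduceCtorEq, false_or] using hX y k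
    refine (h.mul hk).congr_deriv ?_
    simp only [zero_smul, add_zero, MvPolynomial.pderiv_mul, evalP_add, evalP_mul,
      MvPolynomial.pderiv_X]
    rcases k with k | k
    · by_cases hki : k = i
      · subst hki
        simp [evalP]
        ring
      · have : (Sum.inl k : Fin N ⊕ Fin N) ≠ Sum.inl i := by simpa using hki
        simp [evalP, hki]
        ring
    · by_cases hki : k = i
      · subst hki
        simp [evalP]
        ring
      · simp [evalP, hki]
        ring

/-- The sum in `dX` is the derivative of the Gaussian factor, `∂_i G_T(v) = -(1 / 2T) (A⁻¹ v)_i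
G_T(v)`. -/
lemma hasLineDerivAt_polyKer (hA : A.PosDef) (hT : 0 < T) (z : E N) (q : KerPoly N) (i : Fin N)
    (x y : E N) :
    HasLineDerivAt ℝ (fun x => polyKer A T z q x y) (polyKer A T z (dX A T i q) x y) x
      (EuclideanSpace.single i 1) := by
  have h1 := hasLineDerivAt_evalP q z i x y
  have h2 := hasLineDerivAt_comp_sub (contDiff_heatK (A := A) T) i x y
  unfold HasLineDerivAt at h1 h2 ⊢
  refine (h1.mul h2).congr_deriv ?_
  simp only [zero_smul, add_zero, pd_heatK hA hT, polyKer, dX, evalP_add, evalP_sum, evalP_mul,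
    evalP_C, evalP_X_inr, invCoord]
  have e : ∀ j, -(1 / (2 * T)) * A⁻¹ i j * ((x - y) j * evalP (x - z) (x - y) q)
      = (A⁻¹ i j * (x - y) j) * (-(1 / (2 * T)) * evalP (x - z) (x - y) q) := fun j => by ring
  simp_rw [e, ← Finset.sum_mul]
  ring

/-- The integral operator with kernel `q(x - z, x - y) G_T(x - y)`. -/
noncomputable def polyOp (A : Matrix (Fin N) (Fin N) ℝ) (T : ℝ) (z : E N) (f : E N → ℂ)
    (q : KerPoly N) : E N → ℂ :=
  kerOp (polyKer A T z q) f

lemma polyOp_one (f : E N → ℂ) : polyOp A T z f 1 = conv (heatK A T) f := by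
  unfold polyOp conv
  congr 1
  funext x y
  simp [polyKer, evalP]

lemma polyOp_C_mul (f : E N → ℂ) (c : ℝ) (q : KerPoly N) :
    polyOp A T z f (MvPolynomial.C c * q) = c • polyOp A T z f q := by
  unfold polyOp
  rw [← kerOp_const_mul]
  congr 1
  funext x y
  rw [polyKer, evalP_mul, evalP_C, polyKer, mul_assoc]

lemma polyOp_X_mul (f : E N → ℂ) (i : Fin N) (q : KerPoly N) (x : E N) :
    polyOp A T z f (MvPolynomial.X (Sum.inl i) * q) x = (x - z) i • polyOp A T z f q x := by
  simp only [polyOp, kerOp]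
  rw [← integral_smul]
  refine integral_congr_ae (ae_of_all _ fun y => ?_)
  simp only [polyKer, evalP_mul, evalP_X_inl, mul_assoc, mul_smul]

section

variable {a b : ℝ} {f : E N → ℂ} (hA : A.PosDef) (hT : 0 < T) (hab : b < a) (hp : 1 < p)
  (hpt : p ≠ ⊤) (hf : MemWLp p a f)

include hA hT hp hf

lemma polyOp_add (q q' : KerPoly N) :
    polyOp A T z f (q + q') = polyOp A T z f q + polyOp A T z f q' := by
  -- Any target weight below `a` would do; it serves only to make the integrals converge.
  have hab : a - 1 < a := by linarith
  unfold polyOp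
  rw [← (kernelBdd_polyKer hA hT z q hab).kerOp_add (kernelBdd_polyKer hA hT z q' hab) hp hf]
  congr 1
  funext x y
  simp only [polyKer, evalP_add, add_mul]

lemma polyOp_sum {ι : Type*} (s : Finset ι) (q : ι → KerPoly N) :
    polyOp A T z f (∑ i ∈ s, q i) = ∑ i ∈ s, polyOp A T z f (q i) := by
  classical
  induction s using Finset.induction_on with
  | empty =>
    have := polyOp_C_mul (A := A) (T := T) (z := z) f 0 0
    simpa using this
  | insert i s hi ih =>
    rw [Finset.sum_insert hi, Finset.sum_insert hi, polyOp_add hA hT hp hf, ih]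

include hab hpt

lemma memWLp_polyOp (q : KerPoly N) : MemWLp p b (polyOp A T z f q) :=
  (kernelBdd_polyKer hA hT z q hab).memWLp hp hpt hf

lemma hasWeakPartial_polyOp (q : KerPoly N) (i : Fin N) :
    HasWeakPartial i (polyOp A T z f q) (polyOp A T z f (dX A T i q)) :=
  (kernelBdd_polyKer hA hT z q hab).hasWeakPartial (kernelBdd_polyKer hA hT z _ hab)
    (hasLineDerivAt_polyKer hA hT z q i) hp hpt hf

lemma hasW2_polyOp (q : KerPoly N) :
    HasW2 p b (polyOp A T z f q) (fun i => polyOp A T z f (dX A T i q))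
      (fun i j => polyOp A T z f (dX A T j (dX A T i q))) where
  mem := memWLp_polyOp hA hT hab hp hpt hf q
  partial_one i := hasWeakPartial_polyOp hA hT hab hp hpt hf q i
  mem_one _ := memWLp_polyOp hA hT hab hp hpt hf _
  partial_two _ j := hasWeakPartial_polyOp hA hT hab hp hpt hf _ j
  mem_two _ _ := memWLp_polyOp hA hT hab hp hpt hf _

end

/-! ### Commutation with the heat operators -/

/-- The heat operator at time `s` maps the operator of `q` at time `T` to that of `q'`
at time `s + T`. -/
def HeatRel (A : Matrix (Fin N) (Fin N) ℝ) (T s : ℝ) (z : E N) (f : E N → ℂ)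
    (q q' : KerPoly N) : Prop :=
  conv (heatK A s) (polyOp A T z f q) =ᵐ[volume] polyOp A (s + T) z f q'

namespace HeatRel

variable {a : ℝ} {f : E N → ℂ} {s : ℝ} {q q' r r' : KerPoly N}

lemma C_mul (h : HeatRel A T s z f q q') (c : ℝ) :
    HeatRel A T s z f (MvPolynomial.C c * q) (MvPolynomial.C c * q') := by
  unfold HeatRel
  rw [polyOp_C_mul, polyOp_C_mul, conv, kerOp_smul_fun]
  filter_upwards [h] with x hx
  rw [Pi.smul_apply, Pi.smul_apply]
  exact congrArg _ hx

section

variable (hA : A.PosDef) (hT : 0 < T) (hs : 0 < s) (hp : 1 < p) (hpt : p ≠ ⊤)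
  (hf : MemWLp p a f)

include hA hT hs hp hpt hf

lemma add (h : HeatRel A T s z f q q') (h' : HeatRel A T s z f r r') :
    HeatRel A T s z f (q + r) (q' + r') := by
  have hab : a - 1 < a := by linarith
  unfold HeatRel
  rw [polyOp_add hA hT hp hf, polyOp_add hA (add_pos hs hT) hp hf, conv,
    ((expDecay_heatK hA hs).kernelBdd (a - 1)).kerOp_add_fun hp
      (memWLp_polyOp hA hT hab hp hpt hf _) (memWLp_polyOp hA hT hab hp hpt hf _)]
  filter_upwards [h, h'] with x hx hx'
  rw [Pi.add_apply, Pi.add_apply, ← hx, ← hx']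
  rfl

lemma sum {ι : Type*} (S : Finset ι) {q q' : ι → KerPoly N}
    (h : ∀ i ∈ S, HeatRel A T s z f (q i) (q' i)) :
    HeatRel A T s z f (∑ i ∈ S, q i) (∑ i ∈ S, q' i) := by
  classical
  induction S using Finset.induction_on with
  | empty =>
    have h0 (T : ℝ) : polyOp A T z f (0 : KerPoly N) = 0 := by
      simpa using polyOp_C_mul (A := A) (T := T) (z := z) f 0 0
    have h1 := kerOp_smul_fun (fun x y => heatK A s (x - y)) 0 (0 : E N → ℂ)
    rw [zero_smul, zero_smul] at h1
    rw [Finset.sum_empty, Finset.sum_empty]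
    unfold HeatRel
    rw [h0, h0, conv, h1]
  | insert i S hi ih =>
    rw [Finset.sum_insert hi, Finset.sum_insert hi]
    exact add hA hT hs hp hpt hf (h i (by simp)) (ih fun j hj => h j (by simp [hj]))

/-- Both sides are weak derivatives in direction `i` of functions that agree almost everywhere,
hence they agree almost everywhere. -/
lemma conv_pd (h : HeatRel A T s z f q q') (i : Fin N) :
    conv (pd i (heatK A s)) (polyOp A T z f q)
      =ᵐ[volume] polyOp A (s + T) z f (dX A (s + T) i q') := by
  have hab : a - 1 < a := by linarith
  have h1 := hasWeakPartial_conv (contDiff_heatK s) (expDecay_heatK hA hs)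
    (expDecay_pd_heatK hA hs i) hp hpt (memWLp_polyOp (z := z) hA hT hab hp hpt hf q)
  exact (h1.congr h (ae_eq_refl _)).ae_unique
    (hasWeakPartial_polyOp hA (add_pos hs hT) hab hp hpt hf q' i)

/-- Heat operators commute with derivatives: the derivative moves onto the convolution kernel, and
from there outside by `conv_pd`. -/
lemma dX (h : HeatRel A T s z f q q') (i : Fin N) :
    HeatRel A T s z f (dX A T i q) (dX A (s + T) i q') := by
  have hab : a - 1 < a := by linarith
  unfold HeatRel
  rw [(hasWeakPartial_polyOp hA hT hab hp hpt hf q i).conv_eq hp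
    (memWLp_polyOp hA hT hab hp hpt hf _) (memWLp_polyOp hA hT hab hp hpt hf _)
    (contDiff_heatK s) (expDecay_heatK hA hs) (expDecay_pd_heatK hA hs i)]
  exact conv_pd hA hT hs hp hpt hf h i

/-- This is the relation `e^{sL_0} (x - z)_i = ((x - z)_i + 2s ∑_j A_ij ∂_j) e^{sL_0}`. On the left,
time 0 makes `mulX` plain multiplication by `(x - z)_i`. -/
lemma mulX (h : HeatRel A T s z f q q') (i : Fin N) :
    HeatRel A T s z f (mulX A T 0 i q) (mulX A (s + T) s i q') := by
  have hab : a - 1 < a := by linarith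
  have hmem := memWLp_polyOp (z := z) hA hT hab hp hpt hf q
  unfold HeatRel
  rw [mulX_zero, DysonTaylor.mulX, polyOp_add hA (add_pos hs hT) hp hf,
    polyOp_sum hA (add_pos hs hT) hp hf]
  have h1 : ∀ᵐ x, ∀ j, conv (pd j (heatK A s)) (polyOp A T z f q) x
      = polyOp A (s + T) z f (DysonTaylor.dX A (s + T) j q') x := by
    rw [ae_all_iff]; exact fun j => conv_pd hA hT hs hp hpt hf h j
  filter_upwards [h, h1] with x hx hx1
  rw [Pi.add_apply, Finset.sum_apply, polyOp_X_mul, ← hx]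
  simp_rw [polyOp_C_mul, Pi.smul_apply, ← hx1]
  -- Write `(y - z)_i = (x - z)_i - (x - y)_i` and use `-v_i G_s(v) = 2s ∑_j A_ij ∂_j G_s(v)` at `v
  -- = x - y`.
  have hid (y : E N) : heatK A s (x - y) • polyOp A T z f (MvPolynomial.X (Sum.inl i) * q) y
      = (x - z) i • (heatK A s (x - y) • polyOp A T z f q y)
        + ∑ j, (2 * s * A i j) • (pd j (heatK A s) (x - y) • polyOp A T z f q y) := by
    rw [polyOp_X_mul]
    simp only [smul_smul, ← Finset.sum_smul, ← add_smul]
    congr 1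
    simp_rw [pd_heatK hA hs]
    have e : ∀ j, 2 * s * A i j * (-(1 / (2 * s)) * invCoord A j (x - y) * heatK A s (x - y))
        = (A i j * invCoord A j (x - y)) * (-heatK A s (x - y)) := by
      intro j; field_simp
    simp_rw [e]
    rw [← Finset.sum_mul, sum_mul_invCoord hA]
    simp only [PiLp.sub_apply]
    ring
  have i1 := ((expDecay_heatK hA hs).kernelBdd (a - 1)).integrable hp hmem x
  have i2 (j : Fin N) := ((expDecay_pd_heatK hA hs j).kernelBdd (a - 1)).integrable hp hmem x
  simp only [conv, kerOp]
  simp_rw [hid]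
  have i1' : Integrable fun y => (x - z) i • heatK A s (x - y) • polyOp A T z f q y :=
    i1.smul ((x - z) i)
  have i2' (j : Fin N) : Integrable fun y =>
      (2 * s * A i j) • pd j (heatK A s) (x - y) • polyOp A T z f q y := (i2 j).smul (2 * s * A i j)
  rw [integral_add i1' (integrable_finsetSum _ fun j _ => i2' j),
    integral_finsetSum _ fun j _ => i2' j, integral_smul]
  simp_rw [integral_smul]

end

end HeatRel

end DysonTaylor
namespace DysonTaylor

variable {N : ℕ} {p : ℝ≥0∞}

/-! ### Taylor coefficients of dilated functions -/

/-- In the Leibniz formula only the term that differentiates `s ^ j` exactly `j` times survives at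
0. For `j > m` the descending factorial vanishes, so the truncated `m - j` is harmless. -/
lemma iteratedDeriv_pow_mul_zero (m j : ℕ) {F : ℝ → ℝ} (hF : ContDiff ℝ ∞ F) :
    iteratedDeriv m (fun s => s ^ j * F s) 0
      = m.descFactorial j * iteratedDeriv (m - j) F 0 := by
  rw [iteratedDeriv_fun_mul (by fun_prop) (hF.contDiffAt.of_le (by exact_mod_cast le_top))]
  simp_rw [iteratedDeriv_fun_pow_zero]
  by_cases h : j ≤ m
  · rw [Finset.sum_eq_single j]
    · rw [if_pos rfl, Nat.descFactorial_eq_factorial_mul_choose]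
      push_cast
      ring
    · intro i _ hi
      simp [hi]
    · intro hj
      simp only [Finset.mem_range] at hj
      omega
  · rw [Nat.descFactorial_of_lt (by omega), Nat.cast_zero, zero_mul]
    refine Finset.sum_eq_zero fun i hi => ?_
    simp only [Finset.mem_range] at hi
    simp [show i ≠ j by omega]

/-- The derivative of order `m` at `0` of `r ↦ g(z + r(x - z))`. -/
noncomputable def taylorF (m : ℕ) (g : E N → ℝ) (z x : E N) : ℝ :=
  iteratedDeriv m (fun r : ℝ => g (z + r • (x - z))) 0

lemma taylorF_zero (g : E N → ℝ) (z x : E N) : taylorF 0 g z x = g z := by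
  simp [taylorF]

lemma contDiff_ray {g : E N → ℝ} (hg : ContDiff ℝ ∞ g) (z x : E N) :
    ContDiff ℝ ∞ (fun r : ℝ => g (z + r • (x - z))) :=
  hg.comp (by fun_prop)

lemma sum_coord_mul_pd (g : E N → ℝ) (y w : E N) : ∑ i, w i * pd i g y = fderiv ℝ g y w := by
  have hw : w = ∑ i, w i • EuclideanSpace.single i (1 : ℝ) := by
    ext j
    simp [Pi.single_apply]
  conv_rhs => rw [hw]
  rw [map_sum]
  simp [pd]

/-- By the chain rule along the ray. The recursion exhibits the Taylor coefficient as a polynomial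
in `x - z` with derivatives of `g` at `z` as coefficients; `tayP` copies it. -/
lemma taylorF_succ {g : E N → ℝ} (hg : ContDiff ℝ ∞ g) (m : ℕ) (z x : E N) :
    taylorF (m + 1) g z x = ∑ i, (x - z) i * taylorF m (pd i g) z x := by
  have h1 : deriv (fun r : ℝ => g (z + r • (x - z)))
      = fun r => ∑ i, (x - z) i * pd i g (z + r • (x - z)) := by
    funext r
    rw [sum_coord_mul_pd]
    have h2 : HasDerivAt (fun r : ℝ => z + r • (x - z)) (x - z) r := by
      simpa using ((hasDerivAt_id r).smul_const (x - z)).const_add z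
    exact ((hg.differentiable (by simp) _).hasFDerivAt.comp_hasDerivAt r h2).deriv
  rw [taylorF, iteratedDeriv_succ', h1, iteratedDeriv_fun_sum]
  · simp_rw [iteratedDeriv_const_mul_field]
    rfl
  · intro i _
    exact (contDiff_const.mul (contDiff_ray (contDiff_pd hg i) z x)).contDiffAt.of_le
      (by exact_mod_cast le_top)

section

variable {L : DiffOp N} (z x : E N) (m : ℕ)

lemma taylor_a (i j : Fin N) :
    (L.taylor z m).a i j x = (1 / m.factorial : ℝ) * taylorF m (L.a i j) z x := by
  simp only [DiffOp.taylor, DiffOp.dilate, taylorF]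
  ring

lemma taylor_b {i : Fin N} (h : ContDiff ℝ ∞ (L.b i)) :
    (L.taylor z m).b i x = (1 / m.factorial : ℝ)
      * (m.descFactorial 1 * taylorF (m - 1) (L.b i) z x) := by
  have := iteratedDeriv_pow_mul_zero m 1 (contDiff_ray h z x)
  simp only [pow_one] at this
  simp only [DiffOp.taylor, DiffOp.dilate, taylorF, this]
  ring

lemma taylor_c (h : ContDiff ℝ ∞ L.c) :
    (L.taylor z m).c x = (1 / m.factorial : ℝ)
      * (m.descFactorial 2 * taylorF (m - 2) L.c z x) := by
  have := iteratedDeriv_pow_mul_zero m 2 (contDiff_ray h z x)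
  simp only [DiffOp.taylor, DiffOp.dilate, taylorF, this]
  ring

end

/-! ### Taylor coefficients acting on polynomials -/

/-- The action on polynomials of the conjugate of multiplication by `taylorF m g z` with the heat
operator at time `s`. -/
noncomputable def tayP (A : Matrix (Fin N) (Fin N) ℝ) (T s : ℝ) (z : E N) :
    ℕ → (E N → ℝ) → KerPoly N → KerPoly N
  | 0, g, q => MvPolynomial.C (g z) * q
  | m + 1, g, q => ∑ i, mulX A T s i (tayP A T s z m (pd i g) q)

/-- The action on polynomials of the conjugate of `L_m^z` with the heat operator at time `s`. -/
noncomputable def opP (A : Matrix (Fin N) (Fin N) ℝ) (T s : ℝ) (z : E N) (L : DiffOp N) (m : ℕ)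
    (q : KerPoly N) : KerPoly N :=
  MvPolynomial.C (1 / m.factorial : ℝ) *
    ((∑ i, ∑ j, tayP A T s z m (L.a i j) (dX A T i (dX A T j q)))
      + (∑ i, MvPolynomial.C (m.descFactorial 1 : ℝ) * tayP A T s z (m - 1) (L.b i) (dX A T i q))
      + MvPolynomial.C (m.descFactorial 2 : ℝ) * tayP A T s z (m - 2) L.c q)

/-- The polynomial of the conjugate of the integrand of `Λ_{α,z}` with the heat operator
at time `s`. -/
noncomputable def dysonP (A : Matrix (Fin N) (Fin N) ℝ) (T : ℝ) (z : E N) (L : DiffOp N) :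
    (k : ℕ) → (Fin k → ℕ) → (Fin (k + 1) → ℝ) → ℝ → KerPoly N
  | 0, _, _, _ => 1
  | k + 1, α, τ, s =>
      opP A T (s + τ 0) z L (α 0) (dysonP A T z L k (Fin.tail α) (Fin.tail τ) (s + τ 0))

variable {A : Matrix (Fin N) (Fin N) ℝ} {T s : ℝ} {z : E N} {a b : ℝ} {f : E N → ℂ}

section

variable (hA : A.PosDef) (hT : 0 < T) (hp : 1 < p) (hf : MemWLp p a f)

include hA hT hp hf

/-- At time `s = 0` each `mulX` is multiplication by `(x - z)_i`, so `tayP` follows the recursion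
`taylorF_succ`. -/
lemma polyOp_tayP (m : ℕ) {g : E N → ℝ} (hg : ContDiff ℝ ∞ g) (q : KerPoly N) (x : E N) :
    polyOp A T z f (tayP A T 0 z m g q) x = taylorF m g z x • polyOp A T z f q x := by
  induction m generalizing g with
  | zero => rw [tayP, polyOp_C_mul, taylorF_zero]; rfl
  | succ m ih =>
    rw [tayP, polyOp_sum hA hT hp hf, Finset.sum_apply, taylorF_succ hg, Finset.sum_smul]
    refine Finset.sum_congr rfl fun i _ => ?_
    rw [mulX_zero, polyOp_X_mul, ih (contDiff_pd hg i), smul_smul]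

variable (hab : b < a) (hpt : p ≠ ⊤)

include hab hpt

lemma taylor_apply_polyOp {L : DiffOp N} (ha : ∀ i j, ContDiff ℝ ∞ (L.a i j))
    (hb : ∀ i, ContDiff ℝ ∞ (L.b i)) (hc : ContDiff ℝ ∞ L.c) (m : ℕ) (q : KerPoly N) :
    (L.taylor z m).apply (polyOp A T z f q) =ᵐ[volume] polyOp A T z f (opP A T 0 z L m q) := by
  refine (DiffOp.apply_ae (hasW2_polyOp hA hT hab hp hpt hf q) _).trans (ae_of_all _ fun x => ?_)
  simp only [opP, polyOp_C_mul, polyOp_add hA hT hp hf, polyOp_sum hA hT hp hf,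
    Pi.smul_apply, Pi.add_apply, Finset.sum_apply, smul_add, Finset.smul_sum]
  simp only [polyOp_tayP hA hT hp hf _ (ha _ _), polyOp_tayP hA hT hp hf _ (hb _),
    polyOp_tayP hA hT hp hf _ hc, taylor_a, taylor_b z x m (hb _), taylor_c z x m hc, mul_smul]

end

section

variable (hA : A.PosDef) (hT : 0 < T) (hs : 0 < s) (hp : 1 < p) (hpt : p ≠ ⊤)
  (hf : MemWLp p a f)

include hA hT hs hp hpt hf

lemma HeatRel.tayP {q q' : KerPoly N} (h : HeatRel A T s z f q q') (m : ℕ) (g : E N → ℝ) :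
    HeatRel A T s z f (tayP A T 0 z m g q) (tayP A (s + T) s z m g q') := by
  induction m generalizing g with
  | zero => exact h.C_mul _
  | succ m ih =>
    exact HeatRel.sum hA hT hs hp hpt hf _ fun i _ => (ih _).mulX hA hT hs hp hpt hf i

/-- Conjugation respects sums and products, and `opP` is assembled from constants, `dX` and `mulX`,
for which the commutation relations are known. -/
lemma HeatRel.opP {q q' : KerPoly N} (h : HeatRel A T s z f q q') (L : DiffOp N) (m : ℕ) :
    HeatRel A T s z f (opP A T 0 z L m q) (opP A (s + T) s z L m q') := by
  have hd {q q' : KerPoly N} (h : HeatRel A T s z f q q') (i : Fin N) :=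
    h.dX hA hT hs hp hpt hf i
  have ht {q q' : KerPoly N} (h : HeatRel A T s z f q q') (m : ℕ) (g : E N → ℝ) :=
    h.tayP hA hT hs hp hpt hf m g
  refine C_mul (add hA hT hs hp hpt hf (add hA hT hs hp hpt hf ?_ ?_) ?_) _
  · exact sum hA hT hs hp hpt hf _ fun i _ => sum hA hT hs hp hpt hf _ fun j _ =>
      ht (hd (hd h j) i) m _
  · exact sum hA hT hs hp hpt hf _ fun i _ => C_mul (ht (hd h i) _ _) _
  · exact C_mul (ht h _ _) _

end

/-! ### The integrand of the perturbative expansion -/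

lemma conv_congr {k : E N → ℝ} {f g : E N → ℂ} (h : f =ᵐ[volume] g) : conv k f = conv k g :=
  kerOp_congr h

lemma frozen_eq (L : DiffOp N) (z : E N) : L.frozen z = constOp (matA L z) := rfl

/-- The second claim is what makes the induction work: a further heat operator at time `s` only
shifts the time argument of `dysonP`. The outermost `e^{τ_0 L_0}` uses it for the inner factors with
`s = τ 0`. -/
lemma dysonIntegrand_ae_eq [Fact (1 ≤ p)] {L : DiffOp N} (ha : ∀ i j, ContDiff ℝ ∞ (L.a i j))
    (hb : ∀ i, ContDiff ℝ ∞ (L.b i)) (hc : ContDiff ℝ ∞ L.c) (hA : (matA L z).PosDef)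
    (hp : 1 < p) (hpt : p ≠ ⊤) (hab : b < a) (hf : MemWLp p a f) {k : ℕ} (α : Fin k → ℕ)
    {τ : Fin (k + 1) → ℝ} (hτ : ∀ j, 0 < τ j) :
    dysonIntegrand L z p b k α τ f =ᵐ[volume]
      polyOp (matA L z) (∑ j, τ j) z f (dysonP (matA L z) (∑ j, τ j) z L k α τ 0) ∧
    ∀ s, 0 < s → HeatRel (matA L z) (∑ j, τ j) s z f
      (dysonP (matA L z) (∑ j, τ j) z L k α τ 0)
      (dysonP (matA L z) (s + ∑ j, τ j) z L k α τ s) := by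
  have hfb : MemWLp p b f := hf.mono_weight hab.le
  induction k with
  | zero =>
    simp only [Fin.sum_univ_castSucc, Finset.univ_eq_empty, Finset.sum_empty, zero_add]
    have h0 : 0 < τ (Fin.last 0) := hτ _
    refine ⟨?_, fun s hs => ?_⟩
    · rw [dysonP, polyOp_one, dysonIntegrand, frozen_eq]
      exact expOp_ae_eq hA hp hpt hfb h0
    · unfold HeatRel
      rw [dysonP, dysonP, polyOp_one, polyOp_one]
      exact conv_heatK_conv_heatK hA hp hpt hfb hs h0
  | succ k ih =>
    obtain ⟨ih1, ih2⟩ := ih (Fin.tail α) (τ := Fin.tail τ) fun j => hτ _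
    set S := ∑ j, Fin.tail τ j with hS
    have hS0 : 0 < S := Finset.sum_pos (fun j _ => hτ _) Finset.univ_nonempty
    have hSum : ∑ j, τ j = τ 0 + S := Fin.sum_univ_succ _
    have h0 : 0 < τ 0 := hτ 0
    set A := matA L z
    set u := dysonIntegrand L z p b k (Fin.tail α) (Fin.tail τ) f
    have hLu := ((L.taylor z (α 0)).apply_congr ih1).trans
      (taylor_apply_polyOp hA hS0 hp hf hab hpt ha hb hc (α 0) _)
    set Q := dysonP A S z L k (Fin.tail α) (Fin.tail τ) 0
    have hR (r : ℝ) (hr : 0 < r) := (ih2 r hr).opP hA hS0 hr hp hpt hf L (α 0)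
    have hmem := memWLp_polyOp (z := z) hA hS0 hab hp hpt hf (opP A S 0 z L (α 0) Q)
    have hmem' : MemWLp p b ((L.taylor z (α 0)).apply u) := hmem.congr hLu.symm
    rw [hSum]
    simp only [dysonP, zero_add]
    refine ⟨?_, fun s hs => ?_⟩
    · rw [dysonIntegrand, frozen_eq]
      refine (expOp_ae_eq hA hp hpt hmem' h0).trans ?_
      rw [conv_congr hLu]
      exact hR _ h0
    -- By the semigroup property the operators at times `s` and `τ 0` combine, so the inner
    -- hypothesis is used at time `s + τ 0`.
    · unfold HeatRel
      rw [← conv_congr (hR _ h0)]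
      refine (conv_heatK_conv_heatK hA hp hpt hmem hs h0).trans ?_
      have := hR (s + τ 0) (add_pos hs h0)
      unfold HeatRel at this
      rw [add_assoc s (τ 0) S] at this
      exact this

end DysonTaylor
namespace DysonTaylor

variable {N : ℕ} {p : ℝ≥0∞}

/-! ### The algebra `C_b^∞` -/

namespace IsCbInfty

variable {f g : E N → ℝ}

lemma const (c : ℝ) : IsCbInfty (fun _ : E N => c) := by
  refine ⟨contDiff_const, fun m => ?_⟩
  rcases m with _ | m
  · exact ⟨‖c‖, fun x => by simp⟩
  · exact ⟨0, fun x => by simp [iteratedFDeriv_succ_const]⟩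

lemma add (hf : IsCbInfty f) (hg : IsCbInfty g) : IsCbInfty (fun x => f x + g x) := by
  refine ⟨hf.1.add hg.1, fun m => ?_⟩
  obtain ⟨C, hC⟩ := hf.2 m
  obtain ⟨D, hD⟩ := hg.2 m
  refine ⟨C + D, fun x => ?_⟩
  change ‖iteratedFDeriv ℝ m (f + g) x‖ ≤ _
  rw [iteratedFDeriv_add_apply (hf.1.contDiffAt.of_le (by exact_mod_cast le_top))
    (hg.1.contDiffAt.of_le (by exact_mod_cast le_top))]
  exact (norm_add_le _ _).trans (add_le_add (hC x) (hD x))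

lemma mul (hf : IsCbInfty f) (hg : IsCbInfty g) : IsCbInfty (fun x => f x * g x) := by
  refine ⟨hf.1.mul hg.1, fun m => ?_⟩
  choose C hC using hf.2
  choose D hD using hg.2
  refine ⟨∑ i ∈ Finset.range (m + 1), m.choose i * C i * D (m - i), fun x => ?_⟩
  refine (norm_iteratedFDeriv_mul_le hf.1 hg.1 x (n := m) (by exact_mod_cast le_top)).trans
    (Finset.sum_le_sum fun i _ => ?_)
  have := (norm_nonneg _).trans (hC i x)
  gcongr
  · exact hC i x
  · exact hD _ x

lemma sum {ι : Type*} (s : Finset ι) {f : ι → E N → ℝ} (hf : ∀ i ∈ s, IsCbInfty (f i)) :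
    IsCbInfty (fun x => ∑ i ∈ s, f i x) := by
  classical
  induction s using Finset.induction_on with
  | empty => simpa using const 0
  | insert i s hi ih =>
    simp_rw [Finset.sum_insert hi]
    exact (hf i (by simp)).add (ih fun j hj => hf j (by simp [hj]))

lemma prod {ι : Type*} (s : Finset ι) {f : ι → E N → ℝ} (hf : ∀ i ∈ s, IsCbInfty (f i)) :
    IsCbInfty (fun x => ∏ i ∈ s, f i x) := by
  classical
  induction s using Finset.induction_on with
  | empty => simpa using const 1
  | insert i s hi ih =>
    simp_rw [Finset.prod_insert hi]
    exact (hf i (by simp)).mul (ih fun j hj => hf j (by simp [hj]))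

lemma pd (hf : IsCbInfty f) (i : Fin N) : IsCbInfty (pd i f) := by
  refine ⟨contDiff_pd hf.1 i, fun m => ?_⟩
  obtain ⟨C, hC⟩ := hf.2 (m + 1)
  refine ⟨‖EuclideanSpace.single i (1 : ℝ)‖ * C, fun x => ?_⟩
  refine (norm_iteratedFDeriv_clm_apply_const (N := ∞)
    (hf.1.fderiv_right (m := ∞) (by simp)).contDiffAt (by exact_mod_cast le_top)).trans ?_
  rw [norm_iteratedFDeriv_fderiv]
  gcongr
  exact hC x

/-- Composition with a function smooth on an open neighbourhood of a compact set
containing the values. -/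
lemma comp {φ : ℝ → ℝ} {U K : Set ℝ} (hU : IsOpen U) (hK : IsCompact K) (hKU : K ⊆ U)
    (hφ : ContDiffOn ℝ ∞ φ U) (hf : IsCbInfty f) (hfK : ∀ x, f x ∈ K) :
    IsCbInfty (fun x => φ (f x)) := by
  refine ⟨hφ.comp_contDiff hf.1 fun x => hKU (hfK x), fun m => ?_⟩
  choose C hC using hf.2
  have h1 (i : ℕ) : ∃ D, ∀ y ∈ K, ‖iteratedFDerivWithin ℝ i φ U y‖ ≤ D :=
    hK.exists_bound_of_continuousOn
      ((hφ.continuousOn_iteratedFDerivWithin (by exact_mod_cast le_top) hU.uniqueDiffOn).mono hKU)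
  choose D hD using h1
  have hC0 (i) : 0 ≤ C i := (norm_nonneg _).trans (hC i 0)
  have hD0 (i) : 0 ≤ D i := (norm_nonneg _).trans (hD i _ (hfK 0))
  refine ⟨m.factorial * (∑ i ∈ Finset.range (m + 1), D i)
    * (1 + ∑ i ∈ Finset.range (m + 1), C i) ^ m, fun x => ?_⟩
  refine norm_iteratedFDeriv_comp_le' (N := ∞) (t := U) ?_ hU.uniqueDiffOn hφ hf.1
    (by exact_mod_cast le_top) x (fun i hi => ?_) (fun i hi1 hi => ?_)
  · rintro _ ⟨y, rfl⟩; exact hKU (hfK y)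
  · exact (hD i _ (hfK x)).trans (Finset.single_le_sum (f := D) (fun j _ => hD0 j)
      (Finset.mem_range.2 (by omega)))
  · have h2 := Finset.single_le_sum (f := C) (fun j _ => hC0 j)
      (Finset.mem_range.2 (show i < m + 1 by omega))
    refine ((hC i x).trans (h2.trans (le_add_of_nonneg_left zero_le_one))).trans ?_
    refine le_self_pow₀ ?_ (by omega)
    exact le_add_of_nonneg_right (Finset.sum_nonneg fun j _ => hC0 j)

lemma inv {c : ℝ} (hc : 0 < c) (hf : IsCbInfty f) (hfc : ∀ x, c ≤ f x) :
    IsCbInfty (fun x => (f x)⁻¹) := by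
  obtain ⟨C, hC⟩ := hf.2 0
  -- The values of `f` lie in the compact interval `[c, C]` inside `(0, ∞)`, where inversion is
  -- smooth with bounded derivatives.
  refine comp (φ := fun y => y⁻¹) (U := Set.Ioi 0) (K := Set.Icc c C) isOpen_Ioi isCompact_Icc
    (fun y hy => hc.trans_le hy.1) ?_ hf fun x => ⟨hfc x, ?_⟩
  · exact contDiffOn_id.inv fun y hy => (ne_of_gt hy)
  · have := hC x
    rw [norm_iteratedFDeriv_zero] at this
    exact (le_abs_self _).trans this

lemma det {M : E N → Matrix (Fin N) (Fin N) ℝ} (h : ∀ i j, IsCbInfty (fun z => M z i j)) :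
    IsCbInfty (fun z => (M z).det) := by
  simp_rw [Matrix.det_apply']
  exact sum _ fun σ _ => (const _).mul (prod _ fun i _ => h _ _)

/-- By Cramer's rule each entry is a determinant of functions in `C_b^∞` divided by `det M`, which
is bounded below. -/
lemma matrix_inv {M : E N → Matrix (Fin N) (Fin N) ℝ} (h : ∀ i j, IsCbInfty (fun z => M z i j))
    {c : ℝ} (hc : 0 < c) (hd : ∀ z, c ≤ (M z).det) (i j : Fin N) :
    IsCbInfty (fun z => (M z)⁻¹ i j) := by
  have h1 : ∀ z, (M z)⁻¹ i j = (M z).det⁻¹ * ((M z).updateRow j (Pi.single i 1)).det := by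
    intro z
    rw [Matrix.inv_def, Matrix.smul_apply, Matrix.adjugate_apply, Ring.inverse_eq_inv', smul_eq_mul]
  simp_rw [h1]
  refine (inv hc (det h) hd).mul (det fun k l => ?_)
  by_cases hk : k = j
  · subst hk
    simpa using const _
  · simpa [Matrix.updateRow_ne hk] using h k l

end IsCbInfty

/-! ### Ellipticity -/

namespace DiffOp.IsElliptic

variable {L : DiffOp N} {γ : ℝ}

lemma isHermitian (hL : L.IsElliptic γ) (z : E N) : (matA L z).IsHermitian := by
  ext i j
  simp [matA, hL.symm j i z]

lemma le_dotProduct (hL : L.IsElliptic γ) (z ξ : E N) :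
    γ * ‖ξ‖ ^ 2 ≤ ξ.ofLp ⬝ᵥ (matA L z *ᵥ ξ.ofLp) := by
  refine (hL.elliptic z ξ).trans_eq ?_
  simp only [dotProduct, Matrix.mulVec, matA, Matrix.of_apply, Finset.mul_sum]
  exact Finset.sum_congr rfl fun i _ => Finset.sum_congr rfl fun j _ => by ring

lemma posDef (hγ : 0 < γ) (hL : L.IsElliptic γ) (z : E N) : (matA L z).PosDef := by
  refine Matrix.PosDef.of_dotProduct_mulVec_pos (hL.isHermitian z) fun x hx => ?_
  refine lt_of_lt_of_le ?_ (hL.le_dotProduct z (WithLp.toLp 2 x))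
  have : 0 < ‖WithLp.toLp 2 x‖ := norm_pos_iff.2 (by simpa using hx)
  positivity

/-- Ellipticity tested on unit eigenvectors bounds every eigenvalue below by `γ`, and the
determinant is their product. -/
lemma le_det (hγ : 0 < γ) (hL : L.IsElliptic γ) (z : E N) : γ ^ N ≤ (matA L z).det := by
  have hH := hL.isHermitian z
  have h1 (i : Fin N) : γ ≤ hH.eigenvalues i := by
    have h2 := hL.le_dotProduct z (hH.eigenvectorBasis i)
    rw [hH.mulVec_eigenvectorBasis i] at h2
    have h3 : ‖hH.eigenvectorBasis i‖ = 1 := hH.eigenvectorBasis.orthonormal.1 i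
    have h4 : (hH.eigenvectorBasis i).ofLp ⬝ᵥ (hH.eigenvectorBasis i).ofLp = 1 := by
      have h5 := EuclideanSpace.real_norm_sq_eq (hH.eigenvectorBasis i)
      rw [h3] at h5
      simp only [dotProduct, ← sq]
      linarith
    rw [dotProduct_smul, h3, h4] at h2
    simpa using h2
  rw [hH.det_eq_prod_eigenvalues]
  calc γ ^ N = ∏ _i : Fin N, γ := by simp
    _ ≤ ∏ i, hH.eigenvalues i := Finset.prod_le_prod (fun _ _ => hγ.le) fun i _ => h1 i
    _ = _ := by simp

lemma isCbInfty_inv (hγ : 0 < γ) (hL : L.IsElliptic γ) (i j : Fin N) :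
    IsCbInfty (fun z => (matA L z)⁻¹ i j) :=
  IsCbInfty.matrix_inv (fun i j => hL.a_cb i j) (pow_pos hγ N) (hL.le_det hγ) i j

end DiffOp.IsElliptic

/-! ### Coefficients depending on a parameter -/

/-- Finite sums of products of a continuous function of the parameter and a function in
`C_b^∞`. -/
inductive SepCb {Ω : Type*} [TopologicalSpace Ω] : (Ω → E N → ℝ) → Prop
  | prod {h : Ω → ℝ} {g : E N → ℝ} (hh : Continuous h) (hg : IsCbInfty g) :
      SepCb fun σ z => h σ * g z
  | add {c c' : Ω → E N → ℝ} (hc : SepCb c) (hc' : SepCb c') : SepCb fun σ z => c σ z + c' σ z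

namespace SepCb

variable {Ω : Type*} [TopologicalSpace Ω] {c c' : Ω → E N → ℝ}

lemma of_continuous {h : Ω → ℝ} (hh : Continuous h) : SepCb fun σ (_ : E N) => h σ := by
  simpa using SepCb.prod hh (IsCbInfty.const (N := N) 1)

lemma of_isCbInfty {g : E N → ℝ} (hg : IsCbInfty g) : SepCb fun (_ : Ω) z => g z := by
  simpa using SepCb.prod (Ω := Ω) continuous_const hg (h := fun _ => 1)

lemma mul (hc : SepCb c) (hc' : SepCb c') : SepCb fun σ z => c σ z * c' σ z := by
  induction hc with
  | @prod h g hh hg =>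
    induction hc' with
    | @prod h' g' hh' hg' =>
      convert SepCb.prod (hh.mul hh') (hg.mul hg') using 3
      simp only [Pi.mul_apply]
      ring
    | add _ _ h1 h2 => simpa only [mul_add] using h1.add h2
  | add _ _ h1 h2 => simpa only [add_mul] using h1.add h2

lemma continuous (hc : SepCb c) (z : E N) : Continuous fun σ => c σ z := by
  induction hc with
  | prod hh _ => exact hh.mul continuous_const
  | add _ _ h1 h2 => exact h1.add h2

/-- The integral of `h(σ) g(z)` is a constant multiple of `g`, so no differentiation under the
integral sign is needed. Compactness supplies the integrability that splits sums. -/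
lemma isCbInfty_integral [MeasurableSpace Ω] [OpensMeasurableSpace Ω] [T2Space Ω] {μ : Measure Ω}
    [IsFiniteMeasureOnCompacts μ] {K : Set Ω} (hK : IsCompact K) (hc : SepCb c) :
    IsCbInfty fun z => ∫ σ in K, c σ z ∂μ := by
  induction hc with
  | prod hh hg =>
    simp_rw [integral_mul_const]
    exact (IsCbInfty.const _).mul hg
  | @add c c' h h' h1 h2 =>
    have e : ∀ z, ∫ σ in K, c σ z + c' σ z ∂μ = (∫ σ in K, c σ z ∂μ) + ∫ σ in K, c' σ z ∂μ :=
      fun z => integral_add ((h.continuous z).continuousOn.integrableOn_compact hK)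
        ((h'.continuous z).continuousOn.integrableOn_compact hK)
    simp_rw [e]
    exact h1.add h2

end SepCb

end DysonTaylor
namespace DysonTaylor

variable {N : ℕ} {p : ℝ≥0∞}

/-! ### Families of polynomials with controlled degrees -/

open MvPolynomial in
/-- Families of polynomials of degrees at most `d` and `e` in the two groups of variables, with
coefficients satisfying `SepCb`. -/
inductive PolyFamily {Ω : Type*} [TopologicalSpace Ω] (d e : ℕ) : (Ω → E N → KerPoly N) → Prop
  | monomial {c : Ω → E N → ℝ} (hc : SepCb c) (m : Fin N ⊕ Fin N →₀ ℕ)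
      (hd : ∑ i, m (Sum.inl i) ≤ d) (he : ∑ i, m (Sum.inr i) ≤ e) :
      PolyFamily d e fun σ z => monomial m (c σ z)
  | add {q q' : Ω → E N → KerPoly N} (hq : PolyFamily d e q) (hq' : PolyFamily d e q') :
      PolyFamily d e fun σ z => q σ z + q' σ z

namespace PolyFamily

open MvPolynomial

variable {Ω : Type*} [TopologicalSpace Ω] {d e d' e' : ℕ} {q : Ω → E N → KerPoly N}

lemma mono_degree (hq : PolyFamily d e q) (hd : d ≤ d') (he : e ≤ e') : PolyFamily d' e' q := by
  induction hq with
  | monomial hc m h1 h2 => exact .monomial hc m (h1.trans hd) (h2.trans he)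
  | add _ _ h1 h2 => exact .add h1 h2

lemma zero : PolyFamily (Ω := Ω) d e fun _ (_ : E N) => 0 := by
  have := PolyFamily.monomial (d := d) (e := e) (N := N) (Ω := Ω)
    (SepCb.of_continuous (continuous_const (y := (0 : ℝ)))) 0 (by simp) (by simp)
  simpa using this

lemma one : PolyFamily (Ω := Ω) d e fun _ (_ : E N) => 1 := by
  have := PolyFamily.monomial (d := d) (e := e) (N := N) (Ω := Ω)
    (SepCb.of_continuous (continuous_const (y := (1 : ℝ)))) 0 (by simp) (by simp)
  simpa using this

lemma sum {ι : Type*} (s : Finset ι) {q : ι → Ω → E N → KerPoly N}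
    (hq : ∀ i ∈ s, PolyFamily d e (q i)) : PolyFamily d e fun σ z => ∑ i ∈ s, q i σ z := by
  classical
  induction s using Finset.induction_on with
  | empty => simpa using zero
  | insert i s hi ih =>
    simp_rw [Finset.sum_insert hi]
    exact (hq i (by simp)).add (ih fun j hj => hq j (by simp [hj]))

lemma C_mul {c : Ω → E N → ℝ} (hc : SepCb c) (hq : PolyFamily d e q) :
    PolyFamily d e fun σ z => C (c σ z) * q σ z := by
  induction hq with
  | monomial hc' m h1 h2 =>
    simp only [C_mul_monomial]
    exact .monomial (hc.mul hc') m h1 h2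
  | add _ _ h1 h2 => simpa only [mul_add] using h1.add h2

lemma X_inl_mul (hq : PolyFamily d e q) (i : Fin N) :
    PolyFamily (d + 1) e fun σ z => X (Sum.inl i) * q σ z := by
  induction hq with
  | monomial hc m h1 h2 =>
    simp only [X, monomial_mul, one_mul]
    refine .monomial hc _ ?_ ?_
    · simpa [Finset.sum_add_distrib, Finsupp.single_apply, add_comm 1] using h1
    · simpa [Finset.sum_add_distrib, Finsupp.single_apply] using h2
  | add _ _ h1 h2 => simpa only [mul_add] using h1.add h2

lemma X_inr_mul (hq : PolyFamily d e q) (i : Fin N) :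
    PolyFamily d (e + 1) fun σ z => X (Sum.inr i) * q σ z := by
  induction hq with
  | monomial hc m h1 h2 =>
    simp only [X, monomial_mul, one_mul]
    refine .monomial hc _ ?_ ?_
    · simpa [Finset.sum_add_distrib, Finsupp.single_apply] using h1
    · simpa [Finset.sum_add_distrib, Finsupp.single_apply, add_comm 1] using h2
  | add _ _ h1 h2 => simpa only [mul_add] using h1.add h2

lemma pderiv (hq : PolyFamily d e q) (i : Fin N ⊕ Fin N) :
    PolyFamily d e fun σ z => MvPolynomial.pderiv i (q σ z) := by
  induction hq with
  | monomial hc m h1 h2 =>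
    simp only [pderiv_monomial]
    refine .monomial (hc.mul (.of_continuous continuous_const)) _ (le_trans ?_ h1) (le_trans ?_ h2)
    all_goals exact Finset.sum_le_sum fun j _ => Nat.sub_le _ _
  | add _ _ h1 h2 => simpa only [map_add] using h1.add h2

variable {A : E N → Matrix (Fin N) (Fin N) ℝ} {T : ℝ} {s : Ω → ℝ}

/-- The degree in `x - y` grows by one through the Gaussian factor; the partial derivatives of the
polynomial raise nothing. -/
lemma dX (hA : ∀ i j, IsCbInfty fun z => (A z)⁻¹ i j) (hq : PolyFamily d e q) (i : Fin N) :
    PolyFamily d (e + 1) fun σ z => dX (A z) T i (q σ z) := by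
  refine .add (.add ((hq.pderiv _).mono_degree le_rfl (by omega))
    ((hq.pderiv _).mono_degree le_rfl (by omega))) (sum _ fun j _ => (hq.X_inr_mul j).C_mul ?_)
  exact (SepCb.of_continuous continuous_const).mul (SepCb.of_isCbInfty (hA i j))

lemma mulX (hA : ∀ i j, IsCbInfty fun z => (A z)⁻¹ i j)
    (hA' : ∀ i j, IsCbInfty fun z => A z i j) (hs : Continuous s) (hq : PolyFamily d e q)
    (i : Fin N) : PolyFamily (d + 1) (e + 1) fun σ z => mulX (A z) T (s σ) i (q σ z) := by
  refine .add ((hq.X_inl_mul i).mono_degree le_rfl (by omega)) (sum _ fun j _ => .C_mul ?_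
    ((hq.dX hA j).mono_degree (by omega) le_rfl))
  exact (SepCb.of_continuous (by fun_prop)).mul (SepCb.of_isCbInfty (hA' i j))

lemma tayP (hA : ∀ i j, IsCbInfty fun z => (A z)⁻¹ i j)
    (hA' : ∀ i j, IsCbInfty fun z => A z i j) (hs : Continuous s) (hq : PolyFamily d e q)
    (m : ℕ) {g : E N → ℝ} (hg : IsCbInfty g) :
    PolyFamily (d + m) (e + m) fun σ z => tayP (A z) T (s σ) z m g (q σ z) := by
  induction m generalizing g with
  | zero => exact hq.C_mul (SepCb.of_isCbInfty hg)
  | succ m ih => exact sum _ fun i _ => (ih (hg.pd i)).mulX hA hA' hs i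

/-- The second-order part is decisive: two derivatives raise the degree in `x - y` by 2, and `m`
factors `mulX` raise both degrees by `m`. The lower-order parts have fewer derivatives and no more
factors `mulX`, also when `m - 1` or `m - 2` is truncated. -/
lemma opP (hA : ∀ i j, IsCbInfty fun z => (A z)⁻¹ i j)
    (hA' : ∀ i j, IsCbInfty fun z => A z i j) (hs : Continuous s) {L : DiffOp N}
    (ha : ∀ i j, IsCbInfty (L.a i j)) (hb : ∀ i, IsCbInfty (L.b i)) (hc : IsCbInfty L.c)
    (hq : PolyFamily d e q) (m : ℕ) :
    PolyFamily (d + m) (e + m + 2) fun σ z => opP (A z) T (s σ) z L m (q σ z) := by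
  refine .C_mul (.of_continuous continuous_const) (.add (.add ?_ ?_) ?_)
  · exact sum _ fun i _ => sum _ fun j _ =>
      (((hq.dX hA j).dX hA i).tayP hA hA' hs m (ha i j)).mono_degree le_rfl (by omega)
  · exact sum _ fun i _ => .C_mul (.of_continuous continuous_const)
      (((hq.dX hA i).tayP hA hA' hs (m - 1) (hb i)).mono_degree (by omega) (by omega))
  · exact .C_mul (.of_continuous continuous_const)
      ((hq.tayP hA hA' hs (m - 2) hc).mono_degree (by omega) (by omega))

lemma dysonP (hA : ∀ i j, IsCbInfty fun z => (A z)⁻¹ i j)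
    (hA' : ∀ i j, IsCbInfty fun z => A z i j) {L : DiffOp N}
    (ha : ∀ i j, IsCbInfty (L.a i j)) (hb : ∀ i, IsCbInfty (L.b i)) (hc : IsCbInfty L.c)
    {k : ℕ} (α : Fin k → ℕ) {τ : Ω → Fin (k + 1) → ℝ} (hτ : ∀ j, Continuous fun σ => τ σ j)
    {s : Ω → ℝ} (hs : Continuous s) :
    PolyFamily (∑ j, α j) (∑ j, (α j + 2)) fun σ z => dysonP (A z) T z L k α (τ σ) (s σ) := by
  induction k generalizing s with
  | zero => exact one
  | succ k ih =>
    rw [Fin.sum_univ_succ, Fin.sum_univ_succ]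
    exact ((ih (Fin.tail α) (τ := fun σ => Fin.tail (τ σ)) (fun j => hτ _)
      (hs.add (hτ 0))).opP hA hA' (hs.add (hτ 0)) ha hb hc (α 0)).mono_degree
      (by simp only [Fin.tail]; omega) (by simp only [Fin.tail]; omega)

end PolyFamily

/-- The monomial with exponents `β` in `x - z` and `β'` in `x - y`. -/
noncomputable def kerMonomial (β β' : Fin N → ℕ) : KerPoly N :=
  MvPolynomial.monomial (Finsupp.equivFunOnFinite.symm (Sum.elim β β')) 1

lemma evalP_kerMonomial (u v : E N) (β β' : Fin N → ℕ) :
    evalP u v (kerMonomial β β') = mono β u * mono β' v := by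
  simp [evalP, kerMonomial, MvPolynomial.eval_monomial, Finsupp.prod_fintype, mono]

lemma mem_multiIdx {d : ℕ} {β : Fin N → ℕ} : β ∈ multiIdx N d ↔ ∑ i, β i ≤ d := by
  simp only [multiIdx, Finset.mem_filter, Fintype.mem_piFinset, Finset.mem_range,
    and_iff_right_iff_imp]
  intro h i
  have := Finset.single_le_sum (f := β) (fun j _ => Nat.zero_le _) (Finset.mem_univ i)
  omega

/-- A family of polynomials in terms of its coefficients. -/
lemma PolyFamily.exists_coeff {Ω : Type*} [TopologicalSpace Ω] {d e : ℕ}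
    {q : Ω → E N → KerPoly N} (hq : PolyFamily d e q) :
    ∃ c : (Fin N → ℕ) → (Fin N → ℕ) → Ω → E N → ℝ, (∀ β β', SepCb (c β β')) ∧
      ∀ σ z, q σ z = ∑ β ∈ multiIdx N d, ∑ β' ∈ multiIdx N e,
        MvPolynomial.C (c β β' σ z) * kerMonomial β β' := by
  classical
  induction hq with
  | @monomial c hc m hd he =>
    set β₀ : Fin N → ℕ := fun i => m (Sum.inl i)
    set β₁ : Fin N → ℕ := fun i => m (Sum.inr i)
    refine ⟨fun β β' σ z => (if β = β₀ then 1 else 0) * ((if β' = β₁ then 1 else 0) * c σ z),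
      fun β β' => (SepCb.of_continuous continuous_const).mul
        ((SepCb.of_continuous continuous_const).mul hc), fun σ z => ?_⟩
    rw [Finset.sum_eq_single β₀, Finset.sum_eq_single β₁]
    · simp only [if_true, one_mul, kerMonomial, MvPolynomial.C_mul_monomial, mul_one]
      have hm : m = Finsupp.equivFunOnFinite.symm (Sum.elim β₀ β₁) := by
        refine Finsupp.ext fun i => ?_
        rcases i with i | i <;> rfl
      rw [← hm]
    · intro β' _ h; simp [h]
    · intro h; exact absurd (mem_multiIdx.2 he) h
    · intro β _ h; simp [h]
    · intro h; exact absurd (mem_multiIdx.2 hd) h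
  | add _ _ h1 h2 =>
    obtain ⟨c, hc, hq⟩ := h1
    obtain ⟨c', hc', hq'⟩ := h2
    refine ⟨fun β β' σ z => c β β' σ z + c' β β' σ z, fun β β' => (hc β β').add (hc' β β'),
      fun σ z => ?_⟩
    simp only [hq, hq', map_add, add_mul, Finset.sum_add_distrib]

/-! ### The simplex -/

lemma isCompact_simplex (k : ℕ) : IsCompact (simplex k) := by
  have h : IsCompact (Set.univ.pi fun _ : Fin k => Set.Icc (0 : ℝ) 1) :=
    isCompact_univ_pi fun _ => isCompact_Icc
  refine h.of_isClosed_subset ?_ fun σ hσ i _ => hσ.2 i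
  have e : simplex k = (⋂ i, ⋂ j, ⋂ (_ : i ≤ j), {σ : Fin k → ℝ | σ j ≤ σ i})
      ∩ ⋂ i, ({σ | 0 ≤ σ i} ∩ {σ | σ i ≤ 1}) := by
    ext σ
    simp [simplex, Antitone]
  rw [e]
  refine IsClosed.inter (isClosed_iInter fun i => isClosed_iInter fun j => isClosed_iInter fun _ =>
    isClosed_le (continuous_apply _) (continuous_apply _)) (isClosed_iInter fun i => ?_)
  exact (isClosed_le continuous_const (continuous_apply _)).inter
    (isClosed_le (continuous_apply _) continuous_const)

lemma continuous_simplexTau {k : ℕ} (j : Fin (k + 1)) :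
    Continuous fun σ : Fin k → ℝ => simplexTau σ j := by
  unfold simplexTau
  refine Continuous.sub ?_ ?_
  · refine Fin.cases ?_ (fun i => ?_) j
    · simpa using continuous_const
    · simpa using continuous_apply i
  · refine Fin.lastCases ?_ (fun i => ?_) j
    · simpa using continuous_const
    · simpa using continuous_apply i

lemma sum_simplexTau {k : ℕ} (σ : Fin k → ℝ) : ∑ j, simplexTau σ j = 1 := by
  simp only [simplexTau, Finset.sum_sub_distrib]
  rw [Fin.sum_univ_succ, Fin.sum_univ_castSucc (f := Fin.snoc (α := fun _ => ℝ) σ 0)]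
  simp

/-- Each `τ_j` is nonnegative on the simplex and vanishes only on a null set. Positivity is needed
because `expOp` is identified with a convolution for positive times only. -/
lemma ae_simplexTau_pos (k : ℕ) :
    ∀ᵐ σ ∂(volume.restrict (simplex k)), ∀ j, 0 < simplexTau σ j := by
  rw [ae_all_iff]
  intro j
  have key : (∀ σ ∈ simplex k, 0 ≤ simplexTau σ j) ∧ ∀ᵐ σ : Fin k → ℝ, simplexTau σ j ≠ 0 := by
    -- For `k = 0` there is no coordinate, and the only time is 1.
    rcases k with _ | k
    · have h1 (σ : Fin 0 → ℝ) : simplexTau σ j = 1 := by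
        have := sum_simplexTau σ
        rwa [Fin.sum_univ_one, ← Fin.fin_one_eq_zero j] at this
      simp [h1]
    · have hne (i : Fin (k + 1)) (c : ℝ) : ∀ᵐ σ : Fin (k + 1) → ℝ, σ i ≠ c := by
        rw [ae_iff]
        simpa [volume_pi] using Measure.pi_hyperplane (fun _ : Fin (k + 1) => (volume : Measure ℝ)) i c
      refine Fin.cases ?_ (fun i => ?_) j
      · have h1 (σ : Fin (k + 1) → ℝ) : simplexTau σ 0 = 1 - σ 0 :=
          congrArg (1 - ·) (Fin.snoc_castSucc (α := fun _ => ℝ) 0 σ 0)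
        simp only [h1]
        refine ⟨fun σ hσ => sub_nonneg.2 (hσ.2 0).2, ?_⟩
        filter_upwards [hne 0 1] with σ hσ h
        exact hσ (by linarith)
      · refine Fin.lastCases ?_ (fun i => ?_) i
        · have h1 (σ : Fin (k + 1) → ℝ) :
              simplexTau σ (Fin.last k).succ = σ (Fin.last k) := by
            simp [simplexTau]
          simp only [h1]
          exact ⟨fun σ hσ => (hσ.2 _).1, hne _ 0⟩
        · have h1 (σ : Fin (k + 1) → ℝ) :
              simplexTau σ i.castSucc.succ = σ i.castSucc - σ i.succ :=
            congrArg (σ i.castSucc - ·) (Fin.snoc_castSucc (α := fun _ => ℝ) 0 σ i.succ)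
          simp only [h1]
          refine ⟨fun σ hσ => sub_nonneg.2 (hσ.1 (Fin.castSucc_lt_succ).le), ?_⟩
          set φ : (Fin (k + 1) → ℝ) →ₗ[ℝ] ℝ :=
            LinearMap.proj (R := ℝ) (φ := fun _ => ℝ) i.castSucc - LinearMap.proj i.succ
          have hφ (σ : Fin (k + 1) → ℝ) : φ σ = σ i.castSucc - σ i.succ := rfl
          -- The functional `σ_i - σ_{i+1}` is not zero, so its kernel is a proper subspace and has
          -- measure zero.
          have hker : LinearMap.ker φ ≠ ⊤ := by
            intro h
            have h2 : Pi.single i.succ (1 : ℝ) ∈ LinearMap.ker φ := by rw [h]; trivial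
            have h3 : i.castSucc ≠ i.succ := (Fin.castSucc_lt_succ).ne
            rw [LinearMap.mem_ker, hφ] at h2
            simp [h3] at h2
          have h4 := Measure.addHaar_submodule volume _ hker
          rw [ae_iff]
          convert h4 using 2
          ext σ
          simp only [Set.mem_ofPred_eq, not_not, SetLike.mem_coe, LinearMap.mem_ker, hφ]
  rw [ae_restrict_iff' (isCompact_simplex k).measurableSet]
  filter_upwards [key.2] with σ hσ hm
  exact (key.1 σ hm).lt_of_ne' hσ

end DysonTaylor
namespace DysonTaylor

variable {N : ℕ} {p : ℝ≥0∞}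

/-! ### The kernel of `Λ_{α,z}` -/

/-- The pairs of multi-indices of degrees at most `ℓ` and `3ℓ`. -/
noncomputable def idxPairs (N ℓ : ℕ) : Finset ((Fin N → ℕ) × (Fin N → ℕ)) :=
  multiIdx N ℓ ×ˢ multiIdx N (3 * ℓ)

/-- The polynomial with the given coefficients. -/
noncomputable def polyOfCoeff (ℓ : ℕ) (c : (Fin N → ℕ) → (Fin N → ℕ) → ℝ) : KerPoly N :=
  ∑ i ∈ idxPairs N ℓ, MvPolynomial.C (c i.1 i.2) * kerMonomial i.1 i.2

lemma polyKer_polyOfCoeff (L : DiffOp N) (ℓ : ℕ) (coef : (Fin N → ℕ) → (Fin N → ℕ) → E N → ℝ)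
    (z x y : E N) :
    polyKer (matA L z) 1 z (polyOfCoeff ℓ fun β β' => coef β β' z) x y
      = polyP ℓ coef z x y * gaussG L z (x - y) := by
  have h1 : heatK (matA L z) 1 (x - y) = gaussG L z (x - y) := by
    simp only [heatK, gaussG, invForm, mul_one]
  rw [polyKer, h1, polyOfCoeff, evalP_sum, polyP, idxPairs, Finset.sum_product]
  simp only [evalP_mul, evalP_C, evalP_kerMonomial, mul_assoc]

lemma contDiff_polyKer (A : Matrix (Fin N) (Fin N) ℝ) (T : ℝ) (z : E N) (q : KerPoly N) :
    ContDiff ℝ ∞ fun w : E N × E N => polyKer A T z q w.1 w.2 := by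
  have h0 : ContDiff ℝ ∞ fun w : E N × E N => (w.1 - z, w.1 - w.2) :=
    (contDiff_fst.sub contDiff_const).prodMk (contDiff_fst.sub contDiff_snd)
  have h1 := (contDiff_evalP q).comp h0
  have h2 := (contDiff_heatK (A := A) T).comp
    (contDiff_fst.sub contDiff_snd : ContDiff ℝ ∞ fun w : E N × E N => w.1 - w.2)
  exact h1.mul h2

lemma polyOp_polyOfCoeff {A : Matrix (Fin N) (Fin N) ℝ} {T a : ℝ} {z : E N} {f : E N → ℂ}
    (hA : A.PosDef) (hT : 0 < T) (hp : 1 < p) (hf : MemWLp p a f) (ℓ : ℕ)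
    (c : (Fin N → ℕ) → (Fin N → ℕ) → ℝ) :
    polyOp A T z f (polyOfCoeff ℓ c)
      = ∑ i ∈ idxPairs N ℓ, c i.1 i.2 • polyOp A T z f (kerMonomial i.1 i.2) := by
  rw [polyOfCoeff, polyOp_sum hA hT hp hf]
  simp only [polyOp_C_mul]

lemma SepCb.integrable_smul {k : ℕ} {c : (Fin k → ℝ) → E N → ℝ} (hc : SepCb c) (z : E N)
    {F : Type*} [NormedAddCommGroup F] [NormedSpace ℝ F] (v : F) :
    Integrable (fun σ => c σ z • v) (volume.restrict (simplex k)) :=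
  ((hc.continuous z).smul continuous_const).continuousOn.integrableOn_compact (isCompact_simplex k)

section

variable {L : DiffOp N} {γ : ℝ}

lemma exists_coeff_dysonP (hγ : 0 < γ) (hL : L.IsElliptic γ) {k ℓ : ℕ} (α : Fin k → ℕ)
    (hα : ∀ i, 1 ≤ α i) (hαℓ : ∑ i, α i = ℓ) :
    ∃ c : (Fin N → ℕ) → (Fin N → ℕ) → (Fin k → ℝ) → E N → ℝ, (∀ β β', SepCb (c β β')) ∧
      ∀ σ z, dysonP (matA L z) 1 z L k α (simplexTau σ) 0
        = polyOfCoeff ℓ fun β β' => c β β' σ z := by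
  have h1 := PolyFamily.dysonP (T := 1) (hL.isCbInfty_inv hγ) hL.a_cb hL.a_cb hL.b_cb hL.c_cb α
    (τ := simplexTau) continuous_simplexTau (s := fun _ => 0) continuous_const
  -- Since `α j ≥ 1`, one has `α j + 2 ≤ 3 α j`; this is the source of the degree `3ℓ`.
  have h2 : ∑ j, (α j + 2) ≤ 3 * ℓ := by
    rw [← hαℓ, Finset.mul_sum]
    exact Finset.sum_le_sum fun j _ => by have := hα j; omega
  obtain ⟨c, hc, h⟩ := (h1.mono_degree hαℓ.le h2).exists_coeff
  refine ⟨c, hc, fun σ z => ?_⟩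
  rw [h, polyOfCoeff, idxPairs, Finset.sum_product]

variable (hγ : 0 < γ) (hL : L.IsElliptic γ) {k ℓ : ℕ} {α : Fin k → ℕ} {z : E N}
  {c : (Fin N → ℕ) → (Fin N → ℕ) → (Fin k → ℝ) → E N → ℝ} (hc : ∀ β β', SepCb (c β β'))
  (hd : ∀ σ, dysonP (matA L z) 1 z L k α (simplexTau σ) 0
    = polyOfCoeff ℓ fun β β' => c β β' σ z)
  [Fact (1 ≤ p)] (hp : 1 < p) (hpt : p ≠ ⊤) {a b : ℝ} (hab : b < a) {f : E N → ℂ}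
  (hf : MemWLp p a f)

include hγ hL hd hp hpt hab hf

/-- The times add up to 1, so the Gaussian is `G_1` for every `σ`, and `σ` enters only through
scalar coefficients of fixed functions. -/
lemma dysonIntegrand_ae_eq_sum : ∀ᵐ σ ∂(volume.restrict (simplex k)),
    dysonIntegrand L z p b k α (simplexTau σ) f =ᵐ[volume]
      ∑ i ∈ idxPairs N ℓ, c i.1 i.2 σ z • polyOp (matA L z) 1 z f (kerMonomial i.1 i.2) := by
  filter_upwards [ae_simplexTau_pos k] with σ hσ
  have h1 := (dysonIntegrand_ae_eq (fun i j => (hL.a_cb i j).1) (fun i => (hL.b_cb i).1)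
    hL.c_cb.1 (hL.posDef hγ z) hp hpt hab hf α hσ).1
  rwa [sum_simplexTau, hd, polyOp_polyOfCoeff (hL.posDef hγ z) one_pos hp hf] at h1

lemma toWLp_dysonIntegrand_ae_eq :
    (fun σ => toWLp p b (dysonIntegrand L z p b k α (simplexTau σ) f))
      =ᵐ[volume.restrict (simplex k)] fun σ => ∑ i ∈ idxPairs N ℓ, c i.1 i.2 σ z •
        toWLp p b (polyOp (matA L z) 1 z f (kerMonomial i.1 i.2)) := by
  have hm (β β') := memWLp_polyOp (z := z) (hL.posDef hγ z) one_pos hab hp hpt hf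
    (kerMonomial β β')
  filter_upwards [dysonIntegrand_ae_eq_sum hγ hL hd hp hpt hab hf] with σ hσ
  rw [toWLp_congr hσ, toWLp_sum _ fun i _ => (hm _ _).const_smul _]
  exact Finset.sum_congr rfl fun i _ => toWLp_smul (hm _ _) _

include hc

/-- The integrand equals almost everywhere a finite sum of fixed vectors of `L^p` with coefficients
continuous on the compact simplex. -/
lemma lambdaConverges : LambdaConverges L z α p b f := by
  have hm (β β') := memWLp_polyOp (z := z) (hL.posDef hγ z) one_pos hab hp hpt hf
    (kerMonomial β β')
  refine ⟨?_, ?_⟩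
  · filter_upwards [dysonIntegrand_ae_eq_sum hγ hL hd hp hpt hab hf] with σ hσ
    exact (memWLp_sum _ fun i _ => (hm _ _).const_smul _).congr hσ.symm
  · refine Integrable.congr ?_ (toWLp_dysonIntegrand_ae_eq hγ hL hd hp hpt hab hf).symm
    exact integrable_finsetSum _ fun i _ => (hc _ _).integrable_smul z _

/-- For the same reason the vector-valued integral reduces to the scalar integrals of the
coefficients. -/
lemma Lambda_ae_eq : Lambda L z α p b f =ᵐ[volume]
    polyOp (matA L z) 1 z f (polyOfCoeff ℓ fun β β' => ∫ σ in simplex k, c β β' σ z) := by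
  have hm (β β') := memWLp_polyOp (z := z) (hL.posDef hγ z) one_pos hab hp hpt hf
    (kerMonomial β β')
  have h1 : ∫ σ in simplex k, toWLp p b (dysonIntegrand L z p b k α (simplexTau σ) f)
      = toWLp p b (polyOp (matA L z) 1 z f
        (polyOfCoeff ℓ fun β β' => ∫ σ in simplex k, c β β' σ z)) := by
    rw [integral_congr_ae (toWLp_dysonIntegrand_ae_eq hγ hL hd hp hpt hab hf),
      integral_finsetSum _ fun i _ => (hc _ _).integrable_smul z _,
      polyOp_polyOfCoeff (hL.posDef hγ z) one_pos hp hf,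
      toWLp_sum _ fun i _ => (hm _ _).const_smul _]
    refine Finset.sum_congr rfl fun i _ => ?_
    rw [integral_smul_const, toWLp_smul (hm _ _)]
  have h2 := ofWLp_toWLp (memWLp_polyOp (z := z) (hL.posDef hγ z) one_pos hab hp hpt hf
    (polyOfCoeff ℓ fun β β' => ∫ σ in simplex k, c β β' σ z))
  rw [← h1] at h2
  exact h2

end

/-- An operator that agrees with the operator of a polynomial has a smooth kernel. -/
lemma hasSmoothKernel_of_polyOp {L : DiffOp N} {z : E N} (hA : (matA L z).PosDef) {ℓ : ℕ}
    {coef : (Fin N → ℕ) → (Fin N → ℕ) → E N → ℝ}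
    {S : (p : ℝ≥0∞) → [Fact (1 ≤ p)] → ℝ → (E N → ℂ) → E N → ℂ}
    (hS : ∀ (p : ℝ≥0∞) [Fact (1 ≤ p)], 1 < p → p ≠ ⊤ → ∀ a b : ℝ, b < a → ∀ f : E N → ℂ,
      MemWLp p a f → S p b f =ᵐ[volume]
        polyOp (matA L z) 1 z f (polyOfCoeff ℓ fun β β' => coef β β' z)) :
    HasSmoothKernel S fun x y => polyP ℓ coef z x y * gaussG L z (x - y) := by
  simp only [← polyKer_polyOfCoeff]
  exact ⟨contDiff_polyKer _ _ _ _, fun p _ hp hpt a b hab f hf =>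
    ⟨fun x => (kernelBdd_polyKer hA one_pos z _ hab).integrable hp hf x,
      hS p hp hpt a b hab f hf⟩⟩

end DysonTaylor

/-! ### The theorem: single terms and their sum over compositions -/

open DysonTaylor
theorem mainTheorem3 {N : ℕ} (γ : ℝ) (hγ : 0 < γ) (L : DiffOp N) (hL : L.IsElliptic γ) (ℓ : ℕ) :
    ∃ coef : Composition ℓ → (Fin N → ℕ) → (Fin N → ℕ) → E N → ℝ,
      (∀ α β β', IsCbInfty (coef α β β')) ∧
      ∀ z : E N,
        (∀ α : Composition ℓ,
          (∀ (p : ℝ≥0∞) [Fact (1 ≤ p)], 1 < p → p ≠ ⊤ → ∀ a b : ℝ, b < a →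
            ∀ f : E N → ℂ, MemWLp p a f → LambdaConverges L z α.blocksFun p b f) ∧
          HasSmoothKernel (Lambda L z α.blocksFun)
            (fun x y => polyP ℓ (coef α) z x y * gaussG L z (x - y))) ∧
        HasSmoothKernel (LambdaSum L z ℓ)
          (fun x y => polyP ℓ (fun β β' w => ∑ α, coef α β β' w) z x y
            * gaussG L z (x - y)) := by
  -- The coefficients are fixed here, before `z`, `p`, the weights and `f`, so they depend on `L`
  -- and `α` only.
  choose c hc hd using fun α : Composition ℓ => exists_coeff_dysonP hγ hL (ℓ := ℓ) α.blocksFun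
    (fun i => α.one_le_blocksFun i) α.sum_blocksFun
  have hΛ (α : Composition ℓ) (z : E N) (p : ℝ≥0∞) [Fact (1 ≤ p)] (hp : 1 < p) (hpt : p ≠ ⊤)
      (a b : ℝ) (hab : b < a) (f : E N → ℂ) (hf : MemWLp p a f) :=
    Lambda_ae_eq (z := z) hγ hL (hc α) (fun σ => hd α σ z) hp hpt hab hf
  refine ⟨fun α β β' z => ∫ σ in simplex α.length, c α β β' σ z,
    fun α β β' => (hc α β β').isCbInfty_integral (isCompact_simplex _),
    fun z => ⟨fun α => ⟨?_, ?_⟩, ?_⟩⟩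
  · intro p _ hp hpt a b hab f hf
    exact lambdaConverges hγ hL (hc α) (fun σ => hd α σ z) hp hpt hab hf
  · refine hasSmoothKernel_of_polyOp (hL.posDef hγ z) fun p _ hp hpt a b hab f hf => ?_
    exact hΛ α z p hp hpt a b hab f hf
  · refine hasSmoothKernel_of_polyOp (hL.posDef hγ z) fun p _ hp hpt a b hab f hf => ?_
    have h1 : ∀ᵐ x, ∀ α : Composition ℓ, Lambda L z α.blocksFun p b f x
        = polyOp (matA L z) 1 z f
          (polyOfCoeff ℓ fun β β' => ∫ σ in simplex α.length, c α β β' σ z) x := by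
      rw [ae_all_iff]; exact fun α => hΛ α z p hp hpt a b hab f hf
    -- The polynomial is linear in its coefficients, so summing the operators over the compositions
    -- amounts to summing the coefficients.
    have h2 : polyOfCoeff ℓ (fun β β' => ∑ α : Composition ℓ,
          ∫ σ in simplex α.length, c α β β' σ z)
        = ∑ α : Composition ℓ,
          polyOfCoeff ℓ fun β β' => ∫ σ in simplex α.length, c α β β' σ z := by
      simp only [polyOfCoeff, map_sum, Finset.sum_mul]
      exact Finset.sum_comm
    rw [h2, polyOp_sum (hL.posDef hγ z) one_pos hp hf]
    filter_upwards [h1] with x hx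
    rw [LambdaSum, Finset.sum_apply]
    exact Finset.sum_congr rfl fun α _ => hx α
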